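/- **Spaces.** For $F_\infty>0$ let $\mathcal D$ be the set of pairs $(u,F)$ of functions on $\mathbb R$ such that $u\in L^\infty(\mathbb R)$ has a weak derivative $u_x\in L^2(\mathbb R)$ (and $u$ denotes the continuous representative), $F\in L^\infty(\mathbb R)$ is nondecreasing and left continuous, $\lim_{x\to-\infty}F(x)=0$, $\|F\|_\infty=F_\infty$, and $\int_a^b u_x^2\,dx\le F(b^-)-F(a^+)$ for all $a<b$. Write $\mu$ for the finite positive Radon measure with $\mu((-\infty,x))=F(x)$. **Scheme.** Let $(u_0,F_0)\in\mathcal D$ with $\mu_0$ compactly supported, let $\alpha\in(0,1]$ be fixed, and for $\Delta x>0$ let $\Delta t=\frac{\alpha}{2\sqrt{F_\infty}}\sqrt{\Delta x}$, $x_j=j\Delta x$, $t^n=n\Delta t$. Let $\mathbb P_{\Delta x}(u,F)$ be the pair that equals $(u,F)$ at the points $x_j$, $j\in\mathbb Z$, and is linear in between. For a continuous pair $(u,F)$ that is linear on each $[x_j,x_{j+1}]$ let $T_\tau(u,F)$ be the pair that takes the values $u(x_j)+\frac12(F(x_j)-\frac12F_\infty)\tau$ and $F(x_j)$ at the point $x_j+u(x_j)\tau+\frac14(F(x_j)-\frac12F_\infty)\tau^2$,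 with linear interpolation in between. Put $(U^0,F^0)=\mathbb P_{\Delta x}(u_0,F_0)$, $(U^{n+1},F^{n+1})=\mathbb P_{\Delta x}T_{\Delta t}(U^n,F^n)$, and $(u_{\Delta x},F_{\Delta x})(t,\cdot)=\mathbb P_{\Delta x}T_\tau(U^n,F^n)$ for $t=t^n+\tau$, $\tau\in[0,\Delta t)$. **Conservative solutions.** A pair $(u,F)$ on $[0,\infty)\times\mathbb R$ is a conservative solution of $$u_t+uu_x=\tfrac12F-\tfrac14F_\infty,\qquad F_t+uF_x=0$$ with initial data $(u_0,F_0)$ if $u|_{t=0}=u_0$, $F|_{t=0}=F_0$, $u\in C^{0,1/2}([0,T]\times\mathbb R)$ for all $T\ge0$, $(u(t),F(t))\in\mathcal D$ and $\|F(t)\|_\infty=F_\infty$ for all $t\ge0$, and for all $\phi\in C_c^\infty([0,\infty)\times\mathbb R)$ $$\int_0^\infty\!\!\int_{\mathbb R}\phi_t u+\tfrac12\phi_x u^2+\phi\big(\tfrac12F-\tfrac14F_\infty\big)\,dx\,dt+\int_{\mathbb R}\phi(0,x)u_0(x)\,dx=0,$$ $$\int_0^\infty\!\!\int_{\mathbb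 R}\big(\phi_t+u\phi_x\big)\,d\mu(t)\,dt+\int_{\mathbb R}\phi(0,x)\,d\mu_0=0,$$ where $\mu(t)$ is the measure with $\mu(t)((-\infty,x))=F(t,x)$. **Theorem.** (i) Every sequence $\Delta x_k\to0$ of positive numbers has a subsequence along which $(u_{\Delta x},F_{\Delta x})$ converges to some $(u,F)$ in the following sense: for every $T\ge0$, $u_{\Delta x}\to u$ uniformly on $[0,T]\times\mathbb R$ and $F_{\Delta x}\to F$ in $C([0,T],L^1(\mathbb R))$ (that is, $\sup_{t\in[0,T]}\|F_{\Delta x}(t)-F(t)\|_1\to0$, and $F$ is continuous in time with respect to the $L^1$-distance), and for every $t\ge0$, $F_{\Delta x}(t,x)\to F(t,x)$ for almost every $x$; here $F(t,\cdot)$ denotes the left continuous representative. (ii) Whenever $(u,F)$ is the limit, in this sense, of $(u_{\Delta x_k},F_{\Delta x_k})$ for some positive sequence $\Delta x_k\to0$, it is a conservative solution with initial data $(u_0,F_0)$. (iii) For every test function $\phi\in C_c^\infty([0,\infty)\times\mathbb R)$, the left-hand sides of the two weak equations, with $(u,F)$ replaced by $(u_{\Delta x},F_{\Delta x})$ and the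 initial data by $(u_{\Delta x},F_{\Delta x})(0,\cdot)$, are $O(\sqrt{\Delta x})$ as $\Delta x\to0$. -/

import Mathlib

open MeasureTheory Filter Topology Set Asymptotics
open scoped ContDiff ENNReal

noncomputable section

namespace HunterSaxton

/-- `v` is the weak derivative of `u` on the real line. -/
def IsWeakDeriv (u v : ℝ → ℝ) : Prop :=
  ∀ φ : ℝ → ℝ, ContDiff ℝ ∞ φ → HasCompactSupport φ →
    ∫ x, u x * deriv φ x = - ∫ x, v x * φ x

/-- The space `𝓓` of pairs `(u, F)` with total energy `Finf`. A bounded function with weak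
derivative in `L²` has a unique continuous representative; `u` is this representative, so that
point values make sense. -/
structure InD (Finf : ℝ) (u F : ℝ → ℝ) : Prop where
  cont_u : Continuous u
  bdd_u : MemLp u ∞ volume
  bdd_F : MemLp F ∞ volume
  mono_F : Monotone F
  leftCont_F : ∀ x, ContinuousWithinAt F (Iic x) x
  lim_F : Tendsto F atBot (𝓝 0)
  norm_F : eLpNorm F ∞ volume = ENNReal.ofReal Finf
  energy : ∃ v : ℝ → ℝ, MemLp v 2 volume ∧ IsWeakDeriv u v ∧
    ∀ a b : ℝ, a < b →
      ∫ x in a..b, v x ^ 2 ≤ Function.leftLim F b - Function.rightLim F a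

open Classical in
/-- The positive Radon measure `μ` with distribution function `F`, that is,
`μ (-∞, x) = F x`, see `distMeasure_Iio`. -/
def distMeasure (F : ℝ → ℝ) : Measure ℝ :=
  if h : Monotone F then h.stieltjesFunction.measure else 0

/-- The defining property of `distMeasure F` for left continuous `F`. -/
theorem distMeasure_Iio {F : ℝ → ℝ} (hF : Monotone F)
    (hc : ∀ x, ContinuousWithinAt F (Iic x) x) (h0 : Tendsto F atBot (𝓝 0)) (x : ℝ) :
    distMeasure F (Iio x) = ENNReal.ofReal (F x) := by
  have hlim : Tendsto hF.stieltjesFunction atBot (𝓝 0) := by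
    refine tendsto_of_tendsto_of_tendsto_of_le_of_le h0
      (h0.comp (tendsto_atBot_add_const_right atBot (1 : ℝ) tendsto_id)) (fun y => ?_) (fun y => ?_)
    · rw [hF.stieltjesFunction_eq]
      exact hF.le_rightLim le_rfl
    · rw [hF.stieltjesFunction_eq]
      exact hF.rightLim_le (by simp)
  have hl : Function.leftLim hF.stieltjesFunction x = F x := by
    have h1 : Tendsto F (𝓝[<] x) (𝓝 (F x)) := (hc x).mono_left (nhdsWithin_mono _ Iio_subset_Iic_self)
    refine le_antisymm ?_ ?_
    · refine le_of_tendsto (hF.stieltjesFunction.mono.tendsto_leftLim x) ?_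
      filter_upwards [self_mem_nhdsWithin] with y hy
      rw [hF.stieltjesFunction_eq]
      exact hF.rightLim_le hy
    · refine le_of_tendsto h1 ?_
      filter_upwards [self_mem_nhdsWithin] with y hy
      refine (hF.le_rightLim le_rfl).trans ?_
      rw [← hF.stieltjesFunction_eq]
      exact hF.stieltjesFunction.mono.le_leftLim hy
  rw [distMeasure, dif_pos hF, StieltjesFunction.measure_Iio _ hlim, hl, sub_zero]

/-! ### The numerical scheme -/

/-- Piecewise linear interpolation of the values `V j` at the (increasing) breakpoints `X j`,
`j ∈ ℤ`; the point `x` lies in the cell `[X j, X (j + 1))` with `j` the largest index such that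
`X j ≤ x`. -/
def interp (X V : ℤ → ℝ) (x : ℝ) : ℝ :=
  let j : ℤ := sSup {j : ℤ | X j ≤ x}
  V j + (x - X j) / (X (j + 1) - X j) * (V (j + 1) - V j)

/-- The projection `ℙ_Δx` onto continuous piecewise linear pairs on the grid `Δx ℤ`. -/
def project (Δx : ℝ) (w : (ℝ → ℝ) × (ℝ → ℝ)) : (ℝ → ℝ) × (ℝ → ℝ) :=
  (interp (fun j => j * Δx) (fun j => w.1 (j * Δx)),
   interp (fun j => j * Δx) (fun j => w.2 (j * Δx)))

/-- Position at time `τ` of the characteristic that starts at the grid point `j Δx`. -/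
def charPos (Finf Δx τ : ℝ) (w : (ℝ → ℝ) × (ℝ → ℝ)) (j : ℤ) : ℝ :=
  j * Δx + w.1 (j * Δx) * τ + 1 / 4 * (w.2 (j * Δx) - 1 / 2 * Finf) * τ ^ 2

/-- The conservative solution operator `T_τ` on continuous pairs that are piecewise linear with
breakpoints in `Δx ℤ`, before wave breaking: the breakpoints move along characteristics, with
linear interpolation in between. -/
def evolve (Finf Δx τ : ℝ) (w : (ℝ → ℝ) × (ℝ → ℝ)) : (ℝ → ℝ) × (ℝ → ℝ) :=
  (interp (charPos Finf Δx τ w)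
      (fun j => w.1 (j * Δx) + 1 / 2 * (w.2 (j * Δx) - 1 / 2 * Finf) * τ),
   interp (charPos Finf Δx τ w) (fun j => w.2 (j * Δx)))

/-- The time step `Δt = α √Δx / (2 √F_∞)`. -/
def timeStep (Finf α Δx : ℝ) : ℝ := α / (2 * √Finf) * √Δx

/-- The iterates `(U⁰, F⁰) = ℙ (u₀, F₀)` and `(Uⁿ⁺¹, Fⁿ⁺¹) = ℙ T_Δt (Uⁿ, Fⁿ)`. -/
def iterate (Finf Δx Δt : ℝ) (w₀ : (ℝ → ℝ) × (ℝ → ℝ)) : ℕ → (ℝ → ℝ) × (ℝ → ℝ)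
  | 0 => project Δx w₀
  | n + 1 => project Δx (evolve Finf Δx Δt (iterate Finf Δx Δt w₀ n))

/-- The numerical solution at time `t`: `ℙ T_τ (Uⁿ, Fⁿ)` for `t = n Δt + τ`, `τ ∈ [0, Δt)`. -/
def numSol (Finf α : ℝ) (u₀ F₀ : ℝ → ℝ) (Δx t : ℝ) : (ℝ → ℝ) × (ℝ → ℝ) :=
  let Δt := timeStep Finf α Δx
  let n := ⌊t / Δt⌋₊
  project Δx (evolve Finf Δx (t - n * Δt) (iterate Finf Δx Δt (u₀, F₀) n))

/-- The component `u_Δx` of the numerical solution. -/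
def numU (Finf α : ℝ) (u₀ F₀ : ℝ → ℝ) (Δx t : ℝ) : ℝ → ℝ := (numSol Finf α u₀ F₀ Δx t).1

/-- The component `F_Δx` of the numerical solution. -/
def numF (Finf α : ℝ) (u₀ F₀ : ℝ → ℝ) (Δx t : ℝ) : ℝ → ℝ := (numSol Finf α u₀ F₀ Δx t).2

/-- `(u, F)` is the limit of the numerical solutions with grid sizes `δ 0, δ 1, …`:
`u_Δx → u` uniformly on every strip `[0, T] × ℝ`, and `F_Δx → F` in `C([0, T], L¹(ℝ))` and, for
every `t`, almost everywhere in `x`. As a limit in `L¹`, `F t` is determined almost everywhere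
only; `F t` denotes the left continuous representative. -/
structure IsSchemeLimit (Finf α : ℝ) (u₀ F₀ : ℝ → ℝ) (δ : ℕ → ℝ) (u F : ℝ → ℝ → ℝ) : Prop where
  tendsto_u : ∀ T : ℝ, 0 ≤ T →
    TendstoUniformlyOn (fun k (p : ℝ × ℝ) => numU Finf α u₀ F₀ (δ k) p.1 p.2)
      (fun p => u p.1 p.2) atTop (Icc 0 T ×ˢ univ)
  tendsto_F : ∀ T : ℝ, 0 ≤ T →
    Tendsto (fun k => ⨆ t ∈ Icc 0 T, eLpNorm (numF Finf α u₀ F₀ (δ k) t - F t) 1 volume)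
      atTop (𝓝 0)
  cont_F : ∀ s : ℝ, 0 ≤ s →
    Tendsto (fun t => eLpNorm (F t - F s) 1 volume) (𝓝[Ici 0] s) (𝓝 0)
  tendsto_F_ae : ∀ t : ℝ, 0 ≤ t →
    ∀ᵐ x, Tendsto (fun k => numF Finf α u₀ F₀ (δ k) t x) atTop (𝓝 (F t x))
  leftCont_F : ∀ t : ℝ, 0 ≤ t → ∀ x, ContinuousWithinAt (F t) (Iic x) x

/-! ### Conservative weak solutions -/

/-- Test functions in `C_c^∞([0, ∞) × ℝ)`, as restrictions of functions in `C_c^∞(ℝ × ℝ)`. -/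
def IsTestFunction (φ : ℝ → ℝ → ℝ) : Prop :=
  ContDiff ℝ ∞ (fun p : ℝ × ℝ => φ p.1 p.2) ∧ HasCompactSupport (fun p : ℝ × ℝ => φ p.1 p.2)

/-- Inner integral at time `t` in the weak form of `u_t + u u_x = F / 2 - F_∞ / 4`. -/
def innerU (Finf : ℝ) (u F φ : ℝ → ℝ → ℝ) (t : ℝ) : ℝ :=
  ∫ x, (deriv (fun s => φ s x) t * u t x + deriv (φ t) x * (1 / 2 * u t x ^ 2)
    + φ t x * (1 / 2 * F t x - 1 / 4 * Finf))

/-- Inner integral at time `t` in the weak form of the transport equation for `μ(t)`. -/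
def innerF (u F φ : ℝ → ℝ → ℝ) (t : ℝ) : ℝ :=
  ∫ x, (deriv (fun s => φ s x) t + u t x * deriv (φ t) x) ∂(distMeasure (F t))

/-- Left-hand side of the weak form of `u_t + u u_x = F / 2 - F_∞ / 4`. -/
def weakU (Finf : ℝ) (u₀ : ℝ → ℝ) (u F φ : ℝ → ℝ → ℝ) : ℝ :=
  (∫ t in Ioi 0, innerU Finf u F φ t) + ∫ x, φ 0 x * u₀ x

/-- Left-hand side of the weak form of the transport equation for `μ(t)`. -/
def weakF (F₀ : ℝ → ℝ) (u F φ : ℝ → ℝ → ℝ) : ℝ :=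
  (∫ t in Ioi 0, innerF u F φ t) + ∫ x, φ 0 x ∂(distMeasure F₀)

/-- `(u, F)` is a conservative solution of the Hunter–Saxton system with initial data
`(u₀, F₀)`. The condition `‖F(t)‖_∞ = F_∞` is part of `InD Finf`. -/
structure IsConservativeSolution (Finf : ℝ) (u₀ F₀ : ℝ → ℝ) (u F : ℝ → ℝ → ℝ) : Prop where
  init_u : u 0 = u₀
  init_F : F 0 = F₀
  bounded : ∀ T : ℝ, 0 ≤ T → ∃ M : ℝ, ∀ t ∈ Icc 0 T, ∀ x, |u t x| ≤ M
  holder : ∀ T : ℝ, 0 ≤ T → ∃ C : NNReal,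
    HolderOnWith C (1 / 2) (fun p : ℝ × ℝ => u p.1 p.2) (Icc 0 T ×ˢ univ)
  mem_D : ∀ t : ℝ, 0 ≤ t → InD Finf (u t) (F t)
  weak_u : ∀ φ, IsTestFunction φ →
    IntegrableOn (innerU Finf u F φ) (Ioi 0) ∧ weakU Finf u₀ u F φ = 0
  weak_F : ∀ φ, IsTestFunction φ →
    IntegrableOn (innerF u F φ) (Ioi 0) ∧ weakF F₀ u F φ = 0

end HunterSaxton

end

noncomputable section

namespace HunterSaxton

/-! ### Piecewise linear interpolation on a uniform grid -/

/-! The exact evolution sends a point ξ to X = ξ + uτ + ¼(F - ½F∞)τ², gives u the value V = u + ½(F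
- ½F∞)τ there, and carries F along. Increments between two points satisfy ΔX ΔF - (ΔV)² = Δx ΔF -
(Δu)², so the energy inequality (Δu)² ≤ Δx ΔF is transported exactly (`Transport.energy`).
Equivalently, c²x + 2cu + F is nondecreasing for every real c. In this form the inequality is linear
in (u, F), and therefore survives both the projection onto the grid and pointwise limits
(`EnergyIneq.gridInterp`, `EnergyIneq.of_tendsto`). On a grid of size Δx, F has slope at most F∞/Δx,
hence u has slope at most √(F∞/Δx), and the choice of Δt prevents characteristics from meeting
(`GridState.flowMap_expand`).

Stability. The grid size is a constant multiple of Δt², so a step, including its projection, moves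
information by a distance O(Δt). The relation `Dep` records this and composes over many steps. It
yields finite speed of propagation, energy in a bounded interval, sup bounds, and a modulus of
continuity in time up to O(Δt) (`InitData.num_time`).

Residuals. There are O(1/Δt) steps on the support of φ, so an error O(Δt²) per step gives O(Δt) =
O(√Δx) in total (`abs_residual_le`). For the measure equation, integrals against μ become integrals
over η in (0, F∞) by means of the quantile function. Transport moves the quantiles exactly along
characteristics and projection moves them by at most Δx (`DistFn.map_quantile`,
`Transport.abs_quantile_sub_le`). For the momentum equation, the integral is pulled back along the
characteristics and expanded in τ. The slope of F may be as large as F∞/Δx, but its integral is at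
most F∞. The projection error in u is pointwise only O(√Δx), but it is O(Δx) in L¹, because |Δu| ≤
½(Δx + ΔF) and ∫ (F(x+h) - F(x-h)) dx ≤ 2hF∞ (`TestBound.momentum_step`).

Convergence. A subsequence converges at all rational points. Asymptotic equicontinuity extends this
to all points for u, and monotone interlacing extends it to almost all points for F. Because u is
constant off the region carrying the energy, compactness makes the convergence uniform on ℝ, and
similarly uniform in time in L¹ for F. The residuals pass to the limit and vanish there. The energy
inequality of the limit makes u absolutely continuous with u_x² ≤ F_x almost everywhere, which gives
membership in 𝓓 (`InD.of_energyIneq`). -/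

theorem interp_eq {X V : ℤ → ℝ} (hX : Monotone X) {x : ℝ} {j : ℤ} (h₁ : X j ≤ x)
    (h₂ : x < X (j + 1)) :
    interp X V x = V j + (x - X j) / (X (j + 1) - X j) * (V (j + 1) - V j) := by
  have hj : sSup {j : ℤ | X j ≤ x} = j := by
    refine IsGreatest.csSup_eq ⟨h₁, fun k hk => ?_⟩
    by_contra hjk
    exact absurd ((hX (show j + 1 ≤ k by omega)).trans hk) (not_le.2 h₂)
  simp only [interp, hj]

/-- Piecewise linear interpolation of `f` on the grid `δ ℤ`. -/
def gridInterp (δ : ℝ) (f : ℝ → ℝ) (x : ℝ) : ℝ :=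
  f (⌊x / δ⌋ * δ) + (x / δ - ⌊x / δ⌋) * (f ((⌊x / δ⌋ + 1) * δ) - f (⌊x / δ⌋ * δ))

theorem floor_mul_le {δ : ℝ} (hδ : 0 < δ) (x : ℝ) : ⌊x / δ⌋ * δ ≤ x := by
  have := Int.floor_le (x / δ)
  rwa [le_div_iff₀ hδ] at this

theorem lt_floor_add_one_mul {δ : ℝ} (hδ : 0 < δ) (x : ℝ) : x < (⌊x / δ⌋ + 1) * δ := by
  have := Int.lt_floor_add_one (x / δ)
  rwa [div_lt_iff₀ hδ] at this

theorem grid_strictMono {δ : ℝ} (hδ : 0 < δ) : StrictMono fun j : ℤ => (j : ℝ) * δ :=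
  fun _ _ h => mul_lt_mul_of_pos_right (Int.cast_lt.2 h) hδ

theorem interp_grid {δ : ℝ} (hδ : 0 < δ) (f : ℝ → ℝ) :
    interp (fun j : ℤ => j * δ) (fun j : ℤ => f (j * δ)) = gridInterp δ f := by
  funext x
  rw [interp_eq (grid_strictMono hδ).monotone (floor_mul_le hδ x)
    (by push_cast; exact lt_floor_add_one_mul hδ x), gridInterp]
  push_cast
  congr 2
  field_simp
  ring

theorem project_eq {δ : ℝ} (hδ : 0 < δ) (w : (ℝ → ℝ) × (ℝ → ℝ)) :
    project δ w = (gridInterp δ w.1, gridInterp δ w.2) := by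
  simp only [project, interp_grid hδ]

theorem gridInterp_node {δ : ℝ} (hδ : 0 < δ) (f : ℝ → ℝ) (j : ℤ) :
    gridInterp δ f (j * δ) = f (j * δ) := by
  have h : (j : ℝ) * δ / δ = j := mul_div_cancel_right₀ _ hδ.ne'
  simp [gridInterp, h]

theorem gridInterp_congr {δ : ℝ} {f g : ℝ → ℝ} (h : ∀ j : ℤ, f (j * δ) = g (j * δ)) :
    gridInterp δ f = gridInterp δ g := by
  funext x
  have h1 := h (⌊x / δ⌋ + 1)
  push_cast at h1
  simp only [gridInterp, h, h1]

theorem gridInterp_idem {δ : ℝ} (hδ : 0 < δ) (f : ℝ → ℝ) :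
    gridInterp δ (gridInterp δ f) = gridInterp δ f :=
  gridInterp_congr fun j => gridInterp_node hδ f j

theorem gridInterp_add (δ : ℝ) (f g : ℝ → ℝ) (x : ℝ) :
    gridInterp δ (fun y => f y + g y) x = gridInterp δ f x + gridInterp δ g x := by
  simp only [gridInterp]; ring

theorem gridInterp_const_mul (δ c : ℝ) (f : ℝ → ℝ) (x : ℝ) :
    gridInterp δ (fun y => c * f y) x = c * gridInterp δ f x := by
  simp only [gridInterp]; ring

theorem gridInterp_id {δ : ℝ} (hδ : 0 < δ) (x : ℝ) : gridInterp δ (fun y => y) x = x := by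
  simp only [gridInterp]; field_simp; ring

theorem gridInterp_const (δ c x : ℝ) : gridInterp δ (fun _ => c) x = c := by
  simp [gridInterp]

theorem frac_nonneg (δ x : ℝ) : 0 ≤ x / δ - ⌊x / δ⌋ := sub_nonneg.2 (Int.floor_le _)

theorem frac_le_one (δ x : ℝ) : x / δ - ⌊x / δ⌋ ≤ 1 := by
  linarith [Int.lt_floor_add_one (x / δ)]

theorem gridInterp_le_max {δ : ℝ} {f : ℝ → ℝ} {x m : ℝ} (h₁ : f (⌊x / δ⌋ * δ) ≤ m)
    (h₂ : f ((⌊x / δ⌋ + 1) * δ) ≤ m) : gridInterp δ f x ≤ m := by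
  simp only [gridInterp]
  nlinarith [frac_nonneg δ x, frac_le_one δ x]

theorem min_le_gridInterp {δ : ℝ} {f : ℝ → ℝ} {x m : ℝ} (h₁ : m ≤ f (⌊x / δ⌋ * δ))
    (h₂ : m ≤ f ((⌊x / δ⌋ + 1) * δ)) : m ≤ gridInterp δ f x := by
  simp only [gridInterp]
  nlinarith [frac_nonneg δ x, frac_le_one δ x]

theorem abs_floor_mul_sub_le {δ : ℝ} (hδ : 0 < δ) (x : ℝ) : |⌊x / δ⌋ * δ - x| ≤ δ := by
  rw [abs_le]
  constructor <;> nlinarith [floor_mul_le hδ x, lt_floor_add_one_mul hδ x]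

theorem abs_floor_add_one_mul_sub_le {δ : ℝ} (hδ : 0 < δ) (x : ℝ) :
    |(⌊x / δ⌋ + 1) * δ - x| ≤ δ := by
  rw [abs_le]
  constructor <;> nlinarith [floor_mul_le hδ x, lt_floor_add_one_mul hδ x]

theorem gridInterp_le {δ : ℝ} (hδ : 0 < δ) {f : ℝ → ℝ} {x m : ℝ}
    (h : ∀ y, |y - x| ≤ δ → f y ≤ m) : gridInterp δ f x ≤ m :=
  gridInterp_le_max (h _ (abs_floor_mul_sub_le hδ x)) (h _ (abs_floor_add_one_mul_sub_le hδ x))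

theorem le_gridInterp {δ : ℝ} (hδ : 0 < δ) {f : ℝ → ℝ} {x m : ℝ}
    (h : ∀ y, |y - x| ≤ δ → m ≤ f y) : m ≤ gridInterp δ f x :=
  min_le_gridInterp (h _ (abs_floor_mul_sub_le hδ x)) (h _ (abs_floor_add_one_mul_sub_le hδ x))

theorem gridInterp_monotone {δ : ℝ} (hδ : 0 < δ) {f : ℝ → ℝ}
    (hf : ∀ j : ℤ, f (j * δ) ≤ f ((j + 1) * δ)) : Monotone (gridInterp δ f) := by
  have hm : Monotone fun j : ℤ => f (j * δ) :=
    monotone_int_of_le_succ fun j => by push_cast; exact hf j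
  intro x y hxy
  have hfl : ⌊x / δ⌋ ≤ ⌊y / δ⌋ := Int.floor_le_floor (div_le_div_of_nonneg_right hxy hδ.le)
  rcases hfl.eq_or_lt with h | h
  · simp only [gridInterp, ← h]
    have := hf ⌊x / δ⌋
    have h2 : x / δ ≤ y / δ := div_le_div_of_nonneg_right hxy hδ.le
    nlinarith
  · have h1 : gridInterp δ f x ≤ f ((⌊x / δ⌋ + 1) * δ) := gridInterp_le_max (hf _) le_rfl
    have h2 : f (⌊y / δ⌋ * δ) ≤ gridInterp δ f y := min_le_gridInterp le_rfl (hf _)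
    have h3 := hm (show ⌊x / δ⌋ + 1 ≤ ⌊y / δ⌋ by omega)
    push_cast at h3
    linarith

/-- Interpolation is linear and reproduces affine functions, so the claim is the monotonicity of the
interpolant of `C / δ * y - f y`. -/
theorem gridInterp_sub_le {δ C : ℝ} (hδ : 0 < δ) {f : ℝ → ℝ}
    (hf : ∀ j : ℤ, f ((j + 1) * δ) - f (j * δ) ≤ C) {x y : ℝ} (hxy : x ≤ y) :
    gridInterp δ f y - gridInterp δ f x ≤ C / δ * (y - x) := by
  have hm : Monotone (gridInterp δ fun y => C / δ * y + -1 * f y) := by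
    refine gridInterp_monotone hδ fun j => ?_
    have h1 := hf j
    have h2 : C / δ * ((j + 1) * δ) - C / δ * (j * δ) = C := by field_simp; ring
    linarith
  have := hm hxy
  rw [gridInterp_add, gridInterp_add, gridInterp_const_mul, gridInterp_const_mul,
    gridInterp_const_mul, gridInterp_const_mul, gridInterp_id hδ, gridInterp_id hδ] at this
  linarith

/-- The slope of the piecewise linear interpolation of `f` on the grid `δ ℤ`. -/
def gridSlope (δ : ℝ) (f : ℝ → ℝ) (x : ℝ) : ℝ :=
  (f ((⌊x / δ⌋ + 1) * δ) - f (⌊x / δ⌋ * δ)) / δ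

theorem measurable_gridSlope (δ : ℝ) (f : ℝ → ℝ) : Measurable (gridSlope δ f) := by
  have h : Measurable fun j : ℤ => (f ((j + 1) * δ) - f (j * δ)) / δ := measurable_from_top
  exact h.comp (Int.measurable_floor.comp (measurable_id.div_const δ))

/-- The floor selects half-open cells, closed on the left, so the right derivative exists at every
point, nodes included. One-sided derivatives suffice for the fundamental theorem of calculus and for
substitution. -/
theorem hasDerivWithinAt_gridInterp {δ : ℝ} (hδ : 0 < δ) (f : ℝ → ℝ) (x : ℝ) :
    HasDerivWithinAt (gridInterp δ f) (gridSlope δ f x) (Ioi x) x := by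
  set j := ⌊x / δ⌋ with hj
  have h : HasDerivWithinAt (fun y : ℝ => f (j * δ) + (y / δ - j) * (f ((j + 1) * δ) - f (j * δ)))
      (gridSlope δ f x) (Ioi x) x := by
    have h0 := ((((hasDerivAt_id x).div_const δ).sub_const (j : ℝ)).mul_const
      (f ((j + 1) * δ) - f (j * δ))).const_add (f (j * δ))
    have h1 : gridSlope δ f x = 1 / δ * (f ((j + 1) * δ) - f (j * δ)) := by
      rw [gridSlope, ← hj]; ring
    rw [h1]
    exact h0.hasDerivWithinAt
  refine h.congr_of_eventuallyEq ?_ (by simp only [gridInterp, ← hj])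
  filter_upwards [Ioo_mem_nhdsGT (lt_floor_add_one_mul hδ x)] with y hy
  have hyj : ⌊y / δ⌋ = j := by
    rw [Int.floor_eq_iff, le_div_iff₀ hδ, div_lt_iff₀ hδ]
    exact ⟨(floor_mul_le hδ x).trans hy.1.le, hy.2⟩
  simp only [gridInterp, hyj]

/-! ### The energy inequality -/

/-- The energy inequality `(Δu)² ≤ Δx ΔF` on all intervals, for nondecreasing `F`, in linearized
form, see `energyIneq_iff`. -/
def EnergyIneq (u F : ℝ → ℝ) : Prop :=
  ∀ c x y : ℝ, x ≤ y → c ^ 2 * x + 2 * c * u x + F x ≤ c ^ 2 * y + 2 * c * u y + F y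

theorem EnergyIneq.mono {u F : ℝ → ℝ} (h : EnergyIneq u F) : Monotone F := fun x y hxy => by
  simpa using h 0 x y hxy

theorem EnergyIneq.sq_le {u F : ℝ → ℝ} (h : EnergyIneq u F) {x y : ℝ} (hxy : x ≤ y) :
    (u y - u x) ^ 2 ≤ (y - x) * (F y - F x) := by
  rcases hxy.eq_or_lt with rfl | hlt
  · simp
  have hp : 0 < y - x := sub_pos.2 hlt
  -- This c minimizes the quadratic c²Δx + 2cΔu + ΔF.
  have := h (-(u y - u x) / (y - x)) x y hxy
  have h2 : (u y - u x) ^ 2 / (y - x) ≤ F y - F x := by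
    have e : (u y - u x) ^ 2 / (y - x) = - ((-(u y - u x) / (y - x)) ^ 2 * (y - x) +
        2 * (-(u y - u x) / (y - x)) * (u y - u x)) := by
      field_simp; ring
    rw [e]; linarith
  rw [div_le_iff₀ hp] at h2
  linarith

/-- A quadratic in c with nonnegative coefficients of c² and 1 is nonnegative for all c exactly when
its discriminant is not positive. -/
theorem energyIneq_iff {u F : ℝ → ℝ} :
    EnergyIneq u F ↔ ∀ x y, x ≤ y → F x ≤ F y ∧ (u y - u x) ^ 2 ≤ (y - x) * (F y - F x) := by
  refine ⟨fun h x y hxy => ⟨h.mono hxy, h.sq_le hxy⟩, fun h c x y hxy => ?_⟩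
  obtain ⟨h1, h2⟩ := h x y hxy
  rcases hxy.eq_or_lt with rfl | hlt
  · exact le_rfl
  have hp : 0 < y - x := sub_pos.2 hlt
  have h3 : 0 ≤ (y - x) * (c ^ 2 * (y - x) + 2 * c * (u y - u x) + (F y - F x)) := by
    nlinarith [sq_nonneg (c * (y - x) + (u y - u x))]
  have := nonneg_of_mul_nonneg_right h3 hp
  linarith

/-- The cases c = ±1. This form is linear in the increment of F, so it can be integrated in x
without losing a square root. -/
theorem EnergyIneq.abs_sub_le {u F : ℝ → ℝ} (h : EnergyIneq u F) {x y : ℝ} (hxy : x ≤ y) :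
    |u y - u x| ≤ 1 / 2 * ((y - x) + (F y - F x)) := by
  have h1 := h 1 x y hxy
  have h2 := h (-1) x y hxy
  rw [abs_le]
  constructor <;> linarith

theorem EnergyIneq.abs_sub_le_sqrt {u F : ℝ → ℝ} (h : EnergyIneq u F) {K : ℝ}
    (hK : ∀ x y, F y - F x ≤ K) (x y : ℝ) : |u y - u x| ≤ √(K * |y - x|) := by
  wlog hxy : x ≤ y generalizing x y
  · rw [abs_sub_comm, abs_sub_comm y x]; exact this y x (le_of_not_ge hxy)
  refine Real.abs_le_sqrt ((h.sq_le hxy).trans ?_)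
  rw [abs_of_nonneg (sub_nonneg.2 hxy), mul_comm]
  exact mul_le_mul_of_nonneg_right (hK _ _) (sub_nonneg.2 hxy)

theorem EnergyIneq.continuous {u F : ℝ → ℝ} (h : EnergyIneq u F) {K : ℝ}
    (hK : ∀ x y, F y - F x ≤ K) : Continuous u := by
  rw [continuous_iff_continuousAt]
  intro x
  rw [ContinuousAt, tendsto_iff_dist_tendsto_zero]
  have h0 : Tendsto (fun y => √(K * |y - x|)) (𝓝 x) (𝓝 0) := by
    have : Continuous fun y => √(K * |y - x|) := by fun_prop
    simpa using this.tendsto x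
  exact squeeze_zero (fun _ => dist_nonneg) (fun y => h.abs_sub_le_sqrt hK x y) h0

/-- For fixed c the inequality says that one function, linear in u and F, is nondecreasing, and
interpolation respects linear combinations, the identity and monotonicity. -/
theorem EnergyIneq.gridInterp {u F : ℝ → ℝ} (h : EnergyIneq u F) {δ : ℝ} (hδ : 0 < δ) :
    EnergyIneq (gridInterp δ u) (gridInterp δ F) := by
  intro c x y hxy
  have hm : Monotone (HunterSaxton.gridInterp δ fun y => (c ^ 2 * y + 2 * c * u y) + F y) :=
    gridInterp_monotone hδ fun j => h c _ _ (by nlinarith)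
  have e : ∀ x, HunterSaxton.gridInterp δ (fun y => (c ^ 2 * y + 2 * c * u y) + F y) x =
      c ^ 2 * x + 2 * c * HunterSaxton.gridInterp δ u x + HunterSaxton.gridInterp δ F x := by
    intro x
    rw [gridInterp_add, gridInterp_add, gridInterp_const_mul, gridInterp_const_mul,
      gridInterp_id hδ]
  have := hm hxy
  rwa [e, e] at this

/-! ### Transport along characteristics -/

/-- A pair of piecewise linear functions on the grid `δ ℤ` that satisfies the energy inequality. -/
structure GridState (Finf δ : ℝ) (U F : ℝ → ℝ) : Prop where
  energy : EnergyIneq U F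
  interp_u : gridInterp δ U = U
  interp_F : gridInterp δ F = F
  nonneg : ∀ x, 0 ≤ F x
  le : ∀ x, F x ≤ Finf

/-- The characteristics at time `τ` as a function of the initial position. -/
def flowMap (Finf τ : ℝ) (U F : ℝ → ℝ) (ξ : ℝ) : ℝ :=
  ξ + U ξ * τ + 1 / 4 * (F ξ - 1 / 2 * Finf) * τ ^ 2

/-- The pair `(V, H)` arises from `(U, F)` by transport along the characteristics for time `τ`,
and these do not collide. -/
structure Transport (Finf τ : ℝ) (U F V H : ℝ → ℝ) : Prop where
  u_eq : ∀ ξ, V (flowMap Finf τ U F ξ) = U ξ + 1 / 2 * (F ξ - 1 / 2 * Finf) * τ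
  F_eq : ∀ ξ, H (flowMap Finf τ U F ξ) = F ξ
  expand : ∀ x y, x ≤ y → (y - x) / 2 ≤ flowMap Finf τ U F y - flowMap Finf τ U F x
  surj : Function.Surjective (flowMap Finf τ U F)

theorem GridState.sub_le {Finf δ : ℝ} {U F : ℝ → ℝ} (h : GridState Finf δ U F) (x y : ℝ) :
    F y - F x ≤ Finf := by linarith [h.le y, h.nonneg x]

theorem GridState.F_sub_le {Finf δ : ℝ} {U F : ℝ → ℝ} (hδ : 0 < δ) (h : GridState Finf δ U F)
    {x y : ℝ} (hxy : x ≤ y) : F y - F x ≤ Finf / δ * (y - x) := by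
  have := gridInterp_sub_le hδ (f := F) (C := Finf) (fun j => h.sub_le _ _) hxy
  rwa [h.interp_F] at this

theorem GridState.continuous_u {Finf δ : ℝ} {U F : ℝ → ℝ} (h : GridState Finf δ U F) :
    Continuous U := h.energy.continuous h.sub_le

theorem GridState.continuous_F {Finf δ : ℝ} {U F : ℝ → ℝ} (hδ : 0 < δ) (h : GridState Finf δ U F) :
    Continuous F := by
  have hK : 0 ≤ Finf / δ := div_nonneg ((h.nonneg 0).trans (h.le 0)) hδ.le
  have : LipschitzWith (Finf / δ).toNNReal F := by
    refine LipschitzWith.of_le_add_mul _ fun x y => ?_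
    rw [Real.coe_toNNReal _ hK, Real.dist_eq]
    rcases le_total x y with hxy | hxy
    · linarith [h.energy.mono hxy, mul_nonneg hK (abs_nonneg (x - y))]
    · rw [abs_of_nonneg (sub_nonneg.2 hxy)]
      linarith [h.F_sub_le hδ hxy]
  exact this.continuous

/-- Since F has slope at most `Finf / δ`, the energy inequality gives |Δu| ≤ √(Finf/δ) Δx, and the
hypothesis on τ turns this into |Δu| τ ≤ Δx/2. The term in τ² only widens the gap, because F is
nondecreasing. -/
theorem GridState.flowMap_expand {Finf δ τ : ℝ} {U F : ℝ → ℝ} (hδ : 0 < δ)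
    (h : GridState Finf δ U F) (hcfl : 4 * Finf * τ ^ 2 ≤ δ) {x y : ℝ} (hxy : x ≤ y) :
    (y - x) / 2 ≤ flowMap Finf τ U F y - flowMap Finf τ U F x := by
  have hd : 0 ≤ y - x := sub_nonneg.2 hxy
  have h1 := h.F_sub_le hδ hxy
  have h2 := h.energy.sq_le hxy
  have h3 := h.energy.mono hxy
  have h4 : Finf / δ * τ ^ 2 ≤ 1 / 4 := by
    rw [div_mul_eq_mul_div, div_le_iff₀ hδ]; linarith
  have h5 : ((U y - U x) * τ) ^ 2 ≤ ((y - x) / 2) ^ 2 := by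
    calc ((U y - U x) * τ) ^ 2 = (U y - U x) ^ 2 * τ ^ 2 := by ring
      _ ≤ ((y - x) * (Finf / δ * (y - x))) * τ ^ 2 := by
        refine mul_le_mul_of_nonneg_right (h2.trans ?_) (sq_nonneg _)
        exact mul_le_mul_of_nonneg_left h1 hd
      _ = (Finf / δ * τ ^ 2) * (y - x) ^ 2 := by ring
      _ ≤ 1 / 4 * (y - x) ^ 2 := mul_le_mul_of_nonneg_right h4 (sq_nonneg _)
      _ = ((y - x) / 2) ^ 2 := by ring
  have h6 := (abs_le_of_sq_le_sq' h5 (by linarith)).1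
  have h7 : 0 ≤ (F y - F x) * τ ^ 2 := mul_nonneg (sub_nonneg.2 h3) (sq_nonneg _)
  simp only [flowMap]
  nlinarith

theorem surjective_of_expand {X : ℝ → ℝ} (hc : Continuous X)
    (h : ∀ x y, x ≤ y → (y - x) / 2 ≤ X y - X x) : Function.Surjective X := by
  refine hc.surjective ?_ ?_
  · refine tendsto_atTop_mono' atTop (f₁ := fun y => y / 2 + X 0) ?_
      (tendsto_atTop_add_const_right _ _ (tendsto_id.atTop_div_const two_pos))
    filter_upwards [eventually_ge_atTop 0] with y hy
    linarith [h 0 y hy]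
  · refine tendsto_atBot_mono' atBot (f₁ := fun y => y / 2 + X 0) ?_
      (tendsto_atBot_add_const_right _ _ (tendsto_id.atBot_div_const two_pos))
    filter_upwards [eventually_le_atBot 0] with y hy
    linarith [h y 0 hy]

theorem GridState.continuous_flowMap {Finf δ : ℝ} {U F : ℝ → ℝ} (hδ : 0 < δ)
    (h : GridState Finf δ U F) (τ : ℝ) : Continuous (flowMap Finf τ U F) := by
  have h1 := h.continuous_u
  have h2 := h.continuous_F hδ
  unfold flowMap
  fun_prop

/-- The flow map is an affine combination of the identity, U and F, hence piecewise linear on the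
same grid. -/
theorem GridState.gridInterp_flowMap {Finf δ : ℝ} {U F : ℝ → ℝ} (hδ : 0 < δ)
    (h : GridState Finf δ U F) (τ : ℝ) :
    gridInterp δ (flowMap Finf τ U F) = flowMap Finf τ U F := by
  funext x
  have e : flowMap Finf τ U F =
      fun ξ => (ξ + τ * U ξ) + (1 / 4 * τ ^ 2 * F ξ + -(1 / 8 * Finf * τ ^ 2)) := by
    funext ξ; simp only [flowMap]; ring
  rw [e, gridInterp_add, gridInterp_add, gridInterp_add, gridInterp_const_mul,
    gridInterp_const_mul, gridInterp_id hδ, gridInterp_const, h.interp_u, h.interp_F]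

/-- On each cell the flow map is affine and increasing, so the relative position of a point between
two breakpoints does not change as these move. -/
theorem GridState.interp_charPos {Finf δ τ : ℝ} {U F : ℝ → ℝ} (hδ : 0 < δ)
    (h : GridState Finf δ U F) (hcfl : 4 * Finf * τ ^ 2 ≤ δ) (g : ℝ → ℝ) (ξ : ℝ) :
    interp (charPos Finf δ τ (U, F)) (fun j => g (j * δ)) (flowMap Finf τ U F ξ) =
      gridInterp δ g ξ := by
  have hX : charPos Finf δ τ (U, F) = fun j : ℤ => flowMap Finf τ U F (j * δ) := rfl
  have hsm : StrictMono (flowMap Finf τ U F) := fun x y hxy => by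
    linarith [h.flowMap_expand hδ hcfl hxy.le]
  have h1 : charPos Finf δ τ (U, F) ⌊ξ / δ⌋ ≤ flowMap Finf τ U F ξ := by
    rw [hX]; exact hsm.monotone (floor_mul_le hδ ξ)
  have h2 : flowMap Finf τ U F ξ < charPos Finf δ τ (U, F) (⌊ξ / δ⌋ + 1) := by
    rw [hX]; push_cast; exact hsm (lt_floor_add_one_mul hδ ξ)
  have h3 : Monotone (charPos Finf δ τ (U, F)) := by
    rw [hX]; exact hsm.monotone.comp (grid_strictMono hδ).monotone
  rw [interp_eq h3 h1 h2]
  have h4 : flowMap Finf τ U F ξ - charPos Finf δ τ (U, F) ⌊ξ / δ⌋ = (ξ / δ - ⌊ξ / δ⌋) *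
      (charPos Finf δ τ (U, F) (⌊ξ / δ⌋ + 1) - charPos Finf δ τ (U, F) ⌊ξ / δ⌋) := by
    rw [hX]
    have := congrFun (h.gridInterp_flowMap hδ τ) ξ
    simp only [gridInterp] at this
    push_cast
    linarith
  have h5 : charPos Finf δ τ (U, F) (⌊ξ / δ⌋ + 1) - charPos Finf δ τ (U, F) ⌊ξ / δ⌋ ≠ 0 :=
    (sub_pos.2 (h1.trans_lt h2)).ne'
  rw [h4, mul_div_cancel_right₀ _ h5, gridInterp]
  push_cast
  rfl

theorem GridState.transport {Finf δ τ : ℝ} {U F : ℝ → ℝ} (hδ : 0 < δ)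
    (h : GridState Finf δ U F) (hcfl : 4 * Finf * τ ^ 2 ≤ δ) :
    Transport Finf τ U F (evolve Finf δ τ (U, F)).1 (evolve Finf δ τ (U, F)).2 where
  u_eq ξ := by
    rw [show (evolve Finf δ τ (U, F)).1 (flowMap Finf τ U F ξ) =
      gridInterp δ (fun y => U y + 1 / 2 * (F y - 1 / 2 * Finf) * τ) ξ from
      h.interp_charPos hδ hcfl (fun y => U y + 1 / 2 * (F y - 1 / 2 * Finf) * τ) ξ]
    rw [show (fun y => U y + 1 / 2 * (F y - 1 / 2 * Finf) * τ) =
      fun y => U y + (1 / 2 * τ * F y + - (1 / 4 * Finf * τ)) by funext y; ring, gridInterp_add,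
      gridInterp_add, gridInterp_const_mul, gridInterp_const, h.interp_u, h.interp_F]
    ring
  F_eq ξ := by
    rw [show (evolve Finf δ τ (U, F)).2 (flowMap Finf τ U F ξ) = gridInterp δ F ξ from
      h.interp_charPos hδ hcfl F ξ, h.interp_F]
  expand x y hxy := h.flowMap_expand hδ hcfl hxy
  surj := surjective_of_expand (h.continuous_flowMap hδ τ) fun x y hxy => h.flowMap_expand hδ hcfl hxy

theorem Transport.le_iff {Finf τ : ℝ} {U F V H : ℝ → ℝ} (h : Transport Finf τ U F V H) {x y : ℝ} :
    flowMap Finf τ U F x ≤ flowMap Finf τ U F y ↔ x ≤ y := by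
  have hsm : StrictMono (flowMap Finf τ U F) := fun x y hxy => by linarith [h.expand x y hxy.le]
  exact hsm.le_iff_le

/-- In ΔX ΔF - (ΔV)² the terms τ Δu ΔF and ¼τ²(ΔF)² cancel, which leaves Δx ΔF - (Δu)². This is the
conservation of energy along characteristics. -/
theorem Transport.energy {Finf τ : ℝ} {U F V H : ℝ → ℝ} (h : Transport Finf τ U F V H)
    (hE : EnergyIneq U F) : EnergyIneq V H := by
  rw [energyIneq_iff]
  intro x y hxy
  obtain ⟨ξ, rfl⟩ := h.surj x
  obtain ⟨ζ, rfl⟩ := h.surj y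
  rw [h.le_iff] at hxy
  rw [h.u_eq, h.u_eq, h.F_eq, h.F_eq]
  refine ⟨hE.mono hxy, ?_⟩
  simp only [flowMap]
  linarith [hE.sq_le hxy]

/-- The values at a point of a pair `(U', F')` are controlled by the values of `(U, F)` at distance
at most `h`, up to an error `c` in the first component. -/
structure Dep (h c : ℝ) (U F U' F' : ℝ → ℝ) : Prop where
  F_le : ∀ x, F' x ≤ F (x + h)
  le_F : ∀ x, F (x - h) ≤ F' x
  u_le : ∀ x m, (∀ y, |y - x| ≤ h → U y ≤ m) → U' x ≤ m + c
  le_u : ∀ x m, (∀ y, |y - x| ≤ h → m ≤ U y) → m - c ≤ U' x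

theorem Dep.refl (U F : ℝ → ℝ) : Dep 0 0 U F U F where
  F_le x := by simp
  le_F x := by simp
  u_le x m h := by simpa using h x (by simp)
  le_u x m h := by simpa using h x (by simp)

theorem Dep.trans {h₁ c₁ h₂ c₂ : ℝ} {U F U' F' U'' F'' : ℝ → ℝ} (d₁ : Dep h₁ c₁ U F U' F')
    (d₂ : Dep h₂ c₂ U' F' U'' F'') : Dep (h₁ + h₂) (c₁ + c₂) U F U'' F'' where
  F_le x := (d₂.F_le x).trans ((d₁.F_le _).trans_eq (by ring_nf))
  le_F x := le_trans (by ring_nf; exact le_rfl) ((d₁.le_F (x - h₂)).trans (d₂.le_F x))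
  u_le x m h := by
    rw [← add_assoc]
    refine d₂.u_le x _ fun y hy => d₁.u_le y _ fun z hz => h z ?_
    calc |z - x| = |(z - y) + (y - x)| := by ring_nf
      _ ≤ _ := (abs_add_le _ _).trans (add_le_add hz hy)
  le_u x m h := by
    rw [← sub_sub]
    refine d₂.le_u x _ fun y hy => d₁.le_u y _ fun z hz => h z ?_
    calc |z - x| = |(z - y) + (y - x)| := by ring_nf
      _ ≤ _ := (abs_add_le _ _).trans (add_le_add hz hy)

theorem Dep.weaken {h c h' c' : ℝ} {U F U' F' : ℝ → ℝ} (d : Dep h c U F U' F') (hF : Monotone F)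
    (hh : h ≤ h') (hc : c ≤ c') : Dep h' c' U F U' F' where
  F_le x := (d.F_le x).trans (hF (by linarith))
  le_F x := (hF (by linarith)).trans (d.le_F x)
  u_le x m H := (d.u_le x m fun y hy => H y (hy.trans hh)).trans (by linarith)
  le_u x m H := le_trans (by linarith) (d.le_u x m fun y hy => H y (hy.trans hh))

theorem Dep.abs_le {h c M : ℝ} {U F U' F' : ℝ → ℝ} (d : Dep h c U F U' F') (hM : ∀ x, |U x| ≤ M)
    (x : ℝ) : |U' x| ≤ M + c := by
  rw [_root_.abs_le]
  constructor
  · linarith [d.le_u x (-M) fun y _ => (_root_.abs_le.1 (hM y)).1]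
  · exact d.u_le x M fun y _ => (_root_.abs_le.1 (hM y)).2

theorem Dep.abs_F_sub_le {h c : ℝ} {U F U' F' : ℝ → ℝ} (d : Dep h c U F U' F') (hF : Monotone F)
    (hh : 0 ≤ h) (x : ℝ) : |F' x - F x| ≤ F (x + h) - F (x - h) := by
  rw [_root_.abs_le]
  have h1 : F (x - h) ≤ F x := hF (by linarith)
  have h2 : F x ≤ F (x + h) := hF (by linarith)
  constructor <;> linarith [d.F_le x, d.le_F x]

/-- The bound has x-integral of order c + h over a bounded interval, whereas the pointwise bound
`Dep.abs_u_sub_le_sqrt` is only of order c + √h. -/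
theorem Dep.abs_u_sub_le {h c : ℝ} {U F U' F' : ℝ → ℝ} (d : Dep h c U F U' F')
    (hE : EnergyIneq U F) (x : ℝ) :
    |U' x - U x| ≤ c + 1 / 2 * (h + (F (x + h) - F (x - h))) := by
  have key : ∀ y, |y - x| ≤ h → |U y - U x| ≤ 1 / 2 * (h + (F (x + h) - F (x - h))) := by
    intro y hy
    obtain ⟨h1, h2⟩ := _root_.abs_le.1 hy
    have m1 : F (x - h) ≤ F y := hE.mono (by linarith)
    have m2 : F y ≤ F (x + h) := hE.mono (by linarith)
    have m3 : F (x - h) ≤ F x := hE.mono (by linarith)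
    have m4 : F x ≤ F (x + h) := hE.mono (by linarith)
    rcases le_total x y with hxy | hxy
    · linarith [hE.abs_sub_le hxy]
    · rw [abs_sub_comm]; linarith [hE.abs_sub_le hxy]
  rw [_root_.abs_le]
  constructor
  · linarith [d.le_u x (U x - 1 / 2 * (h + (F (x + h) - F (x - h)))) fun y hy => by
      linarith [(_root_.abs_le.1 (key y hy)).1]]
  · linarith [d.u_le x (U x + 1 / 2 * (h + (F (x + h) - F (x - h)))) fun y hy => by
      linarith [(_root_.abs_le.1 (key y hy)).2]]

theorem Dep.abs_u_sub_le_sqrt {h c K : ℝ} {U F U' F' : ℝ → ℝ} (d : Dep h c U F U' F')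
    (hE : EnergyIneq U F) (hK : ∀ x y, F y - F x ≤ K) (x : ℝ) :
    |U' x - U x| ≤ c + √(K * h) := by
  have hK0 : 0 ≤ K := by simpa using hK 0 0
  have key : ∀ y, |y - x| ≤ h → |U y - U x| ≤ √(K * h) := fun y hy =>
    (hE.abs_sub_le_sqrt hK x y).trans (Real.sqrt_le_sqrt (mul_le_mul_of_nonneg_left hy hK0))
  rw [_root_.abs_le]
  constructor
  · linarith [d.le_u x (U x - √(K * h)) fun y hy => by linarith [(_root_.abs_le.1 (key y hy)).1]]
  · linarith [d.u_le x (U x + √(K * h)) fun y hy => by linarith [(_root_.abs_le.1 (key y hy)).2]]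

theorem abs_force_le {Finf F : ℝ} (h₀ : 0 ≤ F) (h₁ : F ≤ Finf) :
    |F - 1 / 2 * Finf| ≤ 1 / 2 * Finf := by
  rw [_root_.abs_le]; constructor <;> linarith

theorem abs_flowMap_sub_le {Finf τ M : ℝ} {U F : ℝ → ℝ} (hτ : 0 ≤ τ) (hF₀ : ∀ x, 0 ≤ F x)
    (hF₁ : ∀ x, F x ≤ Finf) (hM : ∀ x, |U x| ≤ M) (ξ : ℝ) :
    |flowMap Finf τ U F ξ - ξ| ≤ M * τ + 1 / 8 * Finf * τ ^ 2 := by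
  have h1 := mul_le_mul_of_nonneg_right (hM ξ) hτ
  have h2 := mul_le_mul_of_nonneg_right (abs_force_le (hF₀ ξ) (hF₁ ξ)) (sq_nonneg τ)
  calc |flowMap Finf τ U F ξ - ξ| = |U ξ * τ + 1 / 4 * ((F ξ - 1 / 2 * Finf) * τ ^ 2)| := by
        simp only [flowMap]; ring_nf
    _ ≤ |U ξ * τ| + |1 / 4 * ((F ξ - 1 / 2 * Finf) * τ ^ 2)| := abs_add_le _ _
    _ = |U ξ| * τ + 1 / 4 * (|F ξ - 1 / 2 * Finf| * τ ^ 2) := by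
        rw [abs_mul, abs_mul, abs_mul, abs_of_nonneg hτ, abs_of_nonneg (sq_nonneg τ),
          abs_of_nonneg (by norm_num : (0 : ℝ) ≤ 1 / 4)]
    _ ≤ _ := by linarith

/-- The value at x comes from the foot of the characteristic through x. The shift bounds the
displacement, and the second constant bounds the change of u, since the acceleration is at most
`Finf / 4`. -/
theorem Transport.dep {Finf τ M : ℝ} {U F V H : ℝ → ℝ} (h : Transport Finf τ U F V H)
    (hτ : 0 ≤ τ) (hF : Monotone F) (hF₀ : ∀ x, 0 ≤ F x) (hF₁ : ∀ x, F x ≤ Finf)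
    (hM : ∀ x, |U x| ≤ M) :
    Dep (M * τ + 1 / 8 * Finf * τ ^ 2) (1 / 4 * Finf * τ) U F V H where
  F_le x := by
    obtain ⟨ξ, rfl⟩ := h.surj x
    rw [h.F_eq]
    exact hF (by linarith [(abs_le.1 (abs_flowMap_sub_le hτ hF₀ hF₁ hM ξ)).1])
  le_F x := by
    obtain ⟨ξ, rfl⟩ := h.surj x
    rw [h.F_eq]
    exact hF (by linarith [(abs_le.1 (abs_flowMap_sub_le hτ hF₀ hF₁ hM ξ)).2])
  u_le x m H := by
    obtain ⟨ξ, rfl⟩ := h.surj x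
    have h1 := H ξ (by rw [abs_sub_comm]; exact abs_flowMap_sub_le hτ hF₀ hF₁ hM ξ)
    have h2 := mul_le_mul_of_nonneg_right (abs_le.1 (abs_force_le (hF₀ ξ) (hF₁ ξ))).2 hτ
    rw [h.u_eq]
    linarith
  le_u x m H := by
    obtain ⟨ξ, rfl⟩ := h.surj x
    have h1 := H ξ (by rw [abs_sub_comm]; exact abs_flowMap_sub_le hτ hF₀ hF₁ hM ξ)
    have h2 := mul_le_mul_of_nonneg_right (abs_le.1 (abs_force_le (hF₀ ξ) (hF₁ ξ))).1 hτ
    rw [h.u_eq]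
    linarith

/-- An interpolated value is a convex combination of two nodal values at distance at most δ. -/
theorem dep_gridInterp {δ : ℝ} (hδ : 0 < δ) (V : ℝ → ℝ) {H : ℝ → ℝ} (hH : Monotone H) :
    Dep δ 0 V H (gridInterp δ V) (gridInterp δ H) where
  F_le x := gridInterp_le hδ fun y hy => hH (by linarith [(abs_le.1 hy).2])
  le_F x := le_gridInterp hδ fun y hy => hH (by linarith [(abs_le.1 hy).1])
  u_le x m h := by simpa using gridInterp_le hδ h
  le_u x m h := by simpa using le_gridInterp hδ h

theorem gridState_gridInterp {Finf δ : ℝ} (hδ : 0 < δ) {V H : ℝ → ℝ} (hE : EnergyIneq V H)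
    (h₀ : ∀ x, 0 ≤ H x) (h₁ : ∀ x, H x ≤ Finf) :
    GridState Finf δ (gridInterp δ V) (gridInterp δ H) where
  energy := hE.gridInterp hδ
  interp_u := gridInterp_idem hδ V
  interp_F := gridInterp_idem hδ H
  nonneg _ := le_gridInterp hδ fun y _ => h₀ y
  le _ := gridInterp_le hδ fun y _ => h₁ y

theorem Transport.nonneg {Finf τ : ℝ} {U F V H : ℝ → ℝ} (h : Transport Finf τ U F V H)
    (hF₀ : ∀ x, 0 ≤ F x) (x : ℝ) : 0 ≤ H x := by
  obtain ⟨ξ, rfl⟩ := h.surj x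
  rw [h.F_eq]; exact hF₀ ξ

theorem Transport.le {Finf τ : ℝ} {U F V H : ℝ → ℝ} (h : Transport Finf τ U F V H)
    (hF₁ : ∀ x, F x ≤ Finf) (x : ℝ) : H x ≤ Finf := by
  obtain ⟨ξ, rfl⟩ := h.surj x
  rw [h.F_eq]; exact hF₁ ξ

/-! ### Bounds for the numerical solution -/

/-- Initial data with energy in `[-R, R]`. -/
structure InitData (Finf M₀ R : ℝ) (u₀ F₀ : ℝ → ℝ) : Prop where
  energy : EnergyIneq u₀ F₀
  nonneg : ∀ x, 0 ≤ F₀ x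
  le : ∀ x, F₀ x ≤ Finf
  abs_le : ∀ x, |u₀ x| ≤ M₀
  eq_zero : ∀ x, x ≤ -R → F₀ x = 0
  eq_Finf : ∀ x, R ≤ x → F₀ x = Finf

/-- One step of length `τ` of the scheme. -/
def step (Finf δ τ : ℝ) (w : (ℝ → ℝ) × (ℝ → ℝ)) : (ℝ → ℝ) × (ℝ → ℝ) :=
  project δ (evolve Finf δ τ w)

theorem step_eq {δ : ℝ} (hδ : 0 < δ) (Finf τ : ℝ) (w : (ℝ → ℝ) × (ℝ → ℝ)) :
    step Finf δ τ w = (gridInterp δ (evolve Finf δ τ w).1, gridInterp δ (evolve Finf δ τ w).2) :=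
  project_eq hδ _

theorem GridState.step_state {Finf δ τ : ℝ} {w : (ℝ → ℝ) × (ℝ → ℝ)} (hδ : 0 < δ)
    (h : GridState Finf δ w.1 w.2) (hcfl : 4 * Finf * τ ^ 2 ≤ δ) :
    GridState Finf δ (step Finf δ τ w).1 (step Finf δ τ w).2 := by
  have ht := h.transport hδ hcfl
  rw [step_eq hδ]
  exact gridState_gridInterp hδ (ht.energy h.energy) (ht.nonneg h.nonneg) (ht.le h.le)

theorem GridState.step_dep {Finf δ τ M : ℝ} {w : (ℝ → ℝ) × (ℝ → ℝ)} (hδ : 0 < δ)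
    (h : GridState Finf δ w.1 w.2) (hτ : 0 ≤ τ) (hcfl : 4 * Finf * τ ^ 2 ≤ δ)
    (hM : ∀ x, |w.1 x| ≤ M) :
    Dep (M * τ + 1 / 8 * Finf * τ ^ 2 + δ) (1 / 4 * Finf * τ) w.1 w.2
      (step Finf δ τ w).1 (step Finf δ τ w).2 := by
  have ht := h.transport hδ hcfl
  rw [step_eq hδ]
  have d := (ht.dep hτ h.energy.mono h.nonneg h.le hM).trans
    (dep_gridInterp hδ _ (ht.energy h.energy).mono)
  rwa [add_zero] at d

theorem GridState.step_zero {Finf δ : ℝ} {w : (ℝ → ℝ) × (ℝ → ℝ)} (hδ : 0 < δ)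
    (h : GridState Finf δ w.1 w.2) : step Finf δ 0 w = w := by
  have ht := h.transport (τ := 0) hδ (by simp; exact hδ.le)
  have hX : ∀ ξ, flowMap Finf 0 w.1 w.2 ξ = ξ := fun ξ => by simp [flowMap]
  have h1 : (evolve Finf δ 0 w).1 = w.1 := by
    funext ξ; have := ht.u_eq ξ; rw [hX] at this; simpa using this
  have h2 : (evolve Finf δ 0 w).2 = w.2 := by
    funext ξ; have := ht.F_eq ξ; rw [hX] at this; simpa using this
  rw [step_eq hδ, h1, h2, h.interp_u, h.interp_F]

/-! ### Stability over many steps -/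

section Iterate

variable {Finf M₀ R δ Δt : ℝ} {u₀ F₀ : ℝ → ℝ}

theorem InitData.iterate_state (hI : InitData Finf M₀ R u₀ F₀) (hδ : 0 < δ)
    (hcfl : 4 * Finf * Δt ^ 2 ≤ δ) (n : ℕ) :
    GridState Finf δ (iterate Finf δ Δt (u₀, F₀) n).1 (iterate Finf δ Δt (u₀, F₀) n).2 := by
  induction n with
  | zero =>
    rw [iterate, project_eq hδ]
    exact gridState_gridInterp hδ hI.energy hI.nonneg hI.le
  | succ n ih => exact ih.step_state hδ hcfl

theorem InitData.Finf_nonneg (hI : InitData Finf M₀ R u₀ F₀) : 0 ≤ Finf :=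
  (hI.nonneg 0).trans (hI.le 0)

theorem InitData.M_nonneg (hI : InitData Finf M₀ R u₀ F₀) : 0 ≤ M₀ :=
  (abs_nonneg _).trans (hI.abs_le 0)

theorem InitData.abs_iterate_le (hI : InitData Finf M₀ R u₀ F₀) (hδ : 0 < δ) (hΔt : 0 ≤ Δt)
    (hcfl : 4 * Finf * Δt ^ 2 ≤ δ) (n : ℕ) (x : ℝ) :
    |(iterate Finf δ Δt (u₀, F₀) n).1 x| ≤ M₀ + 1 / 4 * Finf * (n * Δt) := by
  induction n generalizing x with
  | zero =>
    have h : (iterate Finf δ Δt (u₀, F₀) 0).1 = gridInterp δ u₀ := by rw [iterate, project_eq hδ]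
    rw [h, _root_.abs_le]
    have := hI.Finf_nonneg
    simp only [Nat.cast_zero, zero_mul, mul_zero, add_zero]
    exact ⟨le_gridInterp hδ fun y _ => (_root_.abs_le.1 (hI.abs_le y)).1,
      gridInterp_le hδ fun y _ => (_root_.abs_le.1 (hI.abs_le y)).2⟩
  | succ n ih =>
    -- Only the forcing increases the sup norm, by at most `Finf / 4` per unit of time; projection
    -- does not.
    have d := (hI.iterate_state hδ hcfl n).step_dep hδ hΔt hcfl ih
    refine (d.abs_le ih x).trans (le_of_eq ?_)
    push_cast; ring

theorem InitData.iterate_dep (hI : InitData Finf M₀ R u₀ F₀) (hδ : 0 < δ) (hΔt : 0 ≤ Δt)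
    (hcfl : 4 * Finf * Δt ^ 2 ≤ δ) {M : ℝ} (n m : ℕ)
    (hM : M₀ + 1 / 4 * Finf * ((n + m : ℕ) * Δt) ≤ M) :
    Dep (m * (M * Δt + 1 / 8 * Finf * Δt ^ 2 + δ)) (m * (1 / 4 * Finf * Δt))
      (iterate Finf δ Δt (u₀, F₀) n).1 (iterate Finf δ Δt (u₀, F₀) n).2
      (iterate Finf δ Δt (u₀, F₀) (n + m)).1 (iterate Finf δ Δt (u₀, F₀) (n + m)).2 := by
  induction m with
  | zero => simpa using Dep.refl _ _
  | succ m ih =>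
    have hM' : M₀ + 1 / 4 * Finf * ((n + m : ℕ) * Δt) ≤ M := by
      refine le_trans ?_ hM
      have := mul_nonneg hI.Finf_nonneg hΔt
      push_cast
      nlinarith
    have d := (ih hM').trans ((hI.iterate_state hδ hcfl (n + m)).step_dep hδ hΔt hcfl
      fun x => (hI.abs_iterate_le hδ hΔt hcfl (n + m) x).trans hM')
    refine d.weaken (hI.iterate_state hδ hcfl n).energy.mono ?_ ?_
    · push_cast; linarith
    · push_cast; linarith

end Iterate

/-! ### The time step and the non-collision condition -/

section TimeStep

variable {Finf α : ℝ}

theorem timeStep_pos (hF : 0 < Finf) (hα : α ∈ Ioc (0 : ℝ) 1) {δ : ℝ} (hδ : 0 < δ) :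
    0 < timeStep Finf α δ :=
  mul_pos (div_pos hα.1 (mul_pos two_pos (Real.sqrt_pos.2 hF))) (Real.sqrt_pos.2 hδ)

theorem timeStep_sq (hF : 0 < Finf) {δ : ℝ} (hδ : 0 < δ) :
    4 * Finf * timeStep Finf α δ ^ 2 = α ^ 2 * δ := by
  rw [timeStep, mul_pow, div_pow, mul_pow, Real.sq_sqrt hF.le, Real.sq_sqrt hδ.le]
  field_simp
  ring

theorem timeStep_cfl (hF : 0 < Finf) (hα : α ∈ Ioc (0 : ℝ) 1) {δ : ℝ} (hδ : 0 < δ) :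
    4 * Finf * timeStep Finf α δ ^ 2 ≤ δ := by
  rw [timeStep_sq hF hδ]
  have h1 : α ^ 2 ≤ 1 := pow_le_one₀ hα.1.le hα.2
  nlinarith

/-- The grid size is quadratic in the time step. Displacing mass by δ in each projection is
therefore an error of second order. -/
theorem eq_mul_timeStep_sq (hF : 0 < Finf) (hα : α ∈ Ioc (0 : ℝ) 1) {δ : ℝ} (hδ : 0 < δ) :
    δ = 4 * Finf / α ^ 2 * timeStep Finf α δ ^ 2 := by
  have := timeStep_sq (α := α) hF hδ
  have hα' : α ^ 2 ≠ 0 := (pow_pos hα.1 2).ne'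
  rw [div_mul_eq_mul_div, this, mul_div_cancel_left₀ _ hα']

theorem timeStep_le (hF : 0 < Finf) (hα : α ∈ Ioc (0 : ℝ) 1) {δ : ℝ} (hδ₁ : δ ≤ 1) :
    timeStep Finf α δ ≤ α / (2 * √Finf) := by
  have h0 : 0 ≤ α / (2 * √Finf) := div_nonneg hα.1.le (by positivity)
  have h1 : √δ ≤ 1 := Real.sqrt_le_one.2 hδ₁
  rw [timeStep]
  nlinarith

theorem cfl_of_le {δ Δt τ : ℝ} (hF : 0 ≤ Finf) (hcfl : 4 * Finf * Δt ^ 2 ≤ δ) (hτ : 0 ≤ τ)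
    (hτ' : τ ≤ Δt) : 4 * Finf * τ ^ 2 ≤ δ := by
  have : τ ^ 2 ≤ Δt ^ 2 := pow_le_pow_left₀ hτ hτ' 2
  nlinarith

end TimeStep

/-! ### The numerical solution at arbitrary times, and its speed of propagation -/

section NumSol

variable {Finf α M₀ R δ : ℝ} {u₀ F₀ : ℝ → ℝ}

/-- The `n`-th iterate of the scheme with the time step `Δt` of the theorem. -/
def iter (Finf α : ℝ) (u₀ F₀ : ℝ → ℝ) (δ : ℝ) (n : ℕ) : (ℝ → ℝ) × (ℝ → ℝ) :=
  iterate Finf δ (timeStep Finf α δ) (u₀, F₀) n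

theorem iter_succ (n : ℕ) :
    iter Finf α u₀ F₀ δ (n + 1) = step Finf δ (timeStep Finf α δ) (iter Finf α u₀ F₀ δ n) := rfl

theorem numSol_eq_step {t : ℝ} {n : ℕ} (hF : 0 < Finf) (hα : α ∈ Ioc (0 : ℝ) 1) (hδ : 0 < δ)
    (h₁ : n * timeStep Finf α δ ≤ t) (h₂ : t < (n + 1) * timeStep Finf α δ) :
    numSol Finf α u₀ F₀ δ t =
      step Finf δ (t - n * timeStep Finf α δ) (iter Finf α u₀ F₀ δ n) := by
  have hp := timeStep_pos hF hα hδ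
  have hn : ⌊t / timeStep Finf α δ⌋₊ = n := by
    rw [Nat.floor_eq_iff (div_nonneg ((mul_nonneg n.cast_nonneg hp.le).trans h₁) hp.le),
      le_div_iff₀ hp, div_lt_iff₀ hp]
    exact ⟨h₁, h₂⟩
  simp only [numSol, hn, step, iter]

/-- Every time `t ≥ 0` lies in a unique time step. -/
theorem exists_step (hF : 0 < Finf) (hα : α ∈ Ioc (0 : ℝ) 1) (hδ : 0 < δ) {t : ℝ} (ht : 0 ≤ t) :
    ∃ n : ℕ, n * timeStep Finf α δ ≤ t ∧ t < (n + 1) * timeStep Finf α δ := by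
  have hp := timeStep_pos hF hα hδ
  refine ⟨⌊t / timeStep Finf α δ⌋₊, ?_, ?_⟩
  · rw [← le_div_iff₀ hp]; exact Nat.floor_le (div_nonneg ht hp.le)
  · rw [← div_lt_iff₀ hp]; exact Nat.lt_floor_add_one _

theorem InitData.iter_state (hI : InitData Finf M₀ R u₀ F₀) (hF : 0 < Finf)
    (hα : α ∈ Ioc (0 : ℝ) 1) (hδ : 0 < δ) (n : ℕ) :
    GridState Finf δ (iter Finf α u₀ F₀ δ n).1 (iter Finf α u₀ F₀ δ n).2 :=
  hI.iterate_state hδ (timeStep_cfl hF hα hδ) n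

theorem InitData.numSol_node (hI : InitData Finf M₀ R u₀ F₀) (hF : 0 < Finf)
    (hα : α ∈ Ioc (0 : ℝ) 1) (hδ : 0 < δ) (n : ℕ) :
    numSol Finf α u₀ F₀ δ (n * timeStep Finf α δ) = iter Finf α u₀ F₀ δ n := by
  have hp := timeStep_pos hF hα hδ
  rw [numSol_eq_step hF hα hδ le_rfl (by nlinarith), sub_self,
    (hI.iter_state hF hα hδ n).step_zero hδ]

theorem InitData.numSol_zero (hI : InitData Finf M₀ R u₀ F₀) (hF : 0 < Finf)
    (hα : α ∈ Ioc (0 : ℝ) 1) (hδ : 0 < δ) :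
    numSol Finf α u₀ F₀ δ 0 = (gridInterp δ u₀, gridInterp δ F₀) := by
  have := hI.numSol_node hF hα hδ 0
  rw [Nat.cast_zero, zero_mul] at this
  rw [this, iter, iterate, project_eq hδ]

theorem InitData.numSol_state (hI : InitData Finf M₀ R u₀ F₀) (hF : 0 < Finf)
    (hα : α ∈ Ioc (0 : ℝ) 1) (hδ : 0 < δ) {t : ℝ} (ht : 0 ≤ t) :
    GridState Finf δ (numU Finf α u₀ F₀ δ t) (numF Finf α u₀ F₀ δ t) := by
  obtain ⟨n, h1, h2⟩ := exists_step hF hα hδ ht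
  simp only [numU, numF]
  rw [numSol_eq_step hF hα hδ h1 h2]
  exact (hI.iter_state hF hα hδ n).step_state hδ
    (cfl_of_le hF.le (timeStep_cfl hF hα hδ) (by linarith) (by linarith))

theorem InitData.abs_numU_le (hI : InitData Finf M₀ R u₀ F₀) (hF : 0 < Finf)
    (hα : α ∈ Ioc (0 : ℝ) 1) (hδ : 0 < δ) {t : ℝ} (ht : 0 ≤ t) (x : ℝ) :
    |numU Finf α u₀ F₀ δ t x| ≤ M₀ + 1 / 4 * Finf * t := by
  obtain ⟨n, h1, h2⟩ := exists_step hF hα hδ ht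
  have hp := timeStep_pos hF hα hδ
  have hcfl := timeStep_cfl hF hα hδ
  have hb := hI.abs_iterate_le hδ hp.le hcfl n
  have d := (hI.iter_state hF hα hδ n).step_dep (τ := t - n * timeStep Finf α δ) hδ (by linarith)
    (cfl_of_le hF.le hcfl (by linarith) (by linarith)) hb
  simp only [numU]
  rw [numSol_eq_step hF hα hδ h1 h2]
  refine (d.abs_le hb x).trans (le_of_eq ?_)
  ring

/-- The speed of propagation of the scheme on `[0, T]`. -/
def speed (Finf α M₀ T : ℝ) : ℝ :=
  M₀ + 1 / 4 * Finf * T + (1 / 8 * Finf + 4 * Finf / α ^ 2) * (α / (2 * √Finf))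

theorem InitData.speed_nonneg (hI : InitData Finf M₀ R u₀ F₀)
    (hα : α ∈ Ioc (0 : ℝ) 1) {T : ℝ} (hT : 0 ≤ T) : 0 ≤ speed Finf α M₀ T := by
  have := hI.M_nonneg
  have := hα.1
  have := hI.Finf_nonneg
  unfold speed
  positivity

/-- Both δ and τ² are at most multiples of Δt², and for δ ≤ 1 one factor Δt is bounded by
α/(2√Finf). The remaining factor makes them part of a speed. -/
theorem InitData.step_shift_le (hI : InitData Finf M₀ R u₀ F₀) (hF : 0 < Finf)
    (hα : α ∈ Ioc (0 : ℝ) 1) (hδ : 0 < δ) (hδ₁ : δ ≤ 1) {T τ : ℝ} (hT : 0 ≤ T) (hτ₀ : 0 ≤ τ)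
    (hτ : τ ≤ timeStep Finf α δ) :
    (M₀ + 1 / 4 * Finf * T) * τ + 1 / 8 * Finf * τ ^ 2 + δ ≤
      speed Finf α M₀ T * timeStep Finf α δ := by
  have h1 := eq_mul_timeStep_sq hF hα hδ
  have h2 := timeStep_le hF hα hδ₁
  have hp := timeStep_pos hF hα hδ
  have hM := hI.M_nonneg
  set Δt := timeStep Finf α δ
  have h3 : τ ^ 2 ≤ Δt ^ 2 := pow_le_pow_left₀ hτ₀ hτ 2
  have h4 : (M₀ + 1 / 4 * Finf * T) * τ ≤ (M₀ + 1 / 4 * Finf * T) * Δt :=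
    mul_le_mul_of_nonneg_left hτ (by positivity)
  have h5 : Δt ^ 2 ≤ (α / (2 * √Finf)) * Δt := by nlinarith
  have h6 : 0 ≤ 1 / 8 * Finf + 4 * Finf / α ^ 2 := by have := hα.1; positivity
  calc (M₀ + 1 / 4 * Finf * T) * τ + 1 / 8 * Finf * τ ^ 2 + δ
      ≤ (M₀ + 1 / 4 * Finf * T) * Δt + 1 / 8 * Finf * Δt ^ 2 + 4 * Finf / α ^ 2 * Δt ^ 2 := by
        nlinarith
    _ = (M₀ + 1 / 4 * Finf * T) * Δt + (1 / 8 * Finf + 4 * Finf / α ^ 2) * Δt ^ 2 := by ring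
    _ ≤ (M₀ + 1 / 4 * Finf * T) * Δt +
        (1 / 8 * Finf + 4 * Finf / α ^ 2) * ((α / (2 * √Finf)) * Δt) := by
        gcongr
    _ = _ := by rw [speed]; ring

theorem InitData.iter_step_dep (hI : InitData Finf M₀ R u₀ F₀) (hF : 0 < Finf)
    (hα : α ∈ Ioc (0 : ℝ) 1) (hδ : 0 < δ) (hδ₁ : δ ≤ 1) {T τ : ℝ} {n : ℕ}
    (hn : n * timeStep Finf α δ ≤ T) (hτ₀ : 0 ≤ τ) (hτ : τ ≤ timeStep Finf α δ) :
    Dep (speed Finf α M₀ T * timeStep Finf α δ) (1 / 4 * Finf * timeStep Finf α δ)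
      (iter Finf α u₀ F₀ δ n).1 (iter Finf α u₀ F₀ δ n).2
      (step Finf δ τ (iter Finf α u₀ F₀ δ n)).1 (step Finf δ τ (iter Finf α u₀ F₀ δ n)).2 := by
  have hp := timeStep_pos hF hα hδ
  have hcfl := timeStep_cfl hF hα hδ
  have hT : 0 ≤ T := le_trans (by positivity) hn
  have hs := hI.iter_state hF hα hδ n
  refine (hs.step_dep hδ hτ₀ (cfl_of_le hF.le hcfl hτ₀ hτ) fun x =>
    (hI.abs_iterate_le hδ hp.le hcfl n x).trans ?_).weaken hs.energy.mono
    (hI.step_shift_le hF hα hδ hδ₁ hT hτ₀ hτ) ?_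
  · nlinarith
  · nlinarith

/-- The summand `timeStep Finf α δ` is there because the last, incomplete step is charged as a full
one. -/
theorem InitData.iter_num_dep (hI : InitData Finf M₀ R u₀ F₀) (hF : 0 < Finf)
    (hα : α ∈ Ioc (0 : ℝ) 1) (hδ : 0 < δ) (hδ₁ : δ ≤ 1) {T t : ℝ} {n : ℕ}
    (hn : n * timeStep Finf α δ ≤ t) (ht : t ≤ T) :
    Dep (speed Finf α M₀ T * (t - n * timeStep Finf α δ + timeStep Finf α δ))
      (1 / 4 * Finf * (t - n * timeStep Finf α δ + timeStep Finf α δ))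
      (iter Finf α u₀ F₀ δ n).1 (iter Finf α u₀ F₀ δ n).2
      (numU Finf α u₀ F₀ δ t) (numF Finf α u₀ F₀ δ t) := by
  have hp := timeStep_pos hF hα hδ
  have hcfl := timeStep_cfl hF hα hδ
  have ht0 : 0 ≤ t := le_trans (by positivity) hn
  have hT : 0 ≤ T := ht0.trans ht
  obtain ⟨k, h1, h2⟩ := exists_step hF hα hδ ht0
  have hnk : n ≤ k := by
    have h3 : (n : ℝ) * timeStep Finf α δ < (k + 1) * timeStep Finf α δ := hn.trans_lt h2
    have h4 : (n : ℝ) < k + 1 := lt_of_mul_lt_mul_right h3 hp.le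
    exact_mod_cast Nat.lt_succ_iff.1 (by exact_mod_cast h4)
  obtain ⟨m, rfl⟩ := Nat.exists_eq_add_of_le hnk
  have hs := hI.iter_state hF hα hδ n
  have d1 := hI.iterate_dep (M := M₀ + 1 / 4 * Finf * T) hδ hp.le hcfl n m (by nlinarith)
  have d2 := hI.iter_step_dep hF hα hδ hδ₁ (h1.trans ht)
    (τ := t - (n + m : ℕ) * timeStep Finf α δ) (by linarith) (by linarith)
  have d := d1.trans d2
  simp only [numU, numF]
  rw [numSol_eq_step hF hα hδ h1 h2]
  have h5 := hI.step_shift_le hF hα hδ hδ₁ hT hp.le le_rfl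
  have h6 := hI.speed_nonneg hα hT
  have h7 := mul_le_mul_of_nonneg_left h5 m.cast_nonneg
  have h8 : (m : ℝ) * timeStep Finf α δ ≤ t - n * timeStep Finf α δ := by
    push_cast at h1; linarith
  refine d.weaken hs.energy.mono ?_ ?_
  · have := mul_le_mul_of_nonneg_left h8 h6
    linarith
  · have := mul_le_mul_of_nonneg_left h8 hF.le
    linarith

/-- Both times are compared with the iterate at the last time nΔt ≤ s. The two elapsed times, each
enlarged by Δt, add up to (t - s) + 2(s - nΔt) + 2Δt ≤ (t - s) + 4Δt, which explains the form of r.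
-/
theorem InitData.num_time_of_le (hI : InitData Finf M₀ R u₀ F₀) (hF : 0 < Finf)
    (hα : α ∈ Ioc (0 : ℝ) 1) (hδ : 0 < δ) (hδ₁ : δ ≤ 1) {T s t r : ℝ} (hs : 0 ≤ s) (hst : s ≤ t)
    (ht : t ≤ T) (hr : r = t - s + 4 * timeStep Finf α δ) (x : ℝ) :
    (numF Finf α u₀ F₀ δ t x ≤ numF Finf α u₀ F₀ δ s (x + speed Finf α M₀ T * r) ∧
      numF Finf α u₀ F₀ δ s x ≤ numF Finf α u₀ F₀ δ t (x + speed Finf α M₀ T * r)) ∧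
    |numU Finf α u₀ F₀ δ t x - numU Finf α u₀ F₀ δ s x| ≤
      1 / 2 * Finf * r + 2 * √(Finf * (speed Finf α M₀ T * r)) := by
  obtain ⟨n, h1, h2⟩ := exists_step hF hα hδ hs
  have hp := timeStep_pos hF hα hδ
  have hT : 0 ≤ T := hs.trans (hst.trans ht)
  have hA := hI.speed_nonneg hα hT
  have hG := hI.iter_state hF hα hδ n
  have ds := hI.iter_num_dep hF hα hδ hδ₁ h1 (hst.trans ht)
  have dt := hI.iter_num_dep hF hα hδ hδ₁ (h1.trans hst) ht
  have ms := (hI.numSol_state hF hα hδ hs).energy.mono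
  have mt := (hI.numSol_state hF hα hδ (hs.trans hst)).energy.mono
  set A := speed Finf α M₀ T
  set Δt := timeStep Finf α δ
  have hsum : A * (t - n * Δt + Δt) + A * (s - n * Δt + Δt) ≤ A * r := by
    rw [← mul_add]; exact mul_le_mul_of_nonneg_left (by linarith) hA
  refine ⟨⟨?_, ?_⟩, ?_⟩
  · have e := ds.le_F (x + A * (t - n * Δt + Δt) + A * (s - n * Δt + Δt))
    rw [add_sub_cancel_right] at e
    exact (dt.F_le x).trans (e.trans (ms (by linarith)))
  · have e := dt.le_F (x + A * (s - n * Δt + Δt) + A * (t - n * Δt + Δt))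
    rw [add_sub_cancel_right] at e
    exact (ds.F_le x).trans (e.trans (mt (by linarith)))
  · have e1 := dt.abs_u_sub_le_sqrt hG.energy hG.sub_le x
    have e2 := ds.abs_u_sub_le_sqrt hG.energy hG.sub_le x
    have q1 : √(Finf * (A * (t - n * Δt + Δt))) ≤ √(Finf * (A * r)) :=
      Real.sqrt_le_sqrt (mul_le_mul_of_nonneg_left
        (mul_le_mul_of_nonneg_left (by linarith) hA) hF.le)
    have q2 : √(Finf * (A * (s - n * Δt + Δt))) ≤ √(Finf * (A * r)) :=
      Real.sqrt_le_sqrt (mul_le_mul_of_nonneg_left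
        (mul_le_mul_of_nonneg_left (by linarith) hA) hF.le)
    have q3 : Finf * (t - n * Δt + Δt) + Finf * (s - n * Δt + Δt) ≤ Finf * r := by
      rw [← mul_add]; exact mul_le_mul_of_nonneg_left (by linarith) hF.le
    have q4 := abs_sub_le (numU Finf α u₀ F₀ δ t x) ((iter Finf α u₀ F₀ δ n).1 x)
      (numU Finf α u₀ F₀ δ s x)
    rw [abs_sub_comm ((iter Finf α u₀ F₀ δ n).1 x)] at q4
    have q5 : 0 ≤ Finf * r := mul_nonneg hF.le (by linarith)
    linarith

/-- Modulus of continuity in time of the numerical solution, up to an error of order `Δt`. -/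
theorem InitData.num_time (hI : InitData Finf M₀ R u₀ F₀) (hF : 0 < Finf)
    (hα : α ∈ Ioc (0 : ℝ) 1) (hδ : 0 < δ) (hδ₁ : δ ≤ 1) {T s t r : ℝ} (hs : s ∈ Icc 0 T)
    (ht : t ∈ Icc 0 T) (hr : r = |t - s| + 4 * timeStep Finf α δ) (x : ℝ) :
    numF Finf α u₀ F₀ δ t x ≤ numF Finf α u₀ F₀ δ s (x + speed Finf α M₀ T * r) ∧
    |numU Finf α u₀ F₀ δ t x - numU Finf α u₀ F₀ δ s x| ≤
      1 / 2 * Finf * r + 2 * √(Finf * (speed Finf α M₀ T * r)) := by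
  rcases le_total s t with h | h
  · have := hI.num_time_of_le (r := r) hF hα hδ hδ₁ hs.1 h ht.2
      (by rw [hr, abs_of_nonneg (sub_nonneg.2 h)]) x
    exact ⟨this.1.1, this.2⟩
  · have := hI.num_time_of_le (r := r) hF hα hδ hδ₁ ht.1 h hs.2
      (by rw [hr, abs_sub_comm, abs_of_nonneg (sub_nonneg.2 h)]) x
    rw [abs_sub_comm]
    exact ⟨this.1.2, this.2⟩

/-- A bound for the support of the energy of the numerical solutions on `[0, T]`. -/
def radius (Finf α M₀ R T : ℝ) : ℝ :=
  R + 1 + speed Finf α M₀ T * (T + 4 * (α / (2 * √Finf)))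

theorem InitData.numF_far (hI : InitData Finf M₀ R u₀ F₀) (hF : 0 < Finf)
    (hα : α ∈ Ioc (0 : ℝ) 1) (hδ : 0 < δ) (hδ₁ : δ ≤ 1) {T t : ℝ} (ht : t ∈ Icc 0 T) {x : ℝ} :
    (x ≤ - radius Finf α M₀ R T → numF Finf α u₀ F₀ δ t x = 0) ∧
    (radius Finf α M₀ R T ≤ x → numF Finf α u₀ F₀ δ t x = Finf) := by
  have hT : 0 ≤ T := ht.1.trans ht.2
  have hA := hI.speed_nonneg hα hT
  have hG := hI.numSol_state hF hα hδ ht.1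
  have h0 : numF Finf α u₀ F₀ δ 0 = gridInterp δ F₀ := by
    simp only [numF]; rw [hI.numSol_zero hF hα hδ]
  have hd := dep_gridInterp hδ u₀ hI.energy.mono
  have hr : |t - 0| + 4 * timeStep Finf α δ ≤ T + 4 * (α / (2 * √Finf)) := by
    rw [sub_zero, abs_of_nonneg ht.1]; linarith [ht.2, timeStep_le hF hα hδ₁]
  have hr' := mul_le_mul_of_nonneg_left hr hA
  constructor <;> intro hx <;> rw [radius] at hx
  · refine le_antisymm ?_ (hG.nonneg x)
    have h1 := (hI.num_time hF hα hδ hδ₁ ⟨le_rfl, hT⟩ ht rfl x).1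
    rw [h0] at h1
    refine h1.trans ((hd.F_le _).trans (le_of_eq (hI.eq_zero _ ?_)))
    linarith
  · refine le_antisymm (hG.le x) ?_
    -- With the two times exchanged, `num_time` bounds F at time t from below by F at time 0.
    have h1 := (hI.num_time hF hα hδ hδ₁ ht ⟨le_rfl, hT⟩ rfl
      (x - speed Finf α M₀ T * (|0 - t| + 4 * timeStep Finf α δ))).1
    rw [h0, sub_add_cancel] at h1
    rw [abs_sub_comm] at h1
    refine le_trans (le_of_eq (hI.eq_Finf _ ?_).symm) ((hd.le_F _).trans h1)
    linarith

end NumSol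

/-! ### Quantile functions -/

/-- Left continuous distribution functions of measures with total mass `Finf` and bounded
support. -/
structure DistFn (Finf : ℝ) (F : ℝ → ℝ) : Prop where
  mono : Monotone F
  leftCont : ∀ x, ContinuousWithinAt F (Iic x) x
  far : ∃ R, (∀ x, x ≤ -R → F x = 0) ∧ ∀ x, R ≤ x → F x = Finf

/-- The quantile function. -/
def quantile (F : ℝ → ℝ) (η : ℝ) : ℝ := sSup {x | F x ≤ η}

theorem exists_mem_Ioo_of_ae {p : ℝ → Prop} (hp : ∀ᵐ x, p x) {a b : ℝ} (hab : a < b) :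
    ∃ x ∈ Ioo a b, p x := by
  by_contra! h
  have h1 : volume (Ioo a b) ≤ volume {x | ¬ p x} := measure_mono fun x hx => h x hx
  rw [ae_iff.1 hp, Real.volume_Ioo] at h1
  simp only [nonpos_iff_eq_zero, ENNReal.ofReal_eq_zero] at h1
  linarith

namespace DistFn

variable {Finf : ℝ} {F : ℝ → ℝ}

theorem nonneg (h : DistFn Finf F) (x : ℝ) : 0 ≤ F x := by
  obtain ⟨R, h1, -⟩ := h.far
  rw [← h1 (min x (-R)) (min_le_right _ _)]
  exact h.mono (min_le_left _ _)

theorem le (h : DistFn Finf F) (x : ℝ) : F x ≤ Finf := by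
  obtain ⟨R, -, h1⟩ := h.far
  rw [← h1 (max x R) (le_max_right _ _)]
  exact h.mono (le_max_left _ _)

theorem tendsto_atBot (h : DistFn Finf F) : Tendsto F atBot (𝓝 0) := by
  obtain ⟨R, h1, -⟩ := h.far
  refine tendsto_const_nhds.congr' ?_
  filter_upwards [eventually_le_atBot (-R)] with x hx using (h1 x hx).symm

theorem tendsto_atTop (h : DistFn Finf F) : Tendsto F atTop (𝓝 Finf) := by
  obtain ⟨R, -, h1⟩ := h.far
  refine tendsto_const_nhds.congr' ?_
  filter_upwards [eventually_ge_atTop R] with x hx using (h1 x hx).symm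

/-- Left continuity puts the supremum itself into the set `{x | F x ≤ η}`, so the quantile function
and F form an adjoint pair without exceptional points. -/
theorem le_quantile_iff (h : DistFn Finf F) {η : ℝ} (hη : η ∈ Ioo 0 Finf) {x : ℝ} :
    x ≤ quantile F η ↔ F x ≤ η := by
  obtain ⟨R, h1, h2⟩ := h.far
  have hne : {x | F x ≤ η}.Nonempty := ⟨-R, by rw [mem_ofPred_eq, h1 _ le_rfl]; exact hη.1.le⟩
  have hbdd : BddAbove {x | F x ≤ η} := by
    refine ⟨R, fun y hy => ?_⟩
    by_contra hlt
    have hy' : F y ≤ η := hy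
    rw [h2 y (not_le.1 hlt).le] at hy'
    exact absurd hη.2 (not_lt.2 hy')
  have key : ∀ y < quantile F η, F y ≤ η := fun y hy => by
    obtain ⟨z, hz, hyz⟩ := exists_lt_of_lt_csSup hne hy
    exact (h.mono hyz.le).trans hz
  refine ⟨fun hx => ?_, fun hx => le_csSup hbdd hx⟩
  rcases hx.lt_or_eq with hlt | rfl
  · exact key x hlt
  · refine le_of_tendsto ((h.leftCont _).mono_left (nhdsWithin_mono _ Iio_subset_Iic_self)) ?_
    filter_upwards [self_mem_nhdsWithin] with y hy using key y hy

theorem quantile_lt_iff (h : DistFn Finf F) {η : ℝ} (hη : η ∈ Ioo 0 Finf) {x : ℝ} :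
    quantile F η < x ↔ η < F x := by
  rw [← not_le, h.le_quantile_iff hη, not_le]

theorem F_quantile_le (h : DistFn Finf F) {η : ℝ} (hη : η ∈ Ioo 0 Finf) : F (quantile F η) ≤ η :=
  (h.le_quantile_iff hη).1 le_rfl

theorem quantile_monotoneOn (h : DistFn Finf F) : MonotoneOn (quantile F) (Ioo 0 Finf) :=
  fun _ hη _ hη' hle => (h.le_quantile_iff hη').2 ((h.F_quantile_le hη).trans hle)

theorem aemeasurable_quantile (h : DistFn Finf F) :
    AEMeasurable (quantile F) (volume.restrict (Ioo 0 Finf)) :=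
  aemeasurable_restrict_of_monotoneOn measurableSet_Ioo h.quantile_monotoneOn

theorem distMeasure_univ (h : DistFn Finf F) : distMeasure F univ = ENNReal.ofReal Finf := by
  have h1 := tendsto_measure_iUnion_atTop (μ := distMeasure F) (s := fun x : ℝ => Iio x)
    (fun _ _ hab => Iio_subset_Iio hab)
  rw [iUnion_Iio] at h1
  refine tendsto_nhds_unique h1 ?_
  refine (ENNReal.tendsto_ofReal h.tendsto_atTop).congr fun x => ?_
  rw [Function.comp_apply, distMeasure_Iio h.mono h.leftCont h.tendsto_atBot]

/-- By the adjunction the preimage of `Iio x` is the set of η below `F x`, so the two finite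
measures agree on the π-system of left half-lines and on the whole line. -/
theorem map_quantile (h : DistFn Finf F) :
    (volume.restrict (Ioo 0 Finf)).map (quantile F) = distMeasure F := by
  have hI : ∀ s : ℝ, s ≤ Finf → volume (Ioo 0 Finf ∩ Iio s) = ENNReal.ofReal s := fun s hs => by
    rw [Ioo_inter_Iio, min_eq_right hs, Real.volume_Ioo, sub_zero]
  refine ext_of_generate_finite (range Iio) ?_ isPiSystem_Iio ?_ ?_
  · rw [BorelSpace.measurable_eq (α := ℝ), borel_eq_generateFrom_Iio]
  · rintro _ ⟨x, rfl⟩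
    rw [Measure.map_apply_of_aemeasurable h.aemeasurable_quantile measurableSet_Iio,
      distMeasure_Iio h.mono h.leftCont h.tendsto_atBot, ← hI (F x) (h.le x),
      Measure.restrict_apply' measurableSet_Ioo]
    congr 1
    ext η
    simp only [mem_inter_iff, mem_preimage, mem_Iio]
    constructor
    · rintro ⟨h1, h2⟩; exact ⟨h2, (h.quantile_lt_iff h2).1 h1⟩
    · rintro ⟨h1, h2⟩; exact ⟨(h.quantile_lt_iff h1).2 h2, h1⟩
  · rw [Measure.map_apply_of_aemeasurable h.aemeasurable_quantile MeasurableSet.univ,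
      h.distMeasure_univ]
    simp

theorem integral_distMeasure (h : DistFn Finf F) {g : ℝ → ℝ} (hg : Continuous g) :
    ∫ x, g x ∂(distMeasure F) = ∫ η in Ioo 0 Finf, g (quantile F η) := by
  rw [← h.map_quantile, integral_map h.aemeasurable_quantile hg.aestronglyMeasurable]

/-- Almost everywhere convergence of distribution functions implies almost everywhere convergence
of the quantile functions. -/
theorem tendsto_quantile {ι : Type*} {l : Filter ι} {G : ι → ℝ → ℝ} (h : DistFn Finf F)
    (hG : ∀ᶠ i in l, DistFn Finf (G i))
    (hlim : ∀ᵐ x, Tendsto (fun i => G i x) l (𝓝 (F x))) :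
    ∀ᵐ η ∂(volume.restrict (Ioo 0 Finf)),
      Tendsto (fun i => quantile (G i) η) l (𝓝 (quantile F η)) := by
  have hc := h.quantile_monotoneOn.countable_not_continuousWithinAt
  have hc' : ∀ᵐ η ∂(volume.restrict (Ioo 0 Finf)),
      η ∉ {η ∈ Ioo 0 Finf | ¬ ContinuousWithinAt (quantile F) (Ioo 0 Finf) η} :=
    measure_eq_zero_iff_ae_notMem.1 (hc.measure_zero _)
  filter_upwards [hc', ae_restrict_mem measurableSet_Ioo] with η h1 hη
  have hcont : ContinuousAt (quantile F) η := by
    by_contra hn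
    exact h1 ⟨hη, fun hw => hn (hw.continuousAt (isOpen_Ioo.mem_nhds hη))⟩
  refine tendsto_order.2 ⟨fun y hy => ?_, fun y hy => ?_⟩
  -- Continuity at η provides a level η' < η whose quantile still exceeds y. This gives the strict
  -- inequality `F z < η` at a point z of convergence, which then holds for `G i z` eventually.
  · have hev : ∀ᶠ η' in 𝓝[<] η, y < quantile F η' :=
      (hcont.tendsto.mono_left nhdsWithin_le_nhds).eventually (lt_mem_nhds hy)
    obtain ⟨η', h2, h3⟩ := (hev.and (Ioo_mem_nhdsLT hη.1)).exists
    have hη' : η' ∈ Ioo 0 Finf := ⟨h3.1, h3.2.trans hη.2⟩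
    obtain ⟨z, hz, hzl⟩ := exists_mem_Ioo_of_ae hlim h2
    have h4 : F z < η := ((h.le_quantile_iff hη').1 hz.2.le).trans_lt h3.2
    filter_upwards [hG, hzl.eventually (gt_mem_nhds h4)] with i hi hiz
    exact hz.1.trans_le ((hi.le_quantile_iff hη).2 hiz.le)
  · obtain ⟨z, hz, hzl⟩ := exists_mem_Ioo_of_ae hlim hy
    have h4 : η < F z := (h.quantile_lt_iff hη).1 hz.1
    filter_upwards [hG, hzl.eventually (lt_mem_nhds h4)] with i hi hiz
    exact ((hi.quantile_lt_iff hη).2 hiz).trans hz.2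

/-- Weak convergence of the measures with distribution functions `G i`, tested with a continuously
convergent family of functions. -/
theorem tendsto_integral {ι : Type*} {l : Filter ι} [l.IsCountablyGenerated] {G : ι → ℝ → ℝ}
    (h : DistFn Finf F) (hG : ∀ᶠ i in l, DistFn Finf (G i))
    (hlim : ∀ᵐ x, Tendsto (fun i => G i x) l (𝓝 (F x))) {g : ι → ℝ → ℝ} {g₀ : ℝ → ℝ} {C : ℝ}
    (hg₀ : Continuous g₀) (hg : ∀ᶠ i in l, Continuous (g i)) (hC : ∀ᶠ i in l, ∀ x, |g i x| ≤ C)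
    (hgl : ∀ (y : ℝ) (z : ι → ℝ), Tendsto z l (𝓝 y) → Tendsto (fun i => g i (z i)) l (𝓝 (g₀ y))) :
    Tendsto (fun i => ∫ x, g i x ∂(distMeasure (G i))) l (𝓝 (∫ x, g₀ x ∂(distMeasure F))) := by
  have e : (fun i => ∫ x, g i x ∂(distMeasure (G i))) =ᶠ[l]
      fun i => ∫ η in Ioo 0 Finf, g i (quantile (G i) η) := by
    filter_upwards [hG, hg] with i h1 h2 using h1.integral_distMeasure h2
  rw [tendsto_congr' e, h.integral_distMeasure hg₀]
  refine tendsto_integral_filter_of_dominated_convergence (fun _ => C) ?_ ?_ ?_ ?_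
  · filter_upwards [hG, hg] with i h1 h2
    exact (h2.measurable.comp_aemeasurable h1.aemeasurable_quantile).aestronglyMeasurable
  · filter_upwards [hC] with i hi
    exact Eventually.of_forall fun η => hi _
  · exact integrable_const C
  · filter_upwards [h.tendsto_quantile hG hlim] with η hη using hgl _ _ hη

end DistFn

/-- Transport preserves F along characteristics, so it moves each quantile by the flow map. The
projection keeps the distribution function between its shifts by ±δ, and so moves quantiles by at
most δ. -/
theorem Transport.abs_quantile_sub_le {Finf δ τ : ℝ} {U F V H : ℝ → ℝ} (hδ : 0 < δ)
    (h : Transport Finf τ U F V H) (hE : EnergyIneq U F) (hF : DistFn Finf F)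
    (hG : DistFn Finf (gridInterp δ H)) {η : ℝ} (hη : η ∈ Ioo 0 Finf) :
    |quantile (gridInterp δ H) η - flowMap Finf τ U F (quantile F η)| ≤ δ := by
  have d := dep_gridInterp hδ V (h.energy hE).mono
  rw [abs_le]
  constructor
  · have h1 : flowMap Finf τ U F (quantile F η) - δ ≤ quantile (gridInterp δ H) η := by
      rw [hG.le_quantile_iff hη]
      refine (d.F_le _).trans ?_
      rw [sub_add_cancel, h.F_eq]
      exact hF.F_quantile_le hη
    linarith
  · obtain ⟨ξ, hξ⟩ := h.surj (quantile (gridInterp δ H) η - δ)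
    have h1 : F ξ ≤ η := by
      rw [← h.F_eq, hξ]
      exact (d.le_F _).trans (hG.F_quantile_le hη)
    have h2 := h.le_iff.2 ((hF.le_quantile_iff hη).2 h1)
    rw [hξ] at h2
    linarith

/-! ### Test functions -/

/-- The derivative of `φ` in time. -/
def timeDeriv (φ : ℝ → ℝ → ℝ) (t x : ℝ) : ℝ := deriv (fun s => φ s x) t

/-- The derivative of `φ` in space. -/
def spaceDeriv (φ : ℝ → ℝ → ℝ) (t x : ℝ) : ℝ := deriv (φ t) x

/-- `g` is bounded by `B`, Lipschitz continuous with constant `B`, and vanishes outside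
`(-L, L)²`. -/
structure LipBound (B L : ℝ) (g : ℝ → ℝ → ℝ) : Prop where
  bound : ∀ t x, |g t x| ≤ B
  lip : ∀ t x s y, |g s y - g t x| ≤ B * (|s - t| + |y - x|)
  supp : ∀ t x, L ≤ |t| ∨ L ≤ |x| → g t x = 0

/-- Quantitative properties of a test function. -/
structure TestBound (B L : ℝ) (φ : ℝ → ℝ → ℝ) : Prop where
  pos : 0 ≤ B
  L_pos : 0 ≤ L
  val : LipBound B L φ
  time : LipBound B L (timeDeriv φ)
  space : LipBound B L (spaceDeriv φ)
  hasDerivAt : ∀ t x, HasDerivAt (φ t) (spaceDeriv φ t x) x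
  taylor : ∀ t x s y,
    |φ s y - φ t x - (s - t) * timeDeriv φ t x - (y - x) * spaceDeriv φ t x| ≤
      B * (|s - t| + |y - x|) ^ 2

theorem LipBound.continuous {B L : ℝ} {g : ℝ → ℝ → ℝ} (h : LipBound B L g) :
    Continuous fun p : ℝ × ℝ => g p.1 p.2 := by
  rw [continuous_iff_continuousAt]
  intro p
  rw [ContinuousAt, tendsto_iff_dist_tendsto_zero]
  have h0 : Tendsto (fun q : ℝ × ℝ => B * (|q.1 - p.1| + |q.2 - p.2|)) (𝓝 p) (𝓝 0) := by
    have : Continuous fun q : ℝ × ℝ => B * (|q.1 - p.1| + |q.2 - p.2|) := by fun_prop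
    simpa using this.tendsto p
  exact squeeze_zero (fun _ => dist_nonneg) (fun q => h.lip p.1 p.2 q.1 q.2) h0

theorem LipBound.continuous_right {B L : ℝ} {g : ℝ → ℝ → ℝ} (h : LipBound B L g) (t : ℝ) :
    Continuous (g t) := h.continuous.comp (by fun_prop : Continuous fun x : ℝ => (t, x))

theorem LipBound.weaken {B L B' L' : ℝ} {g : ℝ → ℝ → ℝ} (h : LipBound B L g) (hB : B ≤ B')
    (hL : L ≤ L') : LipBound B' L' g where
  bound t x := (h.bound t x).trans hB
  lip t x s y := (h.lip t x s y).trans (mul_le_mul_of_nonneg_right hB (by positivity))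
  supp t x hx := h.supp t x (hx.imp hL.trans hL.trans)

theorem exists_lipBound {g : ℝ × ℝ → ℝ} (hg : ContDiff ℝ ∞ g) (hs : HasCompactSupport g) :
    ∃ B L, 0 ≤ B ∧ 0 ≤ L ∧ LipBound B L fun t x => g (t, x) := by
  obtain ⟨C, hC⟩ := hs.exists_bound_of_continuous hg.continuous
  obtain ⟨K, hK⟩ := ContDiff.lipschitzWith_of_hasCompactSupport hs hg (by simp)
  obtain ⟨r, hr⟩ := hs.isCompact.isBounded.subset_ball (0 : ℝ × ℝ)
  have hC0 : 0 ≤ C := (norm_nonneg _).trans (hC 0)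
  refine ⟨C + K, max r 0, by positivity, le_max_right _ _, fun t x => ?_, fun t x s y => ?_,
    fun t x h => ?_⟩
  · exact (hC (t, x)).trans (by linarith [K.2])
  · have h1 := hK.dist_le_mul (s, y) (t, x)
    rw [Real.dist_eq, Prod.dist_eq, Real.dist_eq, Real.dist_eq] at h1
    have h2 : max |s - t| |y - x| ≤ |s - t| + |y - x| :=
      max_le (by linarith [abs_nonneg (y - x)]) (by linarith [abs_nonneg (s - t)])
    refine h1.trans ((mul_le_mul_of_nonneg_left h2 K.2).trans ?_)
    exact mul_le_mul_of_nonneg_right (le_add_of_nonneg_left hC0) (by positivity)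
  · refine image_eq_zero_of_notMem_tsupport fun hmem => ?_
    have h1 := hr hmem
    rw [mem_ball_zero_iff, Prod.norm_def, max_lt_iff, Real.norm_eq_abs, Real.norm_eq_abs] at h1
    rcases h with h | h
    · exact absurd ((le_max_left r 0).trans h) (not_le.2 h1.1)
    · exact absurd ((le_max_left r 0).trans h) (not_le.2 h1.2)

/-- The mean value inequality for z ↦ f z - z f' x, whose derivative is at most K|y - x| between x
and y. -/
theorem abs_sub_sub_mul_le {f f' : ℝ → ℝ} {K : ℝ} (hf : ∀ z, HasDerivAt f (f' z) z) {x : ℝ}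
    (hK : ∀ z, |f' z - f' x| ≤ K * |z - x|) (hK₀ : 0 ≤ K) (y : ℝ) :
    |f y - f x - (y - x) * f' x| ≤ K * |y - x| ^ 2 := by
  have h1 : ∀ z ∈ uIcc x y, HasDerivWithinAt (fun z => f z - z * f' x) (f' z - f' x) (uIcc x y) z :=
    fun z _ => by
      have := (hf z).fun_sub ((hasDerivAt_id z).mul_const (f' x))
      rw [one_mul] at this
      exact this.hasDerivWithinAt
  have h2 : ∀ z ∈ uIcc x y, ‖f' z - f' x‖ ≤ K * |y - x| := fun z hz =>
    (hK z).trans (mul_le_mul_of_nonneg_left (abs_sub_left_of_mem_uIcc hz) hK₀)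
  have h3 := (convex_uIcc x y).norm_image_sub_le_of_norm_hasDerivWithin_le h1 h2 left_mem_uIcc
    right_mem_uIcc
  rw [Real.norm_eq_abs, Real.norm_eq_abs] at h3
  calc _ = |f y - y * f' x - (f x - x * f' x)| := by ring_nf
    _ ≤ _ := h3
    _ = _ := by ring

theorem IsTestFunction.exists_testBound {φ : ℝ → ℝ → ℝ} (hφ : IsTestFunction φ) :
    ∃ B L, TestBound B L φ := by
  obtain ⟨h1, h2⟩ := hφ
  set g : ℝ × ℝ → ℝ := fun p => φ p.1 p.2
  have hdiff : Differentiable ℝ g := h1.differentiable (by simp)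
  have ht : ∀ t x, HasDerivAt (fun s => φ s x) (fderiv ℝ g (t, x) (1, 0)) t := fun t x => by
    have hc : HasDerivAt (fun s : ℝ => (s, x)) ((1 : ℝ), (0 : ℝ)) t :=
      (hasDerivAt_id t).prodMk (hasDerivAt_const t x)
    exact (hdiff (t, x)).hasFDerivAt.comp_hasDerivAt t hc
  have hx : ∀ t x, HasDerivAt (φ t) (fderiv ℝ g (t, x) (0, 1)) x := fun t x => by
    have hc : HasDerivAt (fun y : ℝ => (t, y)) ((0 : ℝ), (1 : ℝ)) x :=
      (hasDerivAt_const x t).prodMk (hasDerivAt_id x)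
    exact (hdiff (t, x)).hasFDerivAt.comp_hasDerivAt x hc
  have et : timeDeriv φ = fun t x => fderiv ℝ g (t, x) (1, 0) := by
    funext t x; exact (ht t x).deriv
  have ex : spaceDeriv φ = fun t x => fderiv ℝ g (t, x) (0, 1) := by
    funext t x; exact (hx t x).deriv
  have hsm : ∀ v, ContDiff ℝ ∞ fun p => fderiv ℝ g p v := fun v =>
    (h1.fderiv_right (m := ∞) (by simp)).clm_apply contDiff_const
  obtain ⟨B₁, L₁, b₁, l₁, H₁⟩ := exists_lipBound h1 h2
  obtain ⟨B₂, L₂, b₂, l₂, H₂⟩ := exists_lipBound (hsm (1, 0)) (h2.fderiv_apply (𝕜 := ℝ) (1, 0))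
  obtain ⟨B₃, L₃, b₃, l₃, H₃⟩ := exists_lipBound (hsm (0, 1)) (h2.fderiv_apply (𝕜 := ℝ) (0, 1))
  have T := H₂.weaken (B' := B₁ + B₂ + B₃) (L' := L₁ + L₂ + L₃) (by linarith) (by linarith)
  have S := H₃.weaken (B' := B₁ + B₂ + B₃) (L' := L₁ + L₂ + L₃) (by linarith) (by linarith)
  rw [← et] at T
  rw [← ex] at S
  refine ⟨B₁ + B₂ + B₃, L₁ + L₂ + L₃, by linarith, by linarith,
    H₁.weaken (by linarith) (by linarith), T, S, fun t x => by rw [ex]; exact hx t x,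
    fun t x s y => ?_⟩
  set B := B₁ + B₂ + B₃
  have hB : 0 ≤ B := by positivity
  -- The increment is taken first in time at y, then in space at time t; the third term moves the
  -- time derivative from y back to x.
  have e1 := abs_sub_sub_mul_le (f := fun s => φ s y) (f' := fun s => timeDeriv φ s y) (x := t)
    (K := B) (fun z => by rw [et]; exact ht z y) (fun z => by simpa using T.lip t y z y) hB s
  have e2 := abs_sub_sub_mul_le (f := φ t) (f' := spaceDeriv φ t) (x := x)
    (K := B) (fun z => by rw [ex]; exact hx t z) (fun z => by simpa using S.lip t x t z) hB y
  have e3 : |(s - t) * (timeDeriv φ t y - timeDeriv φ t x)| ≤ |s - t| * (B * |y - x|) := by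
    rw [abs_mul]
    exact mul_le_mul_of_nonneg_left (by simpa using T.lip t x t y) (abs_nonneg _)
  calc _ = |(φ s y - φ t y - (s - t) * timeDeriv φ t y) +
        (φ t y - φ t x - (y - x) * spaceDeriv φ t x) +
        (s - t) * (timeDeriv φ t y - timeDeriv φ t x)| := by ring_nf
    _ ≤ _ := abs_add_three _ _ _
    _ ≤ B * |s - t| ^ 2 + B * |y - x| ^ 2 + |s - t| * (B * |y - x|) := by
        linarith
    _ ≤ _ := by
        have := mul_nonneg hB (mul_nonneg (abs_nonneg (s - t)) (abs_nonneg (y - x)))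
        nlinarith

/-! ### Summation of the local residuals -/

theorem integrableOn_Ioi_of_steps {I : ℝ → ℝ} {Δt T : ℝ} (hΔt : 0 < Δt)
    (hc : ∀ n : ℕ, ContinuousOn I (Icc (n * Δt) ((n + 1) * Δt))) (hI : ∀ t, T ≤ t → I t = 0) :
    (∀ n : ℕ, IntervalIntegrable I volume (n * Δt) ((n + 1 : ℕ) * Δt)) ∧
      IntegrableOn I (Ioi 0) := by
  have h1 : ∀ n : ℕ, IntervalIntegrable I volume (n * Δt) ((n + 1 : ℕ) * Δt) := fun n => by
    refine ContinuousOn.intervalIntegrable ?_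
    push_cast
    rw [uIcc_of_le (by nlinarith)]
    exact hc n
  refine ⟨h1, ?_⟩
  obtain ⟨N, hN⟩ := exists_nat_ge (T / Δt)
  rw [div_le_iff₀ hΔt] at hN
  have h2 := IntervalIntegrable.trans_iterate (a := fun n : ℕ => (n : ℝ) * Δt) (n := N)
    fun k _ => h1 k
  simp only [Nat.cast_zero, zero_mul] at h2
  rw [← Ioc_union_Ioi_eq_Ioi (show (0 : ℝ) ≤ N * Δt by positivity)]
  refine ((intervalIntegrable_iff_integrableOn_Ioc_of_le (by positivity)).1 h2).union ?_
  exact (integrableOn_zero (ε' := ℝ)).congr_fun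
    (fun t ht => (hI t (hN.trans (le_of_lt ht))).symm) measurableSet_Ioi

/-- As J vanishes from T on, `J 0` is minus the telescoping sum of its increments over the steps.
Each increment differs from the integral of I over the step by at most 2CΔt², half from the error of
the increment and half from freezing I at the left end. There are at most (T + Δt)/Δt steps. -/
theorem abs_residual_le {I J : ℝ → ℝ} {Δt T C : ℝ} (hΔt : 0 < Δt) (hT : 0 ≤ T) (hC : 0 ≤ C)
    (hc : ∀ n : ℕ, ContinuousOn I (Icc (n * Δt) ((n + 1) * Δt))) (hI : ∀ t, T ≤ t → I t = 0)
    (hJ : ∀ t, T ≤ t → J t = 0)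
    (h₁ : ∀ n : ℕ, n * Δt ≤ T →
      |J ((n + 1) * Δt) - J (n * Δt) - Δt * I (n * Δt)| ≤ C * Δt ^ 2)
    (h₂ : ∀ (n : ℕ) (t : ℝ), n * Δt ≤ T → n * Δt ≤ t → t ≤ (n + 1) * Δt →
      |I t - I (n * Δt)| ≤ C * Δt) :
    |(∫ t in Ioi 0, I t) + J 0| ≤ 2 * C * (T + Δt) * Δt := by
  obtain ⟨hint, hint'⟩ := integrableOn_Ioi_of_steps hΔt hc hI
  set N := ⌈T / Δt⌉₊ with hN
  have hN1 : T ≤ N * Δt := by rw [← div_le_iff₀ hΔt]; exact Nat.le_ceil _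
  have hN2 : N * Δt ≤ T + Δt := by
    have := (Nat.ceil_lt_add_one (div_nonneg hT hΔt.le)).le
    rw [← hN] at this
    calc N * Δt ≤ (T / Δt + 1) * Δt := mul_le_mul_of_nonneg_right this hΔt.le
      _ = T + Δt := by field_simp
  have e1 : ∫ t in Ioi 0, I t = ∑ n ∈ Finset.range N, ∫ t in (n * Δt)..((n + 1 : ℕ) * Δt), I t := by
    rw [intervalIntegral.sum_integral_adjacent_intervals (a := fun n : ℕ => (n : ℝ) * Δt)
      fun k _ => hint k]
    simp only [Nat.cast_zero, zero_mul]
    rw [intervalIntegral.integral_of_le (by positivity)]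
    refine setIntegral_eq_of_subset_of_forall_sdiff_eq_zero measurableSet_Ioi Ioc_subset_Ioi_self
      fun t ht => hI t (hN1.trans ?_)
    by_contra hlt
    exact ht.2 ⟨ht.1, (not_le.1 hlt).le⟩
  have e2 : J 0 = - ∑ n ∈ Finset.range N, (J ((n + 1 : ℕ) * Δt) - J (n * Δt)) := by
    rw [Finset.sum_range_sub (fun n : ℕ => J (n * Δt)), hJ _ hN1]
    simp
  have hstep : ∀ n ∈ Finset.range N,
      |(∫ t in (n * Δt)..((n + 1 : ℕ) * Δt), I t) - (J ((n + 1 : ℕ) * Δt) - J (n * Δt))| ≤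
        2 * C * Δt ^ 2 := by
    intro n hn
    have hnT : n * Δt ≤ T := by
      have : (n : ℝ) < T / Δt := Nat.lt_ceil.1 (Finset.mem_range.1 hn)
      rw [lt_div_iff₀ hΔt] at this
      exact this.le
    have a1 : ‖∫ t in (n * Δt)..((n + 1 : ℕ) * Δt), (I t - I (n * Δt))‖ ≤
        C * Δt * |((n + 1 : ℕ) * Δt) - n * Δt| := by
      refine intervalIntegral.norm_integral_le_of_norm_le_const fun t ht => ?_
      push_cast at ht
      rw [uIoc_of_le (by nlinarith)] at ht
      exact h₂ n t hnT ht.1.le ht.2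
    rw [intervalIntegral.integral_sub (hint n) (by simp), intervalIntegral.integral_const,
      Real.norm_eq_abs] at a1
    have a2 : ((n + 1 : ℕ) * Δt) - n * Δt = Δt := by push_cast; ring
    rw [a2, abs_of_pos hΔt, smul_eq_mul] at a1
    have a3 := h₁ n hnT
    rw [show ((n : ℝ) + 1) = (n + 1 : ℕ) by push_cast; rfl] at a3
    rw [abs_le] at a1 a3 ⊢
    constructor <;> nlinarith
  rw [e1, e2, ← sub_eq_add_neg, ← Finset.sum_sub_distrib]
  refine (Finset.abs_sum_le_sum_abs _ _).trans ((Finset.sum_le_sum hstep).trans ?_)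
  rw [Finset.sum_const, Finset.card_range, nsmul_eq_mul]
  calc (N : ℝ) * (2 * C * Δt ^ 2) = (2 * C * Δt) * (N * Δt) := by ring
    _ ≤ (2 * C * Δt) * (T + Δt) := mul_le_mul_of_nonneg_left hN2 (by positivity)
    _ = _ := by ring

/-! ### Passage to the limit in the inner integrals -/

/-- The times `t i` may vary with the data. Thus the lemma serves both for continuity in time at
fixed grid size and, with constant times, for the limit of vanishing grid size. The same holds for
`TestBound.tendsto_innerU`. -/
theorem TestBound.tendsto_innerF {B L Finf M : ℝ} {φ : ℝ → ℝ → ℝ} (hφ : TestBound B L φ)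
    {ι : Type*} {l : Filter ι} [l.IsCountablyGenerated] {t : ι → ℝ} {t₀ : ℝ}
    (ht : Tendsto t l (𝓝 t₀)) {u F : ι → ℝ → ℝ} {u₀ F₀ : ℝ → ℝ}
    (hF₀ : DistFn Finf F₀) (hF : ∀ᶠ i in l, DistFn Finf (F i))
    (hFl : ∀ᵐ x, Tendsto (fun i => F i x) l (𝓝 (F₀ x))) (hu₀ : Continuous u₀)
    (hu : ∀ᶠ i in l, Continuous (u i)) (hM : ∀ᶠ i in l, ∀ x, |u i x| ≤ M) (hM₀ : 0 ≤ M)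
    (hul : ∀ (y : ℝ) (z : ι → ℝ), Tendsto z l (𝓝 y) →
      Tendsto (fun i => u i (z i)) l (𝓝 (u₀ y))) :
    Tendsto (fun i => ∫ x, (timeDeriv φ (t i) x + u i x * spaceDeriv φ (t i) x)
        ∂(distMeasure (F i))) l
      (𝓝 (∫ x, (timeDeriv φ t₀ x + u₀ x * spaceDeriv φ t₀ x) ∂(distMeasure F₀))) := by
  refine hF₀.tendsto_integral (C := B + M * B) hF hFl ?_ ?_ ?_ ?_
  · exact (hφ.time.continuous_right _).add (hu₀.mul (hφ.space.continuous_right _))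
  · filter_upwards [hu] with i hi
    exact (hφ.time.continuous_right _).add (hi.mul (hφ.space.continuous_right _))
  · filter_upwards [hM] with i hi x
    refine (abs_add_le _ _).trans (add_le_add (hφ.time.bound _ _) ?_)
    rw [abs_mul]
    exact mul_le_mul (hi x) (hφ.space.bound _ _) (abs_nonneg _) hM₀
  · intro y z hz
    have h1 : Tendsto (fun i => (t i, z i)) l (𝓝 (t₀, y)) := ht.prodMk_nhds hz
    exact ((hφ.time.continuous.tendsto _).comp h1).add
      ((hul y z hz).mul ((hφ.space.continuous.tendsto _).comp h1))

theorem TestBound.abs_momentum_le {B L Finf M : ℝ} {φ : ℝ → ℝ → ℝ} (hφ : TestBound B L φ)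
    {u F : ℝ → ℝ} (hF : DistFn Finf F) (hM : ∀ x, |u x| ≤ M) (t x : ℝ) :
    |timeDeriv φ t x * u x + spaceDeriv φ t x * (1 / 2 * u x ^ 2) +
      φ t x * (1 / 2 * F x - 1 / 4 * Finf)| ≤
      (Icc (-L) L).indicator (fun _ => B * M + B * (1 / 2 * M ^ 2) + B * Finf) x := by
  by_cases hx : x ∈ Icc (-L) L
  · rw [indicator_of_mem hx]
    have hB := hφ.pos
    refine (abs_add_three _ _ _).trans (add_le_add (add_le_add ?_ ?_) ?_)
    · rw [abs_mul]
      exact mul_le_mul (hφ.time.bound _ _) (hM x) (abs_nonneg _) hB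
    · rw [abs_mul]
      refine mul_le_mul (hφ.space.bound _ _) ?_ (abs_nonneg _) hB
      rw [abs_of_nonneg (by positivity), ← sq_abs]
      have := pow_le_pow_left₀ (abs_nonneg _) (hM x) 2
      linarith
    · rw [abs_mul]
      refine mul_le_mul (hφ.val.bound _ _) ?_ (abs_nonneg _) hB
      rw [abs_le]
      constructor <;> linarith [hF.nonneg x, hF.le x]
  · have hx' : L ≤ |x| := by
      by_contra hlt
      exact hx ⟨(abs_lt.1 (not_le.1 hlt)).1.le, (abs_lt.1 (not_le.1 hlt)).2.le⟩
    rw [indicator_of_notMem hx, hφ.time.supp _ _ (Or.inr hx'), hφ.space.supp _ _ (Or.inr hx'),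
      hφ.val.supp _ _ (Or.inr hx')]
    simp

theorem TestBound.tendsto_innerU {B L Finf M : ℝ} {φ : ℝ → ℝ → ℝ} (hφ : TestBound B L φ)
    {ι : Type*} {l : Filter ι} [l.IsCountablyGenerated] {t : ι → ℝ} {t₀ : ℝ}
    (ht : Tendsto t l (𝓝 t₀)) {u F : ι → ℝ → ℝ} {u₀ F₀ : ℝ → ℝ}
    (hF : ∀ᶠ i in l, DistFn Finf (F i))
    (hFl : ∀ᵐ x, Tendsto (fun i => F i x) l (𝓝 (F₀ x)))
    (hu : ∀ᶠ i in l, Continuous (u i)) (hM : ∀ᶠ i in l, ∀ x, |u i x| ≤ M)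
    (hul : ∀ x, Tendsto (fun i => u i x) l (𝓝 (u₀ x))) :
    Tendsto (fun i => ∫ x, (timeDeriv φ (t i) x * u i x +
        spaceDeriv φ (t i) x * (1 / 2 * u i x ^ 2) +
        φ (t i) x * (1 / 2 * F i x - 1 / 4 * Finf))) l
      (𝓝 (∫ x, (timeDeriv φ t₀ x * u₀ x + spaceDeriv φ t₀ x * (1 / 2 * u₀ x ^ 2) +
        φ t₀ x * (1 / 2 * F₀ x - 1 / 4 * Finf)))) := by
  refine tendsto_integral_filter_of_dominated_convergence
    ((Icc (-L) L).indicator fun _ => B * M + B * (1 / 2 * M ^ 2) + B * Finf) ?_ ?_ ?_ ?_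
  · filter_upwards [hF, hu] with i h1 h2
    have h3 := h1.mono.measurable
    have h4 := (hφ.time.continuous_right (t i)).measurable
    have h5 := (hφ.space.continuous_right (t i)).measurable
    have h6 := (hφ.val.continuous_right (t i)).measurable
    have h7 := h2.measurable
    exact (by fun_prop : Measurable _).aestronglyMeasurable
  · filter_upwards [hF, hM] with i h1 h2
    exact Eventually.of_forall fun x => hφ.abs_momentum_le h1 h2 _ x
  · exact (integrable_indicator_iff measurableSet_Icc).2 (by simp)
  · filter_upwards [hFl] with x hx
    have h1 : Tendsto (fun i => (t i, x)) l (𝓝 (t₀, x)) := ht.prodMk_nhds tendsto_const_nhds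
    have a1 := (hφ.time.continuous.tendsto _).comp h1
    have a2 := (hφ.space.continuous.tendsto _).comp h1
    have a3 := (hφ.val.continuous.tendsto _).comp h1
    exact ((a1.mul (hul x)).add (a2.mul (((hul x).pow 2).const_mul _))).add
      (a3.mul ((hx.const_mul _).sub_const _))

/-! ### Continuity in time within a time step -/

theorem Dep.far {Finf h c : ℝ} {U F U' F' : ℝ → ℝ} (d : Dep h c U F U' F') (h₀ : ∀ x, 0 ≤ F' x)
    (h₁ : ∀ x, F' x ≤ Finf)
    (hf : ∃ R, (∀ x, x ≤ -R → F x = 0) ∧ ∀ x, R ≤ x → F x = Finf) :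
    ∃ R, (∀ x, x ≤ -R → F' x = 0) ∧ ∀ x, R ≤ x → F' x = Finf := by
  obtain ⟨R, a, b⟩ := hf
  refine ⟨R + h, fun x hx => le_antisymm ?_ (h₀ x), fun x hx => le_antisymm (h₁ x) ?_⟩
  · exact (d.F_le x).trans_eq (a _ (by linarith))
  · exact (b (x - h) (by linarith)).symm.trans_le (d.le_F x)

theorem GridState.distFn {Finf δ : ℝ} {U F : ℝ → ℝ} (hδ : 0 < δ) (h : GridState Finf δ U F)
    (hf : ∃ R, (∀ x, x ≤ -R → F x = 0) ∧ ∀ x, R ≤ x → F x = Finf) : DistFn Finf F :=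
  ⟨h.energy.mono, fun _ => (h.continuous_F hδ).continuousWithinAt, hf⟩

section

variable {Finf δ : ℝ} {w : (ℝ → ℝ) × (ℝ → ℝ)}

/-- The foot ξ(τ) of the characteristic through x is continuous in τ: expansion by the factor 1/2
gives |ξ(τ) - ξ(σ)| ≤ 2|X_τ(ξ(σ)) - x|, and X_τ(ξ(σ)) tends to x. The evolved values are continuous
functions of ξ(τ) and τ. -/
theorem GridState.tendsto_evolve (hδ : 0 < δ) (h : GridState Finf δ w.1 w.2) {Δt σ : ℝ}
    (hcfl : ∀ τ ∈ Icc 0 Δt, 4 * Finf * τ ^ 2 ≤ δ) (hσ : σ ∈ Icc 0 Δt) (x : ℝ) :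
    Tendsto (fun τ => (evolve Finf δ τ w).1 x) (𝓝[Icc 0 Δt] σ) (𝓝 ((evolve Finf δ σ w).1 x)) ∧
    Tendsto (fun τ => (evolve Finf δ τ w).2 x) (𝓝[Icc 0 Δt] σ) (𝓝 ((evolve Finf δ σ w).2 x)) := by
  set ξ : ℝ → ℝ := fun τ => Function.invFun (flowMap Finf τ w.1 w.2) x
  have hT : ∀ τ ∈ Icc 0 Δt, Transport Finf τ w.1 w.2 (evolve Finf δ τ w).1 (evolve Finf δ τ w).2 :=
    fun τ hτ => h.transport hδ (hcfl τ hτ)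
  have hξ : ∀ τ ∈ Icc 0 Δt, flowMap Finf τ w.1 w.2 (ξ τ) = x := fun τ hτ =>
    Function.invFun_eq ((hT τ hτ).surj x)
  have hlim : Tendsto ξ (𝓝[Icc 0 Δt] σ) (𝓝 (ξ σ)) := by
    rw [tendsto_iff_dist_tendsto_zero]
    have hc : Tendsto (fun τ => 2 * |flowMap Finf τ w.1 w.2 (ξ σ) - x|) (𝓝[Icc 0 Δt] σ) (𝓝 0) := by
      have : Continuous fun τ => 2 * |flowMap Finf τ w.1 w.2 (ξ σ) - x| := by
        unfold flowMap; fun_prop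
      have h0 := (this.tendsto σ).mono_left (nhdsWithin_le_nhds (s := Icc 0 Δt))
      rwa [hξ σ hσ, sub_self, abs_zero, mul_zero] at h0
    refine squeeze_zero' (Eventually.of_forall fun _ => dist_nonneg) ?_ hc
    filter_upwards [self_mem_nhdsWithin] with τ hτ
    rw [Real.dist_eq, show flowMap Finf τ w.1 w.2 (ξ σ) - x =
      flowMap Finf τ w.1 w.2 (ξ σ) - flowMap Finf τ w.1 w.2 (ξ τ) by rw [hξ τ hτ]]
    rcases le_total (ξ τ) (ξ σ) with hle | hle
    · have := (hT τ hτ).expand _ _ hle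
      rw [abs_sub_comm, abs_of_nonneg (sub_nonneg.2 hle)]
      linarith [le_abs_self (flowMap Finf τ w.1 w.2 (ξ σ) - flowMap Finf τ w.1 w.2 (ξ τ))]
    · have := (hT τ hτ).expand _ _ hle
      rw [abs_of_nonneg (sub_nonneg.2 hle)]
      linarith [neg_abs_le (flowMap Finf τ w.1 w.2 (ξ σ) - flowMap Finf τ w.1 w.2 (ξ τ))]
  have hτ : Tendsto (fun τ : ℝ => τ) (𝓝[Icc 0 Δt] σ) (𝓝 σ) := nhdsWithin_le_nhds
  have hU := (h.continuous_u.tendsto (ξ σ)).comp hlim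
  have hF := ((h.continuous_F hδ).tendsto (ξ σ)).comp hlim
  have e1 : ∀ τ ∈ Icc 0 Δt, (evolve Finf δ τ w).1 x =
      w.1 (ξ τ) + 1 / 2 * (w.2 (ξ τ) - 1 / 2 * Finf) * τ := fun τ hτ => by
    have := (hT τ hτ).u_eq (ξ τ); rwa [hξ τ hτ] at this
  have e2 : ∀ τ ∈ Icc 0 Δt, (evolve Finf δ τ w).2 x = w.2 (ξ τ) := fun τ hτ => by
    have := (hT τ hτ).F_eq (ξ τ); rwa [hξ τ hτ] at this
  constructor
  · rw [e1 σ hσ]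
    refine (hU.add (((hF.sub_const (1 / 2 * Finf)).const_mul (1 / 2)).mul hτ)).congr' ?_
    filter_upwards [self_mem_nhdsWithin] with τ hτ using (e1 τ hτ).symm
  · rw [e2 σ hσ]
    refine hF.congr' ?_
    filter_upwards [self_mem_nhdsWithin] with τ hτ using (e2 τ hτ).symm

theorem tendsto_gridInterp {ι : Type*} {l : Filter ι} {f : ι → ℝ → ℝ} {g : ℝ → ℝ}
    (h : ∀ x, Tendsto (fun i => f i x) l (𝓝 (g x))) (δ x : ℝ) :
    Tendsto (fun i => gridInterp δ (f i) x) l (𝓝 (gridInterp δ g x)) :=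
  (h _).add (((h _).sub (h _)).const_mul _)

end

/-! ### Continuity and integrability in time of the inner integrals -/

section NumSol

variable {Finf α M₀ R δ : ℝ} {u₀ F₀ : ℝ → ℝ}

/-- The right endpoint is included because a step of full length gives the next iterate. This is
what makes the numerical solution continuous on closed time steps. -/
theorem InitData.numSol_eq_step_of_le (hI : InitData Finf M₀ R u₀ F₀) (hF : 0 < Finf)
    (hα : α ∈ Ioc (0 : ℝ) 1) (hδ : 0 < δ) {t : ℝ} {n : ℕ}
    (h₁ : n * timeStep Finf α δ ≤ t) (h₂ : t ≤ (n + 1) * timeStep Finf α δ) :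
    numSol Finf α u₀ F₀ δ t =
      step Finf δ (t - n * timeStep Finf α δ) (iter Finf α u₀ F₀ δ n) := by
  rcases h₂.lt_or_eq with h | rfl
  · exact numSol_eq_step hF hα hδ h₁ h
  · have := hI.numSol_node hF hα hδ (n + 1)
    push_cast at this
    rw [this, iter_succ]
    congr 1
    ring

theorem InitData.iter_distFn (hI : InitData Finf M₀ R u₀ F₀) (hF : 0 < Finf)
    (hα : α ∈ Ioc (0 : ℝ) 1) (hδ : 0 < δ) (n : ℕ) : DistFn Finf (iter Finf α u₀ F₀ δ n).2 := by
  have hp := timeStep_pos hF hα hδ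
  have hcfl := timeStep_cfl hF hα hδ
  induction n with
  | zero =>
    have hs := hI.iter_state hF hα hδ 0
    refine hs.distFn hδ ?_
    have e : iter Finf α u₀ F₀ δ 0 = (gridInterp δ u₀, gridInterp δ F₀) := by
      rw [iter, iterate, project_eq hδ]
    have d := dep_gridInterp hδ u₀ hI.energy.mono
    rw [e] at hs ⊢
    exact d.far hs.nonneg hs.le ⟨R, hI.eq_zero, hI.eq_Finf⟩
  | succ n ih =>
    have hs := hI.iter_state hF hα hδ n
    have hs' := hI.iter_state hF hα hδ (n + 1)
    refine hs'.distFn hδ ?_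
    exact (hs.step_dep hδ hp.le hcfl (hI.abs_iterate_le hδ hp.le hcfl n)).far hs'.nonneg hs'.le ih.far

theorem InitData.num_distFn (hI : InitData Finf M₀ R u₀ F₀) (hF : 0 < Finf)
    (hα : α ∈ Ioc (0 : ℝ) 1) (hδ : 0 < δ) {t : ℝ} (ht : 0 ≤ t) :
    DistFn Finf (numF Finf α u₀ F₀ δ t) := by
  have hp := timeStep_pos hF hα hδ
  have hcfl := timeStep_cfl hF hα hδ
  have hG := hI.numSol_state hF hα hδ ht
  refine hG.distFn hδ ?_
  obtain ⟨n, h1, h2⟩ := exists_step hF hα hδ ht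
  have hs := hI.iter_state hF hα hδ n
  have d := hs.step_dep (τ := t - n * timeStep Finf α δ) hδ (by linarith)
    (cfl_of_le hF.le hcfl (by linarith) (by linarith)) (hI.abs_iterate_le hδ hp.le hcfl n)
  rw [← numSol_eq_step hF hα hδ h1 h2] at d
  exact d.far hG.nonneg hG.le (hI.iter_distFn hF hα hδ n).far

theorem InitData.num_tendsto (hI : InitData Finf M₀ R u₀ F₀) (hF : 0 < Finf)
    (hα : α ∈ Ioc (0 : ℝ) 1) (hδ : 0 < δ) {t : ℝ} {n : ℕ}
    (ht : t ∈ Icc (n * timeStep Finf α δ) ((n + 1) * timeStep Finf α δ)) (x : ℝ) :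
    Tendsto (fun s => numU Finf α u₀ F₀ δ s x)
      (𝓝[Icc (n * timeStep Finf α δ) ((n + 1) * timeStep Finf α δ)] t)
      (𝓝 (numU Finf α u₀ F₀ δ t x)) ∧
    Tendsto (fun s => numF Finf α u₀ F₀ δ s x)
      (𝓝[Icc (n * timeStep Finf α δ) ((n + 1) * timeStep Finf α δ)] t)
      (𝓝 (numF Finf α u₀ F₀ δ t x)) := by
  have hcfl := timeStep_cfl hF hα hδ
  set Δt := timeStep Finf α δ
  have hs := hI.iter_state hF hα hδ n
  have hmem : ∀ s ∈ Icc (n * Δt) ((n + 1) * Δt), s - n * Δt ∈ Icc 0 Δt := fun s hs =>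
    ⟨by linarith [hs.1], by linarith [hs.2]⟩
  have hsub : Tendsto (fun s => s - n * Δt) (𝓝[Icc (n * Δt) ((n + 1) * Δt)] t)
      (𝓝[Icc 0 Δt] (t - n * Δt)) := by
    refine tendsto_nhdsWithin_iff.2 ⟨?_, ?_⟩
    · exact ((continuous_sub_right _).tendsto t).mono_left nhdsWithin_le_nhds
    · filter_upwards [self_mem_nhdsWithin] with s hs using hmem s hs
  have hev := fun y => hs.tendsto_evolve hδ (Δt := Δt)
    (fun τ hτ => cfl_of_le hF.le hcfl hτ.1 hτ.2) (hmem t ht) y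
  have e : ∀ s ∈ Icc (n * Δt) ((n + 1) * Δt), numSol Finf α u₀ F₀ δ s =
      (gridInterp δ (evolve Finf δ (s - n * Δt) (iter Finf α u₀ F₀ δ n)).1,
        gridInterp δ (evolve Finf δ (s - n * Δt) (iter Finf α u₀ F₀ δ n)).2) := fun s hs => by
    rw [hI.numSol_eq_step_of_le hF hα hδ hs.1 hs.2, step_eq hδ]
  simp only [numU, numF]
  rw [e t ht]
  constructor
  · refine (tendsto_gridInterp (fun y => (hev y).1.comp hsub) δ x).congr' ?_
    filter_upwards [self_mem_nhdsWithin] with s hs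
    rw [e s hs]; rfl
  · refine (tendsto_gridInterp (fun y => (hev y).2.comp hsub) δ x).congr' ?_
    filter_upwards [self_mem_nhdsWithin] with s hs
    rw [e s hs]; rfl

/-- Pointwise convergence of functions that satisfy a uniform energy bound is continuous
convergence. -/
theorem EnergyIneq.tendsto_comp {ι : Type*} {l : Filter ι} {u F : ι → ℝ → ℝ} {K : ℝ}
    (hE : ∀ᶠ i in l, EnergyIneq (u i) (F i) ∧ ∀ x y, F i y - F i x ≤ K) {y c : ℝ}
    (hl : Tendsto (fun i => u i y) l (𝓝 c)) {z : ι → ℝ} (hz : Tendsto z l (𝓝 y)) :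
    Tendsto (fun i => u i (z i)) l (𝓝 c) := by
  have h0 : Tendsto (fun i => √(K * |z i - y|)) l (𝓝 0) := by
    have : Continuous fun a => √(K * |a - y|) := by fun_prop
    have h1 := (this.tendsto y).comp hz
    rwa [sub_self, abs_zero, mul_zero, Real.sqrt_zero] at h1
  have h1 : Tendsto (fun i => u i (z i) - u i y) l (𝓝 0) := by
    refine squeeze_zero_norm' ?_ h0
    filter_upwards [hE] with i hi using hi.1.abs_sub_le_sqrt hi.2 y (z i)
  simpa using h1.add hl

theorem InitData.continuousOn_inner (hI : InitData Finf M₀ R u₀ F₀) (hF : 0 < Finf)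
    (hα : α ∈ Ioc (0 : ℝ) 1) (hδ : 0 < δ) {B L : ℝ} {φ : ℝ → ℝ → ℝ} (hφ : TestBound B L φ) (n : ℕ) :
    ContinuousOn (innerU Finf (numU Finf α u₀ F₀ δ) (numF Finf α u₀ F₀ δ) φ)
      (Icc (n * timeStep Finf α δ) ((n + 1) * timeStep Finf α δ)) ∧
    ContinuousOn (innerF (numU Finf α u₀ F₀ δ) (numF Finf α u₀ F₀ δ) φ)
      (Icc (n * timeStep Finf α δ) ((n + 1) * timeStep Finf α δ)) := by
  have hp := timeStep_pos hF hα hδ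
  set Δt := timeStep Finf α δ with hΔt
  have hM := hI.M_nonneg
  have hpos : ∀ s ∈ Icc (n * Δt) ((n + 1) * Δt), 0 ≤ s := fun s hs =>
    le_trans (by positivity) hs.1
  have hmem : ∀ t, ∀ᶠ s in 𝓝[Icc (n * Δt) ((n + 1) * Δt)] t, s ∈ Icc (n * Δt) ((n + 1) * Δt) :=
    fun t => self_mem_nhdsWithin
  have hb : ∀ s ∈ Icc (n * Δt) ((n + 1) * Δt), ∀ x,
      |numU Finf α u₀ F₀ δ s x| ≤ M₀ + 1 / 4 * Finf * ((n + 1) * Δt) := fun s hs x =>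
    (hI.abs_numU_le hF hα hδ (hpos s hs) x).trans (by nlinarith [hs.2])
  constructor <;> intro t ht
  · refine hφ.tendsto_innerU (M := M₀ + 1 / 4 * Finf * ((n + 1) * Δt))
      (tendsto_id.mono_left nhdsWithin_le_nhds) ?_ ?_ ?_ ?_ ?_
    · filter_upwards [hmem t] with s hs using hI.num_distFn hF hα hδ (hpos s hs)
    · exact Eventually.of_forall fun x => (hI.num_tendsto hF hα hδ ht x).2
    · filter_upwards [hmem t] with s hs using (hI.numSol_state hF hα hδ (hpos s hs)).continuous_u
    · filter_upwards [hmem t] with s hs using hb s hs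
    · exact fun x => (hI.num_tendsto hF hα hδ ht x).1
  · refine hφ.tendsto_innerF (M := M₀ + 1 / 4 * Finf * ((n + 1) * Δt))
      (tendsto_id.mono_left nhdsWithin_le_nhds)
      (hI.num_distFn hF hα hδ (hpos t ht)) ?_ ?_ (hI.numSol_state hF hα hδ (hpos t ht)).continuous_u
      ?_ ?_ (by positivity) ?_
    · filter_upwards [hmem t] with s hs using hI.num_distFn hF hα hδ (hpos s hs)
    · exact Eventually.of_forall fun x => (hI.num_tendsto hF hα hδ ht x).2
    · filter_upwards [hmem t] with s hs using (hI.numSol_state hF hα hδ (hpos s hs)).continuous_u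
    · filter_upwards [hmem t] with s hs using hb s hs
    · intro y z hz
      refine EnergyIneq.tendsto_comp (F := numF Finf α u₀ F₀ δ) (K := Finf) ?_
        (hI.num_tendsto hF hα hδ ht y).1 hz
      filter_upwards [hmem t] with s hs
      exact ⟨(hI.numSol_state hF hα hδ (hpos s hs)).energy,
        (hI.numSol_state hF hα hδ (hpos s hs)).sub_le⟩

theorem TestBound.innerU_eq_zero {B L : ℝ} {φ : ℝ → ℝ → ℝ} (hφ : TestBound B L φ)
    (u F : ℝ → ℝ → ℝ) {t : ℝ} (ht : L ≤ t) : innerU Finf u F φ t = 0 := by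
  have h1 : ∀ x, timeDeriv φ t x = 0 := fun x => hφ.time.supp _ _ (Or.inl (ht.trans (le_abs_self t)))
  have h2 : ∀ x, spaceDeriv φ t x = 0 :=
    fun x => hφ.space.supp _ _ (Or.inl (ht.trans (le_abs_self t)))
  have h3 : ∀ x, φ t x = 0 := fun x => hφ.val.supp _ _ (Or.inl (ht.trans (le_abs_self t)))
  simp only [timeDeriv] at h1
  simp only [spaceDeriv] at h2
  simp [innerU, h1, h2, h3]

theorem TestBound.innerF_eq_zero {B L : ℝ} {φ : ℝ → ℝ → ℝ} (hφ : TestBound B L φ)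
    (u F : ℝ → ℝ → ℝ) {t : ℝ} (ht : L ≤ t) : innerF u F φ t = 0 := by
  have h1 : ∀ x, timeDeriv φ t x = 0 := fun x => hφ.time.supp _ _ (Or.inl (ht.trans (le_abs_self t)))
  have h2 : ∀ x, spaceDeriv φ t x = 0 :=
    fun x => hφ.space.supp _ _ (Or.inl (ht.trans (le_abs_self t)))
  simp only [timeDeriv] at h1
  simp only [spaceDeriv] at h2
  simp [innerF, h1, h2]

theorem InitData.integrableOn_inner (hI : InitData Finf M₀ R u₀ F₀) (hF : 0 < Finf)
    (hα : α ∈ Ioc (0 : ℝ) 1) (hδ : 0 < δ) {B L : ℝ} {φ : ℝ → ℝ → ℝ} (hφ : TestBound B L φ) :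
    IntegrableOn (innerU Finf (numU Finf α u₀ F₀ δ) (numF Finf α u₀ F₀ δ) φ) (Ioi 0) ∧
    IntegrableOn (innerF (numU Finf α u₀ F₀ δ) (numF Finf α u₀ F₀ δ) φ) (Ioi 0) :=
  ⟨(integrableOn_Ioi_of_steps (timeStep_pos hF hα hδ)
      (fun n => (hI.continuousOn_inner hF hα hδ hφ n).1) fun _ ht => hφ.innerU_eq_zero _ _ ht).2,
    (integrableOn_Ioi_of_steps (timeStep_pos hF hα hδ)
      (fun n => (hI.continuousOn_inner hF hα hδ hφ n).2) fun _ ht => hφ.innerF_eq_zero _ _ ht).2⟩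

end NumSol

/-! ### The residual in the transport equation -/

section

variable {Finf δ τ M : ℝ} {w : (ℝ → ℝ) × (ℝ → ℝ)}

/-- In the second bound, one √(Finf δ) accounts for the distance δ between the new quantile and the
transported one, the other for the interpolation error in u, and the last term for the forcing. -/
theorem GridState.quantile_step (hδ : 0 < δ) (h : GridState Finf δ w.1 w.2) (hτ : 0 ≤ τ)
    (hcfl : 4 * Finf * τ ^ 2 ≤ δ) (hd : DistFn Finf w.2) (hd' : DistFn Finf (step Finf δ τ w).2)
    {η : ℝ} (hη : η ∈ Ioo 0 Finf) :
    |quantile (step Finf δ τ w).2 η - quantile w.2 η - τ * w.1 (quantile w.2 η)| ≤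
      δ + 1 / 8 * Finf * τ ^ 2 ∧
    |(step Finf δ τ w).1 (quantile (step Finf δ τ w).2 η) - w.1 (quantile w.2 η)| ≤
      2 * √(Finf * δ) + 1 / 4 * Finf * τ := by
  have ht := h.transport hδ hcfl
  have hs := h.step_state hδ hcfl
  rw [step_eq hδ] at hd' hs ⊢
  simp only at hd' hs ⊢
  have hq := ht.abs_quantile_sub_le hδ h.energy hd hd' hη
  have hu := ht.u_eq (quantile w.2 η)
  set V := (evolve Finf δ τ w).1
  set H := (evolve Finf δ τ w).2
  set Y := quantile w.2 η
  set Y' := quantile (gridInterp δ H) η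
  have hf := abs_force_le (h.nonneg Y) (h.le Y)
  have hf1 : |1 / 4 * (w.2 Y - 1 / 2 * Finf) * τ ^ 2| ≤ 1 / 8 * Finf * τ ^ 2 := by
    rw [abs_mul, abs_mul, abs_of_nonneg (sq_nonneg τ), abs_of_nonneg (by norm_num : (0 : ℝ) ≤ 1 / 4)]
    have := mul_le_mul_of_nonneg_right hf (sq_nonneg τ)
    linarith
  have hf2 : |1 / 2 * (w.2 Y - 1 / 2 * Finf) * τ| ≤ 1 / 4 * Finf * τ := by
    rw [abs_mul, abs_mul, abs_of_nonneg hτ, abs_of_nonneg (by norm_num : (0 : ℝ) ≤ 1 / 2)]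
    have := mul_le_mul_of_nonneg_right hf hτ
    linarith
  constructor
  · calc |Y' - Y - τ * w.1 Y| = |(Y' - flowMap Finf τ w.1 w.2 Y) +
          1 / 4 * (w.2 Y - 1 / 2 * Finf) * τ ^ 2| := by simp only [flowMap]; ring_nf
      _ ≤ _ := (abs_add_le _ _).trans (add_le_add hq hf1)
  · have e1 : |gridInterp δ V Y' - gridInterp δ V (flowMap Finf τ w.1 w.2 Y)| ≤ √(Finf * δ) :=
      (hs.energy.abs_sub_le_sqrt hs.sub_le _ _).trans (Real.sqrt_le_sqrt
        (mul_le_mul_of_nonneg_left hq ((h.nonneg 0).trans (h.le 0))))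
    have e2 : |gridInterp δ V (flowMap Finf τ w.1 w.2 Y) - V (flowMap Finf τ w.1 w.2 Y)| ≤
        √(Finf * δ) := by
      have := (dep_gridInterp hδ V (ht.energy h.energy).mono).abs_u_sub_le_sqrt
        (ht.energy h.energy) (K := Finf)
        (fun x y => by linarith [ht.nonneg h.nonneg x, ht.le h.le y]) (flowMap Finf τ w.1 w.2 Y)
      linarith
    calc |gridInterp δ V Y' - w.1 Y| =
        |(gridInterp δ V Y' - gridInterp δ V (flowMap Finf τ w.1 w.2 Y)) +
          (gridInterp δ V (flowMap Finf τ w.1 w.2 Y) - V (flowMap Finf τ w.1 w.2 Y)) +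
          1 / 2 * (w.2 Y - 1 / 2 * Finf) * τ| := by rw [hu]; ring_nf
      _ ≤ _ := abs_add_three _ _ _
      _ ≤ _ := by linarith

/-- Bounds, in terms of a constant `E`, for the errors committed in a time step of length `Δt`. -/
structure StepErr (Finf δ M Δt E : ℝ) : Prop where
  pos : 0 < Δt
  M_nonneg : 0 ≤ M
  E_nonneg : 0 ≤ E
  cfl : 4 * Finf * Δt ^ 2 ≤ δ
  shift : M * Δt + 1 / 8 * Finf * Δt ^ 2 + δ ≤ E * Δt
  quad : δ + 1 / 8 * Finf * Δt ^ 2 ≤ E * Δt ^ 2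
  sqrt : 2 * √(Finf * δ) + 1 / 4 * Finf * Δt ≤ E * Δt

theorem abs_setIntegral_Ioo_le {Finf C : ℝ} (hF : 0 ≤ Finf) {g : ℝ → ℝ}
    (h : ∀ η ∈ Ioo 0 Finf, |g η| ≤ C) : |∫ η in Ioo 0 Finf, g η| ≤ C * Finf := by
  have := norm_setIntegral_le_of_norm_le_const (μ := volume) (s := Ioo 0 Finf) (f := g) (C := C)
    (by simp) h
  simpa [Measure.real, hF] using this

theorem DistFn.integrableOn_quantile {F g : ℝ → ℝ} (hF : DistFn Finf F) (hg : Continuous g) {C : ℝ}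
    (hC : ∀ x, |g x| ≤ C) : IntegrableOn (fun η => g (quantile F η)) (Ioo 0 Finf) := by
  refine Integrable.of_bound (C := C)
    (hg.measurable.comp_aemeasurable hF.aemeasurable_quantile).aestronglyMeasurable ?_
  exact Eventually.of_forall fun η => hC _

/-- In quantile variables all integrals run over the same interval (0, Finf), so the integrands can
be compared for each η. The quantile moves with velocity u up to EΔt², and Taylor expansion of φ
along its displacement gives the first bound. The second uses the Lipschitz bounds and the change
EΔt of u along the quantile. -/
theorem TestBound.transport_step {B L Δt E : ℝ} {φ : ℝ → ℝ → ℝ} (hφ : TestBound B L φ)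
    (hδ : 0 < δ) (h : GridState Finf δ w.1 w.2) (he : StepErr Finf δ M Δt E) (hM : ∀ x, |w.1 x| ≤ M)
    (hτ : 0 ≤ τ) (hτ' : τ ≤ Δt) (hd : DistFn Finf w.2) (hd' : DistFn Finf (step Finf δ τ w).2)
    (t : ℝ) :
    |(∫ x, φ (t + τ) x ∂(distMeasure (step Finf δ τ w).2)) - (∫ x, φ t x ∂(distMeasure w.2)) -
      τ * ∫ x, (timeDeriv φ t x + w.1 x * spaceDeriv φ t x) ∂(distMeasure w.2)| ≤
      (B * (1 + E) ^ 2 + B * E) * Finf * Δt ^ 2 ∧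
    |(∫ x, (timeDeriv φ (t + τ) x + (step Finf δ τ w).1 x * spaceDeriv φ (t + τ) x)
        ∂(distMeasure (step Finf δ τ w).2)) -
      ∫ x, (timeDeriv φ t x + w.1 x * spaceDeriv φ t x) ∂(distMeasure w.2)| ≤
      (B * (1 + E) + M * (B * (1 + E)) + E * B) * Finf * Δt := by
  have hF : 0 ≤ Finf := (h.nonneg 0).trans (h.le 0)
  have hcfl := cfl_of_le hF he.cfl hτ hτ'
  have hs := h.step_state hδ hcfl
  have hB := hφ.pos
  have hE := he.E_nonneg
  have hΔt := he.pos
  have hτ2 : τ ^ 2 ≤ Δt ^ 2 := pow_le_pow_left₀ hτ hτ' 2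
  have hM' : ∀ x, |(step Finf δ τ w).1 x| ≤ M + 1 / 4 * Finf * τ :=
    (h.step_dep hδ hτ hcfl hM).abs_le hM
  have c1 : Continuous fun x => timeDeriv φ t x + w.1 x * spaceDeriv φ t x :=
    (hφ.time.continuous_right _).add (h.continuous_u.mul (hφ.space.continuous_right _))
  have c2 : Continuous fun x => timeDeriv φ (t + τ) x +
      (step Finf δ τ w).1 x * spaceDeriv φ (t + τ) x :=
    (hφ.time.continuous_right _).add (hs.continuous_u.mul (hφ.space.continuous_right _))
  have bd : ∀ (v : ℝ → ℝ) (m s : ℝ), (∀ x, |v x| ≤ m) → ∀ x,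
      |timeDeriv φ s x + v x * spaceDeriv φ s x| ≤ B + m * B := fun v m s hv x => by
    refine (abs_add_le _ _).trans (add_le_add (hφ.time.bound _ _) ?_)
    rw [abs_mul]
    exact mul_le_mul (hv x) (hφ.space.bound _ _) (abs_nonneg _) ((abs_nonneg _).trans (hv 0))
  have key : ∀ η ∈ Ioo 0 Finf,
      |quantile (step Finf δ τ w).2 η - quantile w.2 η - τ * w.1 (quantile w.2 η)| ≤ E * Δt ^ 2 ∧
      |quantile (step Finf δ τ w).2 η - quantile w.2 η| ≤ E * Δt ∧
      |(step Finf δ τ w).1 (quantile (step Finf δ τ w).2 η) - w.1 (quantile w.2 η)| ≤ E * Δt := by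
    intro η hη
    obtain ⟨h1, h2⟩ := h.quantile_step hδ hτ hcfl hd hd' hη
    have h3 : δ + 1 / 8 * Finf * τ ^ 2 ≤ δ + 1 / 8 * Finf * Δt ^ 2 := by gcongr
    have h4 : |τ * w.1 (quantile w.2 η)| ≤ M * Δt := by
      rw [abs_mul, abs_of_nonneg hτ, mul_comm]
      exact mul_le_mul (hM _) hτ' hτ he.M_nonneg
    refine ⟨(h1.trans h3).trans he.quad, ?_, h2.trans (le_trans ?_ he.sqrt)⟩
    · have h5 := abs_add_le (quantile (step Finf δ τ w).2 η - quantile w.2 η -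
        τ * w.1 (quantile w.2 η)) (τ * w.1 (quantile w.2 η))
      rw [sub_add_cancel] at h5
      linarith [he.shift]
    · gcongr
  constructor
  · rw [hd'.integral_distMeasure (hφ.val.continuous_right _),
      hd.integral_distMeasure (hφ.val.continuous_right _), hd.integral_distMeasure c1,
      ← integral_const_mul, ← integral_sub, ← integral_sub]
    · refine (abs_setIntegral_Ioo_le (C := (B * (1 + E) ^ 2 + B * E) * Δt ^ 2) hF ?_).trans_eq
        (by ring)
      intro η hη
      obtain ⟨k1, k2, -⟩ := key η hη
      set Y := quantile w.2 η
      set Y' := quantile (step Finf δ τ w).2 η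
      have e1 := hφ.taylor t Y (t + τ) Y'
      rw [add_sub_cancel_left, abs_of_nonneg hτ] at e1
      have e2 : (τ + |Y' - Y|) ^ 2 ≤ ((1 + E) * Δt) ^ 2 :=
        pow_le_pow_left₀ (by positivity) (by linarith) 2
      have e3 : |(Y' - Y - τ * w.1 Y) * spaceDeriv φ t Y| ≤ E * Δt ^ 2 * B := by
        rw [abs_mul]
        exact mul_le_mul k1 (hφ.space.bound _ _) (abs_nonneg _) (by positivity)
      calc |φ (t + τ) Y' - φ t Y - τ * (timeDeriv φ t Y + w.1 Y * spaceDeriv φ t Y)|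
          = |(φ (t + τ) Y' - φ t Y - τ * timeDeriv φ t Y - (Y' - Y) * spaceDeriv φ t Y) +
            (Y' - Y - τ * w.1 Y) * spaceDeriv φ t Y| := by ring_nf
        _ ≤ B * (τ + |Y' - Y|) ^ 2 + E * Δt ^ 2 * B := (abs_add_le _ _).trans (add_le_add e1 e3)
        _ ≤ B * ((1 + E) * Δt) ^ 2 + E * Δt ^ 2 * B := by gcongr
        _ = _ := by ring
    · exact (hd'.integrableOn_quantile (hφ.val.continuous_right _) (hφ.val.bound _)).sub
        (hd.integrableOn_quantile (hφ.val.continuous_right _) (hφ.val.bound _))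
    · exact (hd.integrableOn_quantile c1 (bd _ _ _ hM)).const_mul τ
    · exact hd'.integrableOn_quantile (hφ.val.continuous_right _) (hφ.val.bound _)
    · exact hd.integrableOn_quantile (hφ.val.continuous_right _) (hφ.val.bound _)
  · rw [hd'.integral_distMeasure c2, hd.integral_distMeasure c1, ← integral_sub]
    · refine (abs_setIntegral_Ioo_le
        (C := (B * (1 + E) + M * (B * (1 + E)) + E * B) * Δt) hF ?_).trans_eq (by ring)
      intro η hη
      obtain ⟨-, k2, k3⟩ := key η hη
      set Y := quantile w.2 η
      set Y' := quantile (step Finf δ τ w).2 η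
      have e0 : |t + τ - t| + |Y' - Y| ≤ (1 + E) * Δt := by
        rw [add_sub_cancel_left, abs_of_nonneg hτ]; linarith
      have e1 := (hφ.time.lip t Y (t + τ) Y').trans (mul_le_mul_of_nonneg_left e0 hB)
      have e2 := (hφ.space.lip t Y (t + τ) Y').trans (mul_le_mul_of_nonneg_left e0 hB)
      have e3 : |w.1 Y * (spaceDeriv φ (t + τ) Y' - spaceDeriv φ t Y)| ≤
          M * (B * ((1 + E) * Δt)) := by
        rw [abs_mul]
        exact mul_le_mul (hM _) e2 (abs_nonneg _) he.M_nonneg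
      have e4 : |((step Finf δ τ w).1 Y' - w.1 Y) * spaceDeriv φ (t + τ) Y'| ≤ E * Δt * B := by
        rw [abs_mul]
        exact mul_le_mul k3 (hφ.space.bound _ _) (abs_nonneg _) (by positivity)
      calc |timeDeriv φ (t + τ) Y' + (step Finf δ τ w).1 Y' * spaceDeriv φ (t + τ) Y' -
            (timeDeriv φ t Y + w.1 Y * spaceDeriv φ t Y)|
          = |(timeDeriv φ (t + τ) Y' - timeDeriv φ t Y) +
            w.1 Y * (spaceDeriv φ (t + τ) Y' - spaceDeriv φ t Y) +
            ((step Finf δ τ w).1 Y' - w.1 Y) * spaceDeriv φ (t + τ) Y'| := by ring_nf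
        _ ≤ _ := abs_add_three _ _ _
        _ ≤ B * ((1 + E) * Δt) + M * (B * ((1 + E) * Δt)) + E * Δt * B := by linarith
        _ = _ := by ring
    · exact hd'.integrableOn_quantile c2 (bd _ _ _ hM')
    · exact hd.integrableOn_quantile c1 (bd _ _ _ hM)

end

section NumSol

variable {Finf α M₀ R δ : ℝ} {u₀ F₀ : ℝ → ℝ}

/-- The constant in the error bounds for a time step. -/
def errConst (Finf α M : ℝ) : ℝ :=
  M + (1 / 8 * Finf + 4 * Finf / α ^ 2) * (1 + α / (2 * √Finf)) +
    2 * √(Finf * (4 * Finf / α ^ 2)) + 1 / 4 * Finf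

theorem stepErr_timeStep {M : ℝ} (hF : 0 < Finf) (hα : α ∈ Ioc (0 : ℝ) 1) (hδ : 0 < δ)
    (hδ₁ : δ ≤ 1) (hM : 0 ≤ M) :
    StepErr Finf δ M (timeStep Finf α δ) (errConst Finf α M) := by
  have hp := timeStep_pos hF hα hδ
  have hle := timeStep_le hF hα hδ₁
  have hcfl := timeStep_cfl hF hα hδ
  have hδe := eq_mul_timeStep_sq hF hα hδ
  have hα0 := hα.1
  set Δt := timeStep Finf α δ
  have hK : 0 ≤ 4 * Finf / α ^ 2 := by positivity
  have hK' : 0 ≤ Finf * (4 * Finf / α ^ 2) := by positivity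
  have hS : 0 ≤ √(Finf * (4 * Finf / α ^ 2)) := Real.sqrt_nonneg _
  have hA : 0 ≤ 1 / 8 * Finf + 4 * Finf / α ^ 2 := by positivity
  have hD : 0 ≤ α / (2 * √Finf) := by positivity
  have hsq : Δt ^ 2 ≤ α / (2 * √Finf) * Δt := by nlinarith
  have hsum : δ + 1 / 8 * Finf * Δt ^ 2 = (1 / 8 * Finf + 4 * Finf / α ^ 2) * Δt ^ 2 := by
    linarith
  have hAD : 0 ≤ (1 / 8 * Finf + 4 * Finf / α ^ 2) * (α / (2 * √Finf)) := mul_nonneg hA hD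
  -- As δ is quadratic in Δt, the Hölder-1/2 errors of u are of first order in Δt.
  have hsqrt : √(Finf * δ) = √(Finf * (4 * Finf / α ^ 2)) * Δt := by
    rw [hδe, ← mul_assoc, Real.sqrt_mul hK', Real.sqrt_sq hp.le]
  refine ⟨hp, hM, by unfold errConst; positivity, hcfl, ?_, ?_, ?_⟩
  · have h1 := mul_le_mul_of_nonneg_left hsq hA
    have h2 : 0 ≤ ((1 / 8 * Finf + 4 * Finf / α ^ 2) + 2 * √(Finf * (4 * Finf / α ^ 2)) +
      1 / 4 * Finf) * Δt := by positivity
    calc M * Δt + 1 / 8 * Finf * Δt ^ 2 + δ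
        = M * Δt + (1 / 8 * Finf + 4 * Finf / α ^ 2) * Δt ^ 2 := by linarith
      _ ≤ _ := by unfold errConst; linarith
  · rw [hsum]
    refine mul_le_mul_of_nonneg_right ?_ (sq_nonneg _)
    unfold errConst
    linarith
  · rw [hsqrt]
    have h2 : 0 ≤ (M + (1 / 8 * Finf + 4 * Finf / α ^ 2) * (1 + α / (2 * √Finf))) * Δt := by
      positivity
    unfold errConst
    linarith

theorem isBigO_sqrt_of_residual {r : ℝ → ℝ} {C T : ℝ} (hF : 0 < Finf)
    (hα : α ∈ Ioc (0 : ℝ) 1) (hC : 0 ≤ C)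
    (h : ∀ δ, 0 < δ → δ ≤ 1 → |r δ| ≤ 2 * C * (T + timeStep Finf α δ) * timeStep Finf α δ) :
    r =O[𝓝[>] 0] fun δ => √δ := by
  have hα0 := hα.1
  set D := α / (2 * √Finf) with hD
  have hD0 : 0 ≤ D := by positivity
  refine IsBigO.of_bound (2 * C * (T + D) * D) ?_
  filter_upwards [Ioc_mem_nhdsGT (zero_lt_one (α := ℝ))] with δ hδ
  have h1 := timeStep_le hF hα hδ.2
  have hp := timeStep_pos hF hα hδ.1
  rw [Real.norm_eq_abs, Real.norm_eq_abs, abs_of_nonneg (Real.sqrt_nonneg δ)]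
  refine (h δ hδ.1 hδ.2).trans ?_
  have h2 : timeStep Finf α δ = D * √δ := rfl
  calc 2 * C * (T + timeStep Finf α δ) * timeStep Finf α δ
      ≤ 2 * C * (T + D) * timeStep Finf α δ := by gcongr
    _ = _ := by rw [h2]; ring

theorem InitData.weakF_isBigO (hI : InitData Finf M₀ R u₀ F₀) (hF : 0 < Finf)
    (hα : α ∈ Ioc (0 : ℝ) 1) {B L : ℝ} {φ : ℝ → ℝ → ℝ} (hφ : TestBound B L φ) :
    (fun δ => weakF (numF Finf α u₀ F₀ δ 0) (numU Finf α u₀ F₀ δ) (numF Finf α u₀ F₀ δ) φ)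
      =O[𝓝[>] 0] fun δ => √δ := by
  set M := M₀ + 1 / 4 * Finf * L
  have hL := hφ.L_pos
  have hM : 0 ≤ M := by have := hI.M_nonneg; positivity
  set E := errConst Finf α M
  have hB := hφ.pos
  have hE : 0 ≤ E := (stepErr_timeStep hF hα one_pos le_rfl hM).E_nonneg
  set C₁ := (B * (1 + E) ^ 2 + B * E) * Finf
  set C₂ := (B * (1 + E) + M * (B * (1 + E)) + E * B) * Finf
  have hC₁ : 0 ≤ C₁ := by positivity
  have hC₂ : 0 ≤ C₂ := by positivity
  refine isBigO_sqrt_of_residual (C := C₁ + C₂) (T := L) hF hα (by positivity) fun δ hδ hδ₁ => ?_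
  have he := stepErr_timeStep hF hα hδ hδ₁ hM
  have hp := timeStep_pos hF hα hδ
  set Δt := timeStep Finf α δ
  have hstep : ∀ (n : ℕ) (t : ℝ), n * Δt ≤ L → n * Δt ≤ t → t ≤ (n + 1) * Δt →
      |(∫ x, φ t x ∂(distMeasure (numF Finf α u₀ F₀ δ t))) -
        (∫ x, φ (n * Δt) x ∂(distMeasure (numF Finf α u₀ F₀ δ (n * Δt)))) -
        (t - n * Δt) * innerF (numU Finf α u₀ F₀ δ) (numF Finf α u₀ F₀ δ) φ (n * Δt)| ≤
          C₁ * Δt ^ 2 ∧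
      |innerF (numU Finf α u₀ F₀ δ) (numF Finf α u₀ F₀ δ) φ t -
        innerF (numU Finf α u₀ F₀ δ) (numF Finf α u₀ F₀ δ) φ (n * Δt)| ≤ C₂ * Δt := by
    intro n t hn h1 h2
    have e1 := hI.numSol_node hF hα hδ n
    have e2 := hI.numSol_eq_step_of_le hF hα hδ h1 h2
    have hd := hI.num_distFn hF hα hδ (t := t) (le_trans (by positivity) h1)
    simp only [innerF, numF, numU] at hd ⊢
    rw [e1, e2]
    rw [e2] at hd
    have := hφ.transport_step hδ (hI.iter_state hF hα hδ n) he (fun x =>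
      (hI.abs_iterate_le hδ hp.le he.cfl n x).trans (by simp only [M]; gcongr))
      (τ := t - n * Δt) (by linarith) (by linarith) (hI.iter_distFn hF hα hδ n) hd (n * Δt)
    rw [add_sub_cancel] at this
    exact this
  refine abs_residual_le (J := fun t => ∫ x, φ t x ∂(distMeasure (numF Finf α u₀ F₀ δ t))) hp hL
    (by positivity) (fun n => (hI.continuousOn_inner hF hα hδ hφ n).2)
    (fun t ht => hφ.innerF_eq_zero _ _ ht) (fun t ht => ?_) (fun n hn => ?_) fun n t hn h1 h2 => ?_
  · have : ∀ x, φ t x = 0 := fun x => hφ.val.supp _ _ (Or.inl (ht.trans (le_abs_self t)))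
    simp [this]
  · have := (hstep n ((n + 1) * Δt) hn (by nlinarith) le_rfl).1
    rw [show ((n : ℝ) + 1) * Δt - n * Δt = Δt by ring] at this
    refine this.trans ?_
    nlinarith [sq_nonneg Δt]
  · exact (hstep n t hn h1 h2).2.trans (by nlinarith)

end NumSol

/-! ### The residual in the momentum equation -/

/-- After translation the two integrals cancel except over an interval of length 2h at each end. -/
theorem intervalIntegral_shift_sub_le {F : ℝ → ℝ} {Finf h : ℝ} (hF : Monotone F)
    (h₀ : ∀ x, 0 ≤ F x) (h₁ : ∀ x, F x ≤ Finf) (hh : 0 ≤ h) (a b : ℝ) :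
    ∫ x in a..b, (F (x + h) - F (x - h)) ≤ 2 * h * Finf := by
  have hi : ∀ c d, IntervalIntegrable F volume c d := fun c d => hF.intervalIntegrable
  have m1 : Monotone fun x => F (x + h) := fun x y hxy => hF (by linarith)
  have m2 : Monotone fun x => F (x - h) := fun x y hxy => hF (by linarith)
  rw [intervalIntegral.integral_sub m1.intervalIntegrable m2.intervalIntegrable,
    intervalIntegral.integral_comp_add_right, intervalIntegral.integral_comp_sub_right]
  have e1 := intervalIntegral.integral_add_adjacent_intervals (hi (a - h) (b - h))
    (hi (b - h) (b + h))
  have e2 := intervalIntegral.integral_add_adjacent_intervals (hi (a - h) (a + h))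
    (hi (a + h) (b + h))
  have e3 : 0 ≤ ∫ x in (a - h)..(a + h), F x :=
    intervalIntegral.integral_nonneg (by linarith) fun x _ => h₀ x
  have e4 : ∫ x in (b - h)..(b + h), F x ≤ ∫ _ in (b - h)..(b + h), Finf :=
    intervalIntegral.integral_mono_on (by linarith) (hi _ _) (by simp) fun x _ => h₁ x
  rw [intervalIntegral.integral_const, smul_eq_mul] at e4
  linarith

theorem integral_eq_intervalIntegral {g : ℝ → ℝ} {L a b : ℝ} (hg : ∀ x, L ≤ |x| → g x = 0)
    (ha : a ≤ -L) (hb : L ≤ b) : ∫ x, g x = ∫ x in a..b, g x := by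
  refine (intervalIntegral.integral_eq_integral_of_support_subset fun x hx => ?_).symm
  have : |x| < L := not_le.1 fun h => hx (hg x h)
  rw [abs_lt] at this
  exact ⟨by linarith, by linarith⟩

theorem abs_integral_le_of_shift {F g : ℝ → ℝ} {Finf h a b L : ℝ} (hF : Monotone F)
    (h₀ : ∀ x, 0 ≤ F x) (h₁ : ∀ x, F x ≤ Finf) (hh : 0 ≤ h) (hL : 0 ≤ L) (hb : 0 ≤ b)
    (hg : ∀ x, L ≤ |x| → g x = 0) (hgb : ∀ x, |g x| ≤ a + b * (F (x + h) - F (x - h))) :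
    |∫ x, g x| ≤ 2 * L * a + b * (2 * h * Finf) := by
  have m1 : Monotone fun x => F (x + h) := fun x y hxy => hF (by linarith)
  have m2 : Monotone fun x => F (x - h) := fun x y hxy => hF (by linarith)
  have hi : IntervalIntegrable (fun x => b * (F (x + h) - F (x - h))) volume (-L) L :=
    (m1.intervalIntegrable.sub m2.intervalIntegrable).const_mul b
  rw [integral_eq_intervalIntegral hg le_rfl le_rfl, ← Real.norm_eq_abs]
  refine (intervalIntegral.norm_integral_le_of_norm_le (by linarith)
    (g := fun x => a + b * (F (x + h) - F (x - h))) (Eventually.of_forall fun x _ => hgb x)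
    ((by simp : IntervalIntegrable (fun _ => a) volume (-L) L).add hi)).trans ?_
  rw [intervalIntegral.integral_add (by simp) hi, intervalIntegral.integral_const_mul,
    intervalIntegral.integral_const, smul_eq_mul]
  have := mul_le_mul_of_nonneg_left (intervalIntegral_shift_sub_le hF h₀ h₁ hh (-L) L) hb
  linarith

/-- Here A is φ at the end of a characteristic; p, pt, px are φ and its derivatives at the start; U
is the velocity, f the acceleration, and S, G are the slopes of u and F. The last factor on the left
is the derivative of the flow map. G is not bounded uniformly in the grid size, so the remainder
must be at most linear in G, which can then be integrated. -/
theorem abs_expansion_le {A p pt px U f S G τ Δt M M₁ B E Finf : ℝ} (hτ : 0 ≤ τ) (hτ' : τ ≤ Δt)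
    (hB : 0 ≤ B) (hE : 0 ≤ E) (hA : |A| ≤ B) (hA₁ : |A - p| ≤ B * ((1 + E) * Δt))
    (hA₂ : |A - p - τ * (pt + U * px)| ≤ B * ((1 + E) ^ 2 + Finf) * Δt ^ 2) (hU : |U| ≤ M)
    (hf : |f| ≤ Finf) (hW : |U + f * τ| ≤ M₁) (hG : 0 ≤ G) (hS : |S| ≤ 1 / 2 * (1 + G)) :
    |A * (U + f * τ) * (1 + τ * S + 1 / 4 * τ ^ 2 * G) -
      (p * U + τ * (pt * U + px * U ^ 2 + p * f + p * U * S))| ≤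
      (M * (B * ((1 + E) ^ 2 + Finf)) + Finf * (B * (1 + E)) +
        (1 + G) * (B * (1 + E) * M + B * Finf) + G * (B * M₁)) * Δt ^ 2 := by
  have hΔt : 0 ≤ Δt := hτ.trans hτ'
  have hM : 0 ≤ M := (abs_nonneg _).trans hU
  have hF : 0 ≤ Finf := (abs_nonneg _).trans hf
  have hM₁ : 0 ≤ M₁ := (abs_nonneg _).trans hW
  have hτ2 : τ ^ 2 ≤ Δt ^ 2 := pow_le_pow_left₀ hτ hτ' 2
  have t1 : |U * (A - p - τ * (pt + U * px))| ≤ M * (B * ((1 + E) ^ 2 + Finf) * Δt ^ 2) := by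
    rw [abs_mul]; exact mul_le_mul hU hA₂ (abs_nonneg _) hM
  have t2 : |f * (τ * (A - p))| ≤ Finf * (Δt * (B * ((1 + E) * Δt))) := by
    rw [abs_mul, abs_mul, abs_of_nonneg hτ]
    exact mul_le_mul hf (mul_le_mul hτ' hA₁ (abs_nonneg _) hΔt) (by positivity) hF
  have t3 : |τ * (S * ((A - p) * U + A * (f * τ)))| ≤
      Δt * (1 / 2 * (1 + G) * (B * ((1 + E) * Δt) * M + B * (Finf * Δt))) := by
    rw [abs_mul, abs_mul, abs_of_nonneg hτ]
    refine mul_le_mul hτ' (mul_le_mul hS ((abs_add_le _ _).trans (add_le_add ?_ ?_))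
      (abs_nonneg _) (by positivity)) (by positivity) hΔt
    · rw [abs_mul]; exact mul_le_mul hA₁ hU (abs_nonneg _) (by positivity)
    · rw [abs_mul, abs_mul, abs_of_nonneg hτ]
      exact mul_le_mul hA (mul_le_mul hf hτ' hτ hF) (by positivity) hB
  have t4 : |1 / 4 * τ ^ 2 * G * (A * (U + f * τ))| ≤ 1 / 4 * Δt ^ 2 * G * (B * M₁) := by
    rw [abs_mul, abs_mul A, abs_of_nonneg (by positivity : 0 ≤ 1 / 4 * τ ^ 2 * G)]
    exact mul_le_mul (by gcongr) (mul_le_mul hA hW (abs_nonneg _) hB) (by positivity)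
      (by positivity)
  calc _ = |(U * (A - p - τ * (pt + U * px)) + f * (τ * (A - p)) +
        τ * (S * ((A - p) * U + A * (f * τ)))) + 1 / 4 * τ ^ 2 * G * (A * (U + f * τ))| := by
        ring_nf
    _ ≤ _ := (abs_add_le _ _).trans (add_le_add_left (abs_add_three _ _ _) _)
    _ ≤ _ := add_le_add (add_le_add (add_le_add t1 t2) t3) t4
    _ ≤ _ := by
      have q1 : 0 ≤ (1 + G) * (B * (1 + E) * M + B * Finf) * Δt ^ 2 := by positivity
      have q2 : 0 ≤ G * (B * M₁) * Δt ^ 2 := by positivity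
      nlinarith

section

variable {Finf δ τ M : ℝ} {w : (ℝ → ℝ) × (ℝ → ℝ)}

theorem GridState.gridSlope_F_nonneg (hδ : 0 < δ) (h : GridState Finf δ w.1 w.2) (x : ℝ) :
    0 ≤ gridSlope δ w.2 x :=
  div_nonneg (sub_nonneg.2 (h.energy.mono (by nlinarith))) hδ.le

theorem GridState.gridSlope_F_le (hδ : 0 < δ) (h : GridState Finf δ w.1 w.2) (x : ℝ) :
    gridSlope δ w.2 x ≤ Finf / δ :=
  div_le_div_of_nonneg_right (h.sub_le _ _) hδ.le

/-- The linear form of the energy inequality on one cell; it trades the slope of u for the slope of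
F, whose integral is under control. -/
theorem GridState.abs_gridSlope_u_le (hδ : 0 < δ) (h : GridState Finf δ w.1 w.2) (x : ℝ) :
    |gridSlope δ w.1 x| ≤ 1 / 2 * (1 + gridSlope δ w.2 x) := by
  have := h.energy.abs_sub_le (x := ⌊x / δ⌋ * δ) (y := (⌊x / δ⌋ + 1) * δ) (by nlinarith)
  rw [gridSlope, gridSlope, abs_div, abs_of_pos hδ, div_le_iff₀ hδ]
  calc _ ≤ _ := this
    _ = _ := by field_simp; ring

theorem GridState.intervalIntegrable_slope (hδ : 0 < δ) (h : GridState Finf δ w.1 w.2) (a b : ℝ) :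
    IntervalIntegrable (gridSlope δ w.1) volume a b ∧
      IntervalIntegrable (gridSlope δ w.2) volume a b := by
  have hb : ∀ {g : ℝ → ℝ} {C : ℝ}, Measurable g → (∀ x, |g x| ≤ C) →
      IntervalIntegrable g volume a b := fun {g C} hg hC => by
    rw [intervalIntegrable_iff]
    exact Measure.integrableOn_of_bounded (M := C) (by simp [uIoc]) hg.aestronglyMeasurable
      (Eventually.of_forall hC)
  have hF : ∀ x, |gridSlope δ w.2 x| ≤ Finf / δ := fun x => by
    rw [abs_of_nonneg (h.gridSlope_F_nonneg hδ x)]; exact h.gridSlope_F_le hδ x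
  refine ⟨hb (C := 1 / 2 * (1 + Finf / δ)) (measurable_gridSlope δ _) fun x =>
    (h.abs_gridSlope_u_le hδ x).trans ?_, hb (measurable_gridSlope δ _) hF⟩
  linarith [h.gridSlope_F_le hδ x]

theorem GridState.hasDerivWithinAt_u (hδ : 0 < δ) (h : GridState Finf δ w.1 w.2) (x : ℝ) :
    HasDerivWithinAt w.1 (gridSlope δ w.1 x) (Ioi x) x := by
  have := hasDerivWithinAt_gridInterp hδ w.1 x
  rwa [h.interp_u] at this

theorem GridState.hasDerivWithinAt_F (hδ : 0 < δ) (h : GridState Finf δ w.1 w.2) (x : ℝ) :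
    HasDerivWithinAt w.2 (gridSlope δ w.2 x) (Ioi x) x := by
  have := hasDerivWithinAt_gridInterp hδ w.2 x
  rwa [h.interp_F] at this

theorem GridState.hasDerivWithinAt_flowMap (hδ : 0 < δ) (h : GridState Finf δ w.1 w.2) (τ x : ℝ) :
    HasDerivWithinAt (flowMap Finf τ w.1 w.2)
      (1 + τ * gridSlope δ w.1 x + 1 / 4 * τ ^ 2 * gridSlope δ w.2 x) (Ioi x) x := by
  have h1 := ((hasDerivWithinAt_id x (Ioi x)).add ((h.hasDerivWithinAt_u hδ x).mul_const τ)).add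
    ((((h.hasDerivWithinAt_F hδ x).sub_const (1 / 2 * Finf)).const_mul (1 / 4)).mul_const (τ ^ 2))
  exact h1.congr_deriv (by ring)

/-- The slope itself may be as large as `Finf / δ`; only its integral is bounded independently of
the grid. -/
theorem GridState.integral_slope_F_le (hδ : 0 < δ) (h : GridState Finf δ w.1 w.2) (a b : ℝ) :
    ∫ x in a..b, gridSlope δ w.2 x ≤ Finf := by
  rw [intervalIntegral.integral_eq_sub_of_hasDeriv_right (h.continuous_F hδ).continuousOn
    (fun x _ => h.hasDerivWithinAt_F hδ x) (h.intervalIntegrable_slope hδ a b).2]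
  exact h.sub_le _ _

/-- Integration by parts for `φ u u_x`. -/
theorem TestBound.integral_mul_slope {B L K : ℝ} {φ : ℝ → ℝ → ℝ} (hφ : TestBound B L φ)
    (hδ : 0 < δ) (h : GridState Finf δ w.1 w.2) (hK : L ≤ K) (t : ℝ) :
    ∫ x in (-K)..K, φ t x * w.1 x * gridSlope δ w.1 x =
      - ∫ x in (-K)..K, spaceDeriv φ t x * (1 / 2 * w.1 x ^ 2) := by
  have hK0 : 0 ≤ K := hφ.L_pos.trans hK
  have cφ := hφ.val.continuous_right t
  have cx := hφ.space.continuous_right t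
  have cu := h.continuous_u
  have i1 : IntervalIntegrable (fun x => φ t x * w.1 x * gridSlope δ w.1 x) volume (-K) K :=
    (h.intervalIntegrable_slope hδ _ _).1.continuousOn_mul (cφ.mul cu).continuousOn
  have i2 : IntervalIntegrable (fun x => spaceDeriv φ t x * (1 / 2 * w.1 x ^ 2)) volume (-K) K :=
    (by fun_prop : Continuous _).intervalIntegrable _ _
  have hd : ∀ x, HasDerivWithinAt (fun x => φ t x * (1 / 2 * w.1 x ^ 2))
      (spaceDeriv φ t x * (1 / 2 * w.1 x ^ 2) + φ t x * w.1 x * gridSlope δ w.1 x) (Ioi x) x := by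
    intro x
    have h1 := (hφ.hasDerivAt t x).hasDerivWithinAt (s := Ioi x) |>.mul
      (((h.hasDerivWithinAt_u hδ x).pow 2).const_mul (1 / 2))
    exact h1.congr_deriv (by simp; ring)
  have key := intervalIntegral.integral_eq_sub_of_hasDeriv_right (a := -K) (b := K)
    (f := fun x => φ t x * (1 / 2 * w.1 x ^ 2)) (by fun_prop) (fun x _ => hd x) (i2.add i1)
  have z1 : φ t K = 0 := hφ.val.supp _ _ (Or.inr (hK.trans (le_abs_self K)))
  have z2 : φ t (-K) = 0 := hφ.val.supp _ _ (Or.inr (by rw [abs_neg]; exact hK.trans (le_abs_self K)))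
  rw [intervalIntegral.integral_add i2 i1, z1, z2] at key
  linarith

end

theorem integrable_of_eq_zero {g : ℝ → ℝ} {L : ℝ} (hc : Continuous g)
    (hg : ∀ x, L ≤ |x| → g x = 0) : Integrable g := by
  refine hc.integrable_of_hasCompactSupport (HasCompactSupport.intro (isCompact_Icc (a := -L) (b := L))
    fun x hx => hg x (le_of_not_gt fun hlt => hx ?_))
  exact ⟨(abs_lt.1 hlt).1.le, (abs_lt.1 hlt).2.le⟩

/-- The integrand in the weak form of the momentum equation. -/
def momentumDensity (Finf : ℝ) (φ : ℝ → ℝ → ℝ) (t : ℝ) (u F : ℝ → ℝ) (x : ℝ) : ℝ :=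
  timeDeriv φ t x * u x + spaceDeriv φ t x * (1 / 2 * u x ^ 2) +
    φ t x * (1 / 2 * F x - 1 / 4 * Finf)

section

variable {Finf δ τ M : ℝ} {w : (ℝ → ℝ) × (ℝ → ℝ)}

theorem TestBound.momentumDensity_eq_zero {B L : ℝ} {φ : ℝ → ℝ → ℝ} (hφ : TestBound B L φ)
    (t : ℝ) (u F : ℝ → ℝ) {x : ℝ} (hx : L ≤ |x|) : momentumDensity Finf φ t u F x = 0 := by
  simp [momentumDensity, hφ.time.supp t x (Or.inr hx), hφ.space.supp t x (Or.inr hx),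
    hφ.val.supp t x (Or.inr hx)]

theorem TestBound.continuous_momentumDensity {B L : ℝ} {φ : ℝ → ℝ → ℝ} (hφ : TestBound B L φ)
    (t : ℝ) {u F : ℝ → ℝ} (hu : Continuous u) (hF : Continuous F) :
    Continuous (momentumDensity Finf φ t u F) := by
  have h1 := hφ.val.continuous_right t
  have h2 := hφ.time.continuous_right t
  have h3 := hφ.space.continuous_right t
  unfold momentumDensity
  fun_prop

theorem StepErr.step_dep {Δt E : ℝ} (he : StepErr Finf δ M Δt E) (hδ : 0 < δ)
    (h : GridState Finf δ w.1 w.2) (hM : ∀ x, |w.1 x| ≤ M) (hτ : 0 ≤ τ) (hτ' : τ ≤ Δt) :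
    Dep (E * Δt) (1 / 4 * Finf * Δt) w.1 w.2 (step Finf δ τ w).1 (step Finf δ τ w).2 := by
  have hF : 0 ≤ Finf := (h.nonneg 0).trans (h.le 0)
  have hτ2 : τ ^ 2 ≤ Δt ^ 2 := pow_le_pow_left₀ hτ hτ' 2
  refine (h.step_dep hδ hτ (cfl_of_le hF he.cfl hτ hτ') hM).weaken h.energy.mono
    (le_trans ?_ he.shift) (by gcongr)
  have := he.M_nonneg
  gcongr

/-- The change of u in one step is only O(√Δt) in the sup norm, which would be too weak. The
difference is therefore bounded pointwise by O(Δt) plus a multiple of F(x + EΔt) - F(x - EΔt), and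
the integral of the latter is again O(Δt). -/
theorem TestBound.momentum_step_inner {B L Δt E D : ℝ} {φ : ℝ → ℝ → ℝ} (hφ : TestBound B L φ)
    (hδ : 0 < δ) (h : GridState Finf δ w.1 w.2) (he : StepErr Finf δ M Δt E) (hD : Δt ≤ D)
    (hM : ∀ x, |w.1 x| ≤ M) (hτ : 0 ≤ τ) (hτ' : τ ≤ Δt) (t : ℝ) :
    |(∫ x, momentumDensity Finf φ (t + τ) (step Finf δ τ w).1 (step Finf δ τ w).2 x) -
      ∫ x, momentumDensity Finf φ t w.1 w.2 x| ≤
      (2 * L * ((B + B * (M + Finf * D)) * (Finf + E) + B * (M + M ^ 2 + Finf)) +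
        (B + B * (M + Finf * D) + B) * (2 * E * Finf)) * Δt := by
  have hF : 0 ≤ Finf := (h.nonneg 0).trans (h.le 0)
  have hs := h.step_state hδ (cfl_of_le hF he.cfl hτ hτ')
  have d := he.step_dep hδ h hM hτ hτ'
  have hB := hφ.pos
  have hE := he.E_nonneg
  have hΔt := he.pos.le
  have hM0 := he.M_nonneg
  set M₁ := M + Finf * D
  have hFD : Finf * Δt ≤ Finf * D := mul_le_mul_of_nonneg_left hD hF
  have hM₁ : M ≤ M₁ := by have := mul_nonneg hF hΔt; simp only [M₁]; linarith
  have hu' : ∀ x, |(step Finf δ τ w).1 x| ≤ M₁ := fun x =>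
    (d.abs_le hM x).trans (by have := mul_nonneg hF hΔt; simp only [M₁]; linarith)
  have hM₁0 : 0 ≤ M₁ := hM0.trans hM₁
  rw [← integral_sub
    (integrable_of_eq_zero (hφ.continuous_momentumDensity _ hs.continuous_u (hs.continuous_F hδ))
      fun x hx => hφ.momentumDensity_eq_zero _ _ _ hx)
    (integrable_of_eq_zero (hφ.continuous_momentumDensity _ h.continuous_u (h.continuous_F hδ))
      fun x hx => hφ.momentumDensity_eq_zero _ _ _ hx)]
  refine (abs_integral_le_of_shift (F := w.2) (Finf := Finf) (h := E * Δt) (L := L)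
    (a := ((B + B * M₁) * (Finf + E) + B * (M + M ^ 2 + Finf)) * Δt) (b := B + B * M₁ + B)
    h.energy.mono h.nonneg h.le (by positivity) hφ.L_pos (by positivity) (fun x hx => ?_)
    fun x => ?_).trans_eq (by ring)
  · rw [hφ.momentumDensity_eq_zero _ _ _ hx, hφ.momentumDensity_eq_zero _ _ _ hx, sub_zero]
  have e1 := d.abs_u_sub_le h.energy x
  have e2 := d.abs_F_sub_le h.energy.mono (by positivity) x
  set W := w.2 (x + E * Δt) - w.2 (x - E * Δt)
  have hW : 0 ≤ W := (abs_nonneg _).trans e2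
  set u' := (step Finf δ τ w).1 x
  set F' := (step Finf δ τ w).2 x
  have lt : ∀ {g : ℝ → ℝ → ℝ}, LipBound B L g → |g (t + τ) x - g t x| ≤ B * Δt := fun {g} hg => by
    have := hg.lip t x (t + τ) x
    rw [add_sub_cancel_left, sub_self, abs_zero, add_zero, abs_of_nonneg hτ] at this
    exact this.trans (mul_le_mul_of_nonneg_left hτ' hB)
  have t1 : |timeDeriv φ (t + τ) x * (u' - w.1 x) +
      (timeDeriv φ (t + τ) x - timeDeriv φ t x) * w.1 x| ≤ B * |u' - w.1 x| + B * Δt * M := by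
    refine (abs_add_le _ _).trans (add_le_add ?_ ?_)
    · rw [abs_mul]; exact mul_le_mul_of_nonneg_right (hφ.time.bound _ _) (abs_nonneg _)
    · rw [abs_mul]; exact mul_le_mul (lt hφ.time) (hM x) (abs_nonneg _) (by positivity)
  have t2 : |1 / 2 * (spaceDeriv φ (t + τ) x * ((u' - w.1 x) * (u' + w.1 x))) +
      1 / 2 * ((spaceDeriv φ (t + τ) x - spaceDeriv φ t x) * w.1 x ^ 2)| ≤
      1 / 2 * (B * (|u' - w.1 x| * (2 * M₁))) + 1 / 2 * (B * Δt * M ^ 2) := by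
    refine (abs_add_le _ _).trans (add_le_add ?_ ?_)
    · rw [abs_mul, abs_mul, abs_mul, abs_of_nonneg (by norm_num : (0 : ℝ) ≤ 1 / 2)]
      have : |u' + w.1 x| ≤ 2 * M₁ := (abs_add_le _ _).trans (by linarith [hu' x, hM x])
      have := hφ.space.bound (t + τ) x
      gcongr
    · rw [abs_mul, abs_mul, abs_of_nonneg (by norm_num : (0 : ℝ) ≤ 1 / 2), abs_pow]
      have := lt hφ.space
      have := hM x
      gcongr
  have t3 : |1 / 2 * (φ (t + τ) x * (F' - w.2 x)) +
      (φ (t + τ) x - φ t x) * (1 / 2 * w.2 x - 1 / 4 * Finf)| ≤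
      1 / 2 * (B * |F' - w.2 x|) + B * Δt * Finf := by
    refine (abs_add_le _ _).trans (add_le_add ?_ ?_)
    · rw [abs_mul, abs_mul, abs_of_nonneg (by norm_num : (0 : ℝ) ≤ 1 / 2)]
      have := hφ.val.bound (t + τ) x
      gcongr
    · rw [abs_mul]
      refine mul_le_mul (lt hφ.val) ?_ (abs_nonneg _) (by positivity)
      rw [abs_le]
      constructor <;> linarith [h.nonneg x, h.le x]
  calc _ = |(timeDeriv φ (t + τ) x * (u' - w.1 x) +
        (timeDeriv φ (t + τ) x - timeDeriv φ t x) * w.1 x) +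
        (1 / 2 * (spaceDeriv φ (t + τ) x * ((u' - w.1 x) * (u' + w.1 x))) +
          1 / 2 * ((spaceDeriv φ (t + τ) x - spaceDeriv φ t x) * w.1 x ^ 2)) +
        (1 / 2 * (φ (t + τ) x * (F' - w.2 x)) +
          (φ (t + τ) x - φ t x) * (1 / 2 * w.2 x - 1 / 4 * Finf))| := by
        congr 1; simp only [momentumDensity, u', F']; ring
    _ ≤ _ := abs_add_three _ _ _
    _ ≤ _ := add_le_add (add_le_add t1 t2) t3
    _ = (B + B * M₁) * |u' - w.1 x| + 1 / 2 * B * |F' - w.2 x| +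
        B * (M + 1 / 2 * M ^ 2 + Finf) * Δt := by ring
    _ ≤ (B + B * M₁) * (1 / 4 * Finf * Δt + 1 / 2 * (E * Δt + W)) + 1 / 2 * B * W +
        B * (M + 1 / 2 * M ^ 2 + Finf) * Δt := by gcongr
    _ ≤ _ := by
      have q1 : 0 ≤ (B + B * M₁) * (Finf * Δt) := by positivity
      have q2 : 0 ≤ (B + B * M₁) * (E * Δt) := by positivity
      have q3 : 0 ≤ (B + B * M₁) * W := by positivity
      have q4 : 0 ≤ B * W := by positivity
      have q5 : 0 ≤ B * M ^ 2 * Δt := by positivity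
      linarith

/-- The substitution x = X(ξ). The flow map is continuous with a right derivative everywhere, which
suffices. -/
theorem TestBound.integral_mul_transport {B L K : ℝ} {φ : ℝ → ℝ → ℝ} (hφ : TestBound B L φ)
    (hδ : 0 < δ) (h : GridState Finf δ w.1 w.2) {V H : ℝ → ℝ} (ht : Transport Finf τ w.1 w.2 V H)
    (hV : Continuous V) (s : ℝ) (h₁ : flowMap Finf τ w.1 w.2 (-K) ≤ -L)
    (h₂ : L ≤ flowMap Finf τ w.1 w.2 K) :
    ∫ x, φ s x * V x = ∫ ξ in (-K)..K, φ s (flowMap Finf τ w.1 w.2 ξ) *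
      (w.1 ξ + 1 / 2 * (w.2 ξ - 1 / 2 * Finf) * τ) *
      (1 + τ * gridSlope δ w.1 ξ + 1 / 4 * τ ^ 2 * gridSlope δ w.2 ξ) := by
  have hX := h.continuous_flowMap hδ τ
  have hg : Continuous fun x => φ s x * V x := (hφ.val.continuous_right s).mul hV
  obtain ⟨i1, i2⟩ := h.intervalIntegrable_slope hδ (-K) K
  have hint : IntervalIntegrable (fun ξ => 1 + τ * gridSlope δ w.1 ξ +
      1 / 4 * τ ^ 2 * gridSlope δ w.2 ξ) volume (-K) K :=
    ((by simp : IntervalIntegrable (fun _ => (1 : ℝ)) volume (-K) K).add (i1.const_mul τ)).add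
      (i2.const_mul _)
  rw [integral_eq_intervalIntegral (L := L) (fun x hx => by
    rw [hφ.val.supp s x (Or.inr hx), zero_mul]) h₁ h₂]
  rw [← intervalIntegral.integral_comp_mul_deriv''' (g := fun x => φ s x * V x) hX.continuousOn
    (fun x _ => h.hasDerivWithinAt_flowMap hδ τ x) hg.continuousOn]
  · refine intervalIntegral.integral_congr fun ξ _ => ?_
    simp only [Function.comp_apply, ht.u_eq]
  · exact hg.continuousOn.integrableOn_compact (isCompact_uIcc.image hX)
  · have := hint.continuousOn_mul (hg.comp hX).continuousOn
    rw [intervalIntegrable_iff'] at this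
    exact this

/-- After substitution the coefficient of τ is φ_t u + φ_x u² + φ f + φ u u_x, with f = ½(F - ½F∞)
and the last term coming from the derivative of the flow map. Integration by parts replaces φ u u_x
by -½φ_x u², which leaves the momentum density. The projection contributes O(δ) = O(Δt²) in L¹. -/
theorem TestBound.momentum_step {B L Δt E D : ℝ} {φ : ℝ → ℝ → ℝ} (hφ : TestBound B L φ)
    (hδ : 0 < δ) (h : GridState Finf δ w.1 w.2) (he : StepErr Finf δ M Δt E) (hD : Δt ≤ D)
    (hM : ∀ x, |w.1 x| ≤ M) (hτ : 0 ≤ τ) (hτ' : τ ≤ Δt) (t : ℝ) :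
    |(∫ x, φ (t + τ) x * (step Finf δ τ w).1 x) - (∫ x, φ t x * w.1 x) -
      τ * ∫ x, momentumDensity Finf φ t w.1 w.2 x| ≤
      (B * (L + Finf) * E +
        (2 * (L + E * D) * (M * (B * ((1 + E) ^ 2 + Finf)) + Finf * (B * (1 + E)) +
          (B * (1 + E) * M + B * Finf)) +
          (B * (1 + E) * M + B * Finf + B * (M + Finf * D)) * Finf)) * Δt ^ 2 := by
  have hF : 0 ≤ Finf := (h.nonneg 0).trans (h.le 0)
  have hcfl := cfl_of_le hF he.cfl hτ hτ'
  have hs := h.step_state hδ hcfl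
  have ht := h.transport hδ hcfl
  have hE := he.E_nonneg
  have hB := hφ.pos
  have hL := hφ.L_pos
  have hΔt := he.pos.le
  have hM0 := he.M_nonneg
  have hD0 : 0 ≤ D := hΔt.trans hD
  have hτ2 : τ ^ 2 ≤ Δt ^ 2 := pow_le_pow_left₀ hτ hτ' 2
  have hst : (step Finf δ τ w).1 = gridInterp δ (evolve Finf δ τ w).1 := by rw [step_eq hδ]
  have hEH := ht.energy h.energy
  set V := (evolve Finf δ τ w).1
  set H := (evolve Finf δ τ w).2
  have hV : Continuous V := hEH.continuous (K := Finf)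
    fun x y => by linarith [ht.nonneg h.nonneg x, ht.le h.le y]
  have hshift : ∀ ξ, |flowMap Finf τ w.1 w.2 ξ - ξ| ≤ E * Δt := fun ξ => by
    refine (abs_flowMap_sub_le hτ h.nonneg h.le hM ξ).trans (le_trans ?_ he.shift)
    have : M * τ + 1 / 8 * Finf * τ ^ 2 ≤ M * Δt + 1 / 8 * Finf * Δt ^ 2 := by gcongr
    linarith
  have hφs : ∀ (s x : ℝ) (v : ℝ → ℝ), L ≤ |x| → φ s x * v x = 0 := fun s x v hx => by
    rw [hφ.val.supp s x (Or.inr hx), zero_mul]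
  -- the projection error
  have err₁ : |(∫ x, φ (t + τ) x * (step Finf δ τ w).1 x) - ∫ x, φ (t + τ) x * V x| ≤
      B * (L + Finf) * E * Δt ^ 2 := by
    have j : ∀ v : ℝ → ℝ, Continuous v → Integrable fun x => φ (t + τ) x * v x := fun v hv =>
      integrable_of_eq_zero ((hφ.val.continuous_right _).mul hv) fun x hx => hφs _ _ _ hx
    rw [← integral_sub (j _ hs.continuous_u) (j _ hV)]
    refine (abs_integral_le_of_shift (F := H) (Finf := Finf) (h := δ) (L := L) (a := B * (1 / 2 * δ))
      (b := B * (1 / 2)) hEH.mono (ht.nonneg h.nonneg) (ht.le h.le) hδ.le hL (by positivity)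
      (fun x hx => by rw [hφs _ _ _ hx, hφs _ _ _ hx, sub_zero]) fun x => ?_).trans ?_
    · rw [← mul_sub, abs_mul, hst]
      have e := (dep_gridInterp hδ V hEH.mono).abs_u_sub_le hEH x
      refine (mul_le_mul (hφ.val.bound _ _) e (abs_nonneg _) hB).trans_eq (by ring)
    · have hq : δ ≤ E * Δt ^ 2 := by
        have := mul_nonneg hF (sq_nonneg Δt)
        linarith [he.quad]
      have := mul_le_mul_of_nonneg_left hq (by positivity : 0 ≤ B * (L + Finf))
      linarith
  -- the change of variables
  set K := L + E * D
  have hED : E * Δt ≤ E * D := mul_le_mul_of_nonneg_left hD hE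
  have hLK : L ≤ K := by simp only [K]; linarith [mul_nonneg hE hD0]
  -- K exceeds L by at least the largest displacement EΔt, so the characteristics from ±K end
  -- outside (-L, L).
  have hcov := hφ.integral_mul_transport (K := K) hδ h ht hV (t + τ)
    (by have := (abs_le.1 (hshift (-K))).2; simp only [K] at *; linarith)
    (by have := (abs_le.1 (hshift K)).1; simp only [K] at *; linarith)
  obtain ⟨i1, i2⟩ := h.intervalIntegrable_slope hδ (-K) K
  have cφ := hφ.val.continuous_right t
  have ct := hφ.time.continuous_right t
  have cx := hφ.space.continuous_right t
  have cu := h.continuous_u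
  have cF := h.continuous_F hδ
  -- the expansion in powers of `τ`
  have e₀ : (∫ x, φ t x * w.1 x) + τ * ∫ x, momentumDensity Finf φ t w.1 w.2 x =
      ∫ x in (-K)..K, (φ t x * w.1 x + τ * (timeDeriv φ t x * w.1 x +
        spaceDeriv φ t x * w.1 x ^ 2 + φ t x * (1 / 2 * (w.2 x - 1 / 2 * Finf)) +
        φ t x * w.1 x * gridSlope δ w.1 x)) := by
    rw [integral_eq_intervalIntegral (fun x hx => hφs t x w.1 hx) (neg_le_neg hLK) hLK,
      integral_eq_intervalIntegral (fun x hx => hφ.momentumDensity_eq_zero t w.1 w.2 hx)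
        (neg_le_neg hLK) hLK]
    have j1 : IntervalIntegrable (fun x => φ t x * w.1 x * gridSlope δ w.1 x) volume (-K) K :=
      i1.continuousOn_mul (cφ.mul cu).continuousOn
    have j2 : IntervalIntegrable (momentumDensity Finf φ t w.1 w.2) volume (-K) K :=
      (hφ.continuous_momentumDensity t cu cF).intervalIntegrable _ _
    have j3 : IntervalIntegrable (fun x => spaceDeriv φ t x * (1 / 2 * w.1 x ^ 2)) volume (-K) K :=
      (by fun_prop : Continuous _).intervalIntegrable _ _
    have j4 : IntervalIntegrable (fun x => φ t x * w.1 x) volume (-K) K :=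
      (by fun_prop : Continuous _).intervalIntegrable _ _
    have e1 := hφ.integral_mul_slope hδ h hLK t
    have e2 : ∫ x in (-K)..K, (φ t x * w.1 x + τ * (timeDeriv φ t x * w.1 x +
        spaceDeriv φ t x * w.1 x ^ 2 + φ t x * (1 / 2 * (w.2 x - 1 / 2 * Finf)) +
        φ t x * w.1 x * gridSlope δ w.1 x)) =
        ∫ x in (-K)..K, (φ t x * w.1 x + τ * (momentumDensity Finf φ t w.1 w.2 x +
          (spaceDeriv φ t x * (1 / 2 * w.1 x ^ 2) + φ t x * w.1 x * gridSlope δ w.1 x))) := by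
      refine intervalIntegral.integral_congr fun x _ => ?_
      simp only [momentumDensity]
      ring
    rw [e2, intervalIntegral.integral_add j4 ((j2.add (j3.add j1)).const_mul τ),
      intervalIntegral.integral_const_mul, intervalIntegral.integral_add j2 (j3.add j1),
      intervalIntegral.integral_add j3 j1, e1]
    ring
  set c₃ := B * (1 + E) * M + B * Finf
  set c₁ := M * (B * ((1 + E) ^ 2 + Finf)) + Finf * (B * (1 + E)) + c₃
  set c₂ := c₃ + B * (M + Finf * D)
  have hc₂ : 0 ≤ c₂ := by positivity
  have err₂ : |(∫ x, φ (t + τ) x * V x) - ((∫ x, φ t x * w.1 x) +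
      τ * ∫ x, momentumDensity Finf φ t w.1 w.2 x)| ≤ (2 * K * c₁ + c₂ * Finf) * Δt ^ 2 := by
    have hi1 : IntervalIntegrable (fun ξ => φ (t + τ) (flowMap Finf τ w.1 w.2 ξ) *
      (w.1 ξ + 1 / 2 * (w.2 ξ - 1 / 2 * Finf) * τ) *
      (1 + τ * gridSlope δ w.1 ξ + 1 / 4 * τ ^ 2 * gridSlope δ w.2 ξ)) volume (-K) K := by
      refine IntervalIntegrable.continuousOn_mul (((by simp : IntervalIntegrable
        (fun _ => (1 : ℝ)) volume (-K) K).add (i1.const_mul τ)).add (i2.const_mul _)) ?_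
      have c1 := (hφ.val.continuous_right (t + τ)).comp (h.continuous_flowMap hδ τ)
      exact (c1.mul (by fun_prop)).continuousOn
    have hi2 : IntervalIntegrable (fun x => φ t x * w.1 x + τ * (timeDeriv φ t x * w.1 x +
        spaceDeriv φ t x * w.1 x ^ 2 + φ t x * (1 / 2 * (w.2 x - 1 / 2 * Finf)) +
        φ t x * w.1 x * gridSlope δ w.1 x)) volume (-K) K := by
      refine ((by fun_prop : Continuous _).intervalIntegrable _ _).add (IntervalIntegrable.const_mul
        (((by fun_prop : Continuous _).intervalIntegrable _ _).add
          (i1.continuousOn_mul (cφ.mul cu).continuousOn)) τ)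
    have hi3 : IntervalIntegrable (fun x => (c₁ + c₂ * gridSlope δ w.2 x) * Δt ^ 2) volume (-K) K :=
      ((by simp : IntervalIntegrable (fun _ => c₁) volume (-K) K).add (i2.const_mul c₂)).mul_const _
    rw [hcov, e₀, ← intervalIntegral.integral_sub hi1 hi2, ← Real.norm_eq_abs]
    refine (intervalIntegral.norm_integral_le_of_norm_le (by linarith)
      (Eventually.of_forall fun ξ _ => ?_) hi3).trans ?_
    · have hf := abs_force_le (h.nonneg ξ) (h.le ξ)
      have hf' : |1 / 2 * (w.2 ξ - 1 / 2 * Finf)| ≤ 1 / 4 * Finf := by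
        rw [abs_mul, abs_of_nonneg (by norm_num : (0 : ℝ) ≤ 1 / 2)]; linarith
      have hfτ : |1 / 2 * (w.2 ξ - 1 / 2 * Finf) * τ| ≤ 1 / 4 * Finf * τ := by
        rw [abs_mul, abs_of_nonneg hτ]; exact mul_le_mul_of_nonneg_right hf' hτ
      have hsum : |t + τ - t| + |flowMap Finf τ w.1 w.2 ξ - ξ| ≤ (1 + E) * Δt := by
        rw [add_sub_cancel_left, abs_of_nonneg hτ]; linarith [hshift ξ]
      rw [Real.norm_eq_abs]
      refine (abs_expansion_le (M := M) (M₁ := M + Finf * D) (B := B) (E := E) (Finf := Finf)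
        hτ hτ' hB hE (hφ.val.bound _ _)
        ((hφ.val.lip t ξ _ _).trans (mul_le_mul_of_nonneg_left hsum hB)) ?_ (hM ξ)
        (hf'.trans (by linarith)) ?_ (h.gridSlope_F_nonneg hδ ξ)
        (h.abs_gridSlope_u_le hδ ξ)).trans_eq (by simp only [c₁, c₂, c₃]; ring)
      · have e1 := (hφ.taylor t ξ (t + τ) (flowMap Finf τ w.1 w.2 ξ)).trans
          (mul_le_mul_of_nonneg_left (pow_le_pow_left₀ (by positivity) hsum 2) hB)
        -- The displacement along a characteristic exceeds τu by the acceleration term of order τ²,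
        -- which is moved to the remainder.
        have e2 : |1 / 2 * (w.2 ξ - 1 / 2 * Finf) * (1 / 2 * τ ^ 2) * spaceDeriv φ t ξ| ≤
            1 / 4 * Finf * (1 / 2 * Δt ^ 2) * B := by
          rw [abs_mul, abs_mul, abs_of_nonneg (by positivity : 0 ≤ 1 / 2 * τ ^ 2)]
          have := hφ.space.bound t ξ
          gcongr
        calc _ = |(φ (t + τ) (flowMap Finf τ w.1 w.2 ξ) - φ t ξ - (t + τ - t) * timeDeriv φ t ξ -
              (flowMap Finf τ w.1 w.2 ξ - ξ) * spaceDeriv φ t ξ) +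
              1 / 2 * (w.2 ξ - 1 / 2 * Finf) * (1 / 2 * τ ^ 2) * spaceDeriv φ t ξ| := by
              congr 1; simp only [flowMap]; ring
          _ ≤ _ := (abs_add_le _ _).trans (add_le_add e1 e2)
          _ ≤ _ := by
            have : 0 ≤ B * Finf * Δt ^ 2 := by positivity
            linarith
      · refine (abs_add_le _ _).trans ?_
        have : Finf * τ ≤ Finf * D := mul_le_mul_of_nonneg_left (hτ'.trans hD) hF
        have : 0 ≤ Finf * τ := by positivity
        linarith [hM ξ]
    · rw [intervalIntegral.integral_mul_const, intervalIntegral.integral_add (by simp)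
        (i2.const_mul c₂), intervalIntegral.integral_const_mul, intervalIntegral.integral_const,
        smul_eq_mul]
      refine mul_le_mul_of_nonneg_right ?_ (sq_nonneg _)
      have := mul_le_mul_of_nonneg_left (h.integral_slope_F_le hδ (-K) K) hc₂
      linarith
  have := abs_add_le ((∫ x, φ (t + τ) x * (step Finf δ τ w).1 x) - ∫ x, φ (t + τ) x * V x)
    ((∫ x, φ (t + τ) x * V x) - ((∫ x, φ t x * w.1 x) +
      τ * ∫ x, momentumDensity Finf φ t w.1 w.2 x))
  rw [sub_add_sub_cancel, ← sub_sub] at this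
  refine this.trans ((add_le_add err₁ err₂).trans_eq ?_)
  ring

end

/-! ### Summation of the momentum residuals -/

section NumSol

variable {Finf α M₀ R δ : ℝ} {u₀ F₀ : ℝ → ℝ}

theorem InitData.weakU_isBigO (hI : InitData Finf M₀ R u₀ F₀) (hF : 0 < Finf)
    (hα : α ∈ Ioc (0 : ℝ) 1) {B L : ℝ} {φ : ℝ → ℝ → ℝ} (hφ : TestBound B L φ) :
    (fun δ => weakU Finf (numU Finf α u₀ F₀ δ 0) (numU Finf α u₀ F₀ δ) (numF Finf α u₀ F₀ δ) φ)
      =O[𝓝[>] 0] fun δ => √δ := by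
  set M := M₀ + 1 / 4 * Finf * L
  have hL := hφ.L_pos
  have hα0 := hα.1
  have hM : 0 ≤ M := by have := hI.M_nonneg; positivity
  set E := errConst Finf α M
  have hB := hφ.pos
  have hE : 0 ≤ E := (stepErr_timeStep hF hα one_pos le_rfl hM).E_nonneg
  set D := α / (2 * √Finf)
  have hD : 0 ≤ D := by positivity
  set C₁ := B * (L + Finf) * E +
        (2 * (L + E * D) * (M * (B * ((1 + E) ^ 2 + Finf)) + Finf * (B * (1 + E)) +
          (B * (1 + E) * M + B * Finf)) +
          (B * (1 + E) * M + B * Finf + B * (M + Finf * D)) * Finf)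
  set C₂ := 2 * L * ((B + B * (M + Finf * D)) * (Finf + E) + B * (M + M ^ 2 + Finf)) +
        (B + B * (M + Finf * D) + B) * (2 * E * Finf)
  have hC₁ : 0 ≤ C₁ := by positivity
  have hC₂ : 0 ≤ C₂ := by positivity
  refine isBigO_sqrt_of_residual (C := C₁ + C₂) (T := L) hF hα (by positivity)
    fun δ hδ hδ₁ => ?_
  have he := stepErr_timeStep hF hα hδ hδ₁ hM
  have hp := timeStep_pos hF hα hδ
  have hle := timeStep_le hF hα hδ₁
  set Δt := timeStep Finf α δ
  have hstep : ∀ (n : ℕ) (t : ℝ), n * Δt ≤ L → n * Δt ≤ t → t ≤ (n + 1) * Δt →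
      |(∫ x, φ t x * numU Finf α u₀ F₀ δ t x) -
        (∫ x, φ (n * Δt) x * numU Finf α u₀ F₀ δ (n * Δt) x) -
        (t - n * Δt) * innerU Finf (numU Finf α u₀ F₀ δ) (numF Finf α u₀ F₀ δ) φ (n * Δt)| ≤
          C₁ * Δt ^ 2 ∧
      |innerU Finf (numU Finf α u₀ F₀ δ) (numF Finf α u₀ F₀ δ) φ t -
        innerU Finf (numU Finf α u₀ F₀ δ) (numF Finf α u₀ F₀ δ) φ (n * Δt)| ≤ C₂ * Δt := by
    intro n t hn h1 h2
    have e1 := hI.numSol_node hF hα hδ n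
    have e2 := hI.numSol_eq_step_of_le hF hα hδ h1 h2
    have hs := hI.iter_state hF hα hδ n
    have hb : ∀ x, |(iter Finf α u₀ F₀ δ n).1 x| ≤ M := fun x =>
      (hI.abs_iterate_le hδ hp.le he.cfl n x).trans (by simp only [M]; gcongr)
    simp only [innerU, numF, numU]
    rw [e1, e2]
    have a1 := hφ.momentum_step hδ hs he hle hb (τ := t - n * Δt) (by linarith) (by linarith)
      (n * Δt)
    have a2 := hφ.momentum_step_inner hδ hs he hle hb (τ := t - n * Δt) (by linarith) (by linarith)
      (n * Δt)
    rw [add_sub_cancel] at a1 a2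
    exact ⟨a1, a2⟩
  refine abs_residual_le (J := fun t => ∫ x, φ t x * numU Finf α u₀ F₀ δ t x) hp hL
    (by positivity) (fun n => (hI.continuousOn_inner hF hα hδ hφ n).1)
    (fun t ht => hφ.innerU_eq_zero _ _ ht) (fun t ht => ?_) (fun n hn => ?_) fun n t hn h1 h2 => ?_
  · have : ∀ x, φ t x = 0 := fun x => hφ.val.supp _ _ (Or.inl (ht.trans (le_abs_self t)))
    simp [this]
  · have := (hstep n ((n + 1) * Δt) hn (by nlinarith) le_rfl).1
    rw [show ((n : ℝ) + 1) * Δt - n * Δt = Δt by ring] at this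
    refine this.trans ?_
    nlinarith [sq_nonneg Δt]
  · exact (hstep n t hn h1 h2).2.trans (by nlinarith)

end NumSol

/-! ### The initial data -/

/-- A sequence of bump functions that concentrate at the origin. -/
def bumpSeq (n : ℕ) : ContDiffBump (0 : ℝ) where
  rIn := 1 / (n + 1) / 2
  rOut := 1 / (n + 1)
  rIn_pos := by positivity
  rIn_lt_rOut := half_lt_self (by positivity)

theorem tendsto_bumpSeq_rOut : Tendsto (fun n => (bumpSeq n).rOut) atTop (𝓝 0) :=
  tendsto_one_div_add_atTop_nhds_zero_nat

/-- A smooth approximation of the indicator function of `[a, b]`. -/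
def smoothIndicator (a b : ℝ) (n : ℕ) (x : ℝ) : ℝ :=
  ∫ y in (a - x)..(b - x), (bumpSeq n).normed volume y

section SmoothIndicator

variable {a b : ℝ}

theorem hasDerivAt_smoothIndicator (n : ℕ) (x : ℝ) :
    HasDerivAt (smoothIndicator a b n)
      ((bumpSeq n).normed volume (a - x) - (bumpSeq n).normed volume (b - x)) x := by
  have hc : Continuous ((bumpSeq n).normed volume) := (bumpSeq n).continuous_normed
  have key : ∀ c, HasDerivAt (fun x => ∫ y in (0 : ℝ)..(c - x), (bumpSeq n).normed volume y)
      (- (bumpSeq n).normed volume (c - x)) x := fun c => by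
    have h1 := (hc.integral_hasStrictDerivAt 0 (c - x)).hasDerivAt
    have h2 : HasDerivAt (fun x : ℝ => c - x) (-1) x := by
      simpa using (hasDerivAt_id x).const_sub c
    have h3 := h1.scomp x h2
    simpa [Function.comp_def] using h3
  have e : smoothIndicator a b n = fun x =>
      (∫ y in (0 : ℝ)..(b - x), (bumpSeq n).normed volume y) -
        ∫ y in (0 : ℝ)..(a - x), (bumpSeq n).normed volume y := by
    funext x
    rw [smoothIndicator, intervalIntegral.integral_interval_sub_left (hc.intervalIntegrable _ _)
      (hc.intervalIntegrable _ _)]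
  rw [e]
  exact ((key b).fun_sub (key a)).congr_deriv (by ring)

theorem contDiff_smoothIndicator (n : ℕ) : ContDiff ℝ ∞ (smoothIndicator a b n) := by
  rw [contDiff_infty_iff_deriv]
  refine ⟨fun x => (hasDerivAt_smoothIndicator n x).differentiableAt, ?_⟩
  have e : deriv (smoothIndicator a b n) = fun x =>
      (bumpSeq n).normed volume (a - x) - (bumpSeq n).normed volume (b - x) :=
    funext fun x => (hasDerivAt_smoothIndicator n x).deriv
  rw [e]
  have h : ContDiff ℝ ∞ ((bumpSeq n).normed volume) := (bumpSeq n).contDiff_normed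
  exact (h.comp (contDiff_const.sub contDiff_id)).sub (h.comp (contDiff_const.sub contDiff_id))

theorem bumpSeq_eq_zero {n : ℕ} {y : ℝ} (hy : 1 / (n + 1) ≤ |y|) :
    (bumpSeq n).normed volume y = 0 := by
  by_contra hne
  have : y ∈ Function.support ((bumpSeq n).normed volume) := hne
  rw [ContDiffBump.support_normed_eq, mem_ball_zero_iff, Real.norm_eq_abs] at this
  exact absurd hy (not_le.2 this)

theorem smoothIndicator_eq_zero (hab : a ≤ b) {n : ℕ} {x : ℝ}
    (hx : x ≤ a - 1 / (n + 1) ∨ b + 1 / (n + 1) ≤ x) : smoothIndicator a b n x = 0 := by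
  rw [smoothIndicator, intervalIntegral.integral_congr (g := fun _ => 0)]
  · simp
  · intro y hy
    rw [uIcc_of_le (by linarith)] at hy
    refine bumpSeq_eq_zero (le_abs.2 ?_)
    rcases hx with hx | hx
    · left; linarith [hy.1]
    · right; linarith [hy.2]

theorem smoothIndicator_eq_one {n : ℕ} {x : ℝ} (h₁ : a + 1 / (n + 1) ≤ x)
    (h₂ : x ≤ b - 1 / (n + 1)) : smoothIndicator a b n x = 1 := by
  rw [smoothIndicator, intervalIntegral.integral_eq_integral_of_support_subset,
    (bumpSeq n).integral_normed]
  rw [ContDiffBump.support_normed_eq]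
  intro y hy
  rw [mem_ball_zero_iff, Real.norm_eq_abs, abs_lt] at hy
  have : (bumpSeq n).rOut = 1 / (n + 1) := rfl
  rw [this] at hy
  exact ⟨by linarith, by linarith⟩

theorem abs_smoothIndicator_le (n : ℕ) (x : ℝ) : |smoothIndicator a b n x| ≤ 1 := by
  have h := intervalIntegral.norm_integral_le_integral_norm_uIoc (μ := volume)
    (f := (bumpSeq n).normed volume) (a := a - x) (b := b - x)
  refine h.trans ?_
  rw [← (bumpSeq n).integral_normed (μ := volume)]
  have e : ∀ y, ‖(bumpSeq n).normed volume y‖ = (bumpSeq n).normed volume y := fun y => by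
    rw [Real.norm_eq_abs, abs_of_nonneg ((bumpSeq n).nonneg_normed y)]
  simp_rw [e]
  exact setIntegral_le_integral (bumpSeq n).integrable_normed
    (Eventually.of_forall fun y => (bumpSeq n).nonneg_normed y)

theorem tendsto_smoothIndicator {x : ℝ} (ha : x ≠ a) (hb : x ≠ b) (hab : a ≤ b) :
    Tendsto (fun n => smoothIndicator a b n x) atTop (𝓝 ((Ioc a b).indicator 1 x)) := by
  have hlim : Tendsto (fun n : ℕ => 1 / ((n : ℝ) + 1)) atTop (𝓝 0) :=
    tendsto_one_div_add_atTop_nhds_zero_nat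
  refine tendsto_const_nhds.congr' ?_
  by_cases hx : x ∈ Ioc a b
  · have h1 : 0 < min (x - a) (b - x) :=
      lt_min (sub_pos.2 hx.1) (sub_pos.2 (lt_of_le_of_ne hx.2 hb))
    filter_upwards [hlim.eventually (gt_mem_nhds h1)] with n hn
    rw [lt_min_iff] at hn
    rw [indicator_of_mem hx, smoothIndicator_eq_one (by linarith) (by linarith), Pi.one_apply]
  · rw [indicator_of_notMem hx]
    rcases lt_or_gt_of_ne ha with h | h
    · filter_upwards [hlim.eventually (gt_mem_nhds (sub_pos.2 h))] with n hn
      rw [smoothIndicator_eq_zero hab (Or.inl (by linarith))]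
    · have hbx : b < x := not_le.1 fun hle => hx ⟨h, hle⟩
      filter_upwards [hlim.eventually (gt_mem_nhds (sub_pos.2 hbx))] with n hn
      rw [smoothIndicator_eq_zero hab (Or.inr (by linarith))]

end SmoothIndicator

/-- A continuous function with a locally integrable weak derivative is its primitive. -/
theorem IsWeakDeriv.sub_eq_integral {u v : ℝ → ℝ} (h : IsWeakDeriv u v) (hu : Continuous u)
    (hv : LocallyIntegrable v) {a b : ℝ} (hab : a ≤ b) : u b - u a = ∫ x in a..b, v x := by
  have hvi : IntegrableOn v (Icc (a - 1) (b + 1)) := hv.integrableOn_isCompact isCompact_Icc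
  have hn1 : ∀ n : ℕ, 1 / ((n : ℝ) + 1) ≤ 1 := fun n => by
    rw [div_le_one (by positivity)]; linarith [n.cast_nonneg (α := ℝ)]
  have hzero : ∀ (n : ℕ) (x : ℝ), x ∉ Icc (a - 1) (b + 1) → smoothIndicator a b n x = 0 := by
    intro n x hx
    refine smoothIndicator_eq_zero hab ?_
    by_contra! hc
    exact hx ⟨by linarith [hn1 n], by linarith [hn1 n]⟩
  -- The derivative of the smooth indicator is a mollifier centred at a minus one centred at b, and
  -- mollification converges at points of continuity.
  have lim₁ : Tendsto (fun n => ∫ x, u x * deriv (smoothIndicator a b n) x) atTop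
      (𝓝 (u a - u b)) := by
    have hconv : ∀ c, Tendsto (fun n => ∫ x, (bumpSeq n).normed volume (c - x) * u x) atTop
        (𝓝 (u c)) := fun c => by
      have := ContDiffBump.convolution_tendsto_right_of_continuous (μ := volume)
        tendsto_bumpSeq_rOut hu c
      simpa only [convolution_lsmul_swap, smul_eq_mul] using this
    refine ((hconv a).sub (hconv b)).congr fun n => ?_
    have hint : ∀ c, Integrable fun x => (bumpSeq n).normed volume (c - x) * u x := fun c => by
      refine integrable_of_eq_zero (L := |c| + 1)
        (((bumpSeq n).continuous_normed.comp (continuous_const.sub continuous_id)).mul hu)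
        fun x hx => ?_
      rw [bumpSeq_eq_zero, zero_mul]
      have h1 := abs_sub_abs_le_abs_sub x c
      rw [abs_sub_comm] at h1
      linarith [hn1 n]
    rw [← integral_sub (hint a) (hint b)]
    refine integral_congr_ae (Eventually.of_forall fun x => ?_)
    simp only [(hasDerivAt_smoothIndicator n x).deriv]
    ring
  have lim₂ : Tendsto (fun n => ∫ x, v x * smoothIndicator a b n x) atTop
      (𝓝 (∫ x, v x * (Ioc a b).indicator 1 x)) := by
    refine tendsto_integral_of_dominated_convergence
      ((Icc (a - 1) (b + 1)).indicator fun x => ‖v x‖) (fun n => ?_) ?_ (fun n => ?_) ?_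
    · exact hv.aestronglyMeasurable.mul
        (contDiff_smoothIndicator n).continuous.aestronglyMeasurable
    · exact (integrable_indicator_iff measurableSet_Icc).2 hvi.norm
    · refine Eventually.of_forall fun x => ?_
      by_cases hx : x ∈ Icc (a - 1) (b + 1)
      · rw [indicator_of_mem hx, norm_mul]
        exact mul_le_of_le_one_right (norm_nonneg _) (abs_smoothIndicator_le n x)
      · rw [indicator_of_notMem hx, hzero n x hx, mul_zero, norm_zero]
    · have h0 : ∀ c : ℝ, ∀ᵐ x, x ≠ c := fun c => by simp [ae_iff]
      filter_upwards [h0 a, h0 b] with x h1 h2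
      exact (tendsto_smoothIndicator h1 h2 hab).const_mul _
  have e : ∫ x, v x * (Ioc a b).indicator 1 x = ∫ x in a..b, v x := by
    rw [intervalIntegral.integral_of_le hab, ← integral_indicator measurableSet_Ioc]
    refine integral_congr_ae (Eventually.of_forall fun x => ?_)
    by_cases hx : x ∈ Ioc a b <;> simp [hx]
  have lim₃ := lim₂.neg
  rw [e] at lim₃
  have := tendsto_nhds_unique (lim₁.congr fun n => h _ (contDiff_smoothIndicator n)
    (HasCompactSupport.intro isCompact_Icc fun x hx => hzero n x hx)) lim₃
  linarith

/-! ### Consequences of membership in the space of admissible pairs -/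

namespace InD

variable {Finf : ℝ} {u F : ℝ → ℝ}

theorem nonneg (h : InD Finf u F) (x : ℝ) : 0 ≤ F x :=
  h.mono_F.le_of_tendsto h.lim_F x

theorem le (h : InD Finf u F) (hF : 0 ≤ Finf) (x : ℝ) : F x ≤ Finf := by
  have h1 : ∀ᵐ x, F x ≤ Finf := by
    filter_upwards [ae_le_eLpNormEssSup (f := F) (μ := volume)] with x hx
    rw [← eLpNorm_exponent_top, h.norm_F, Real.enorm_eq_ofReal (h.nonneg x),
      ENNReal.ofReal_le_ofReal_iff hF] at hx
    exact hx
  obtain ⟨y, hy, hle⟩ := exists_mem_Ioo_of_ae h1 (lt_add_one x)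
  exact (h.mono_F hy.1.le).trans hle

theorem exists_abs_le (h : InD Finf u F) : ∃ M, ∀ x, |u x| ≤ M := by
  obtain ⟨C, hC⟩ : ∃ C, ∀ᵐ x, |u x| ≤ C := by
    refine ⟨(eLpNorm u ∞ volume).toReal, ?_⟩
    filter_upwards [ae_le_eLpNormEssSup (f := u) (μ := volume)] with x hx
    rw [← eLpNorm_exponent_top] at hx
    have := ENNReal.toReal_mono h.bdd_u.2.ne hx
    simpa using this
  refine ⟨C, fun x => ?_⟩
  have hcl : IsClosed {x | |u x| ≤ C} := isClosed_le h.cont_u.abs continuous_const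
  have hd : Dense {x | |u x| ≤ C} := Measure.dense_of_ae hC
  have := hd.closure_eq
  rw [hcl.closure_eq] at this
  exact (this ▸ mem_univ x : x ∈ {x | |u x| ≤ C})

/-- With v the weak derivative, the claim follows on expanding ∫ (v + c)² ≥ 0, since ∫ v is the
increment of u and ∫ v² is at most that of F. Passing from one-sided limits to values of F only
enlarges its increment. -/
theorem energyIneq (h : InD Finf u F) : EnergyIneq u F := by
  obtain ⟨v, hv, hw, hE⟩ := h.energy
  have hloc : LocallyIntegrable v := hv.locallyIntegrable (by norm_num)
  have hv2 : Integrable fun x => v x ^ 2 := hv.integrable_sq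
  intro c x y hxy
  rcases hxy.eq_or_lt with rfl | hlt
  · exact le_rfl
  have h1 := hw.sub_eq_integral h.cont_u hloc hxy
  have h2 := hE x y hlt
  have h3 : Function.leftLim F y ≤ F y := h.mono_F.leftLim_le le_rfl
  have h4 : F x ≤ Function.rightLim F x := h.mono_F.le_rightLim le_rfl
  have i1 : IntervalIntegrable v volume x y :=
    (hloc.integrableOn_isCompact isCompact_uIcc).intervalIntegrable
  have i2 : IntervalIntegrable (fun x => v x ^ 2) volume x y := hv2.intervalIntegrable
  have h5 : 0 ≤ ∫ z in x..y, (v z + c) ^ 2 :=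
    intervalIntegral.integral_nonneg hxy fun z _ => sq_nonneg _
  have h6 : ∫ z in x..y, (v z + c) ^ 2 = (∫ z in x..y, v z ^ 2) + 2 * c * (∫ z in x..y, v z) +
      c ^ 2 * (y - x) := by
    have : (fun z => (v z + c) ^ 2) = fun z => v z ^ 2 + 2 * c * v z + c ^ 2 := by
      funext z; ring
    rw [this, intervalIntegral.integral_add (i2.add (i1.const_mul _)) (by simp),
      intervalIntegral.integral_add i2 (i1.const_mul _), intervalIntegral.integral_const_mul,
      intervalIntegral.integral_const, smul_eq_mul]
    ring
  rw [h6, ← h1] at h5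
  linarith

/-- Off a ball containing the support the measure vanishes, so F is constant on either side. The
right-hand constant is an upper bound of F, hence at least its essential supremum `Finf`. -/
theorem exists_far (h : InD Finf u F) (hF : 0 ≤ Finf)
    (hs : IsCompact (distMeasure F).support) :
    ∃ R, (∀ x, x ≤ -R → F x = 0) ∧ ∀ x, R ≤ x → F x = Finf := by
  obtain ⟨r, hr⟩ := hs.isBounded.subset_closedBall (0 : ℝ)
  have hnull : ∀ s : Set ℝ, (∀ x ∈ s, r < |x|) → distMeasure F s = 0 := fun s hs' => by
    refine measure_mono_null (t := (distMeasure F).supportᶜ) ?_ Measure.measure_compl_support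
    intro x hx hmem
    have h1 := hr hmem
    rw [mem_closedBall_zero_iff, Real.norm_eq_abs] at h1
    exact absurd h1 (not_le.2 (hs' x hx))
  have hIio := distMeasure_Iio h.mono_F h.leftCont_F h.lim_F
  refine ⟨|r| + 1, fun x hx => ?_, ?_⟩
  · have h1 := hIio x
    rw [hnull (Iio x) fun y hy => ?_] at h1
    · exact le_antisymm (ENNReal.ofReal_eq_zero.1 h1.symm) (h.nonneg x)
    · have : y < x := hy
      rw [lt_abs]; right; linarith [le_abs_self r]
  have hconst : ∀ x, |r| + 1 ≤ x → F x = F (|r| + 1) := fun x hx => by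
    have h1 : distMeasure F (Iio x) ≤ distMeasure F (Iio (|r| + 1)) := by
      rw [← Iio_union_Ico_eq_Iio hx]
      refine (measure_union_le _ _).trans_eq ?_
      rw [hnull (Ico (|r| + 1) x) fun y hy => ?_, add_zero]
      rw [lt_abs]; left; linarith [le_abs_self r, hy.1]
    rw [hIio, hIio, ENNReal.ofReal_le_ofReal_iff (h.nonneg _)] at h1
    exact le_antisymm h1 (h.mono_F hx)
  have hge : Finf ≤ F (|r| + 1) := by
    have h1 : eLpNorm F ∞ volume ≤ ENNReal.ofReal (F (|r| + 1)) := by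
      rw [eLpNorm_exponent_top]
      refine eLpNormEssSup_le_of_ae_bound (Eventually.of_forall fun x => ?_)
      rw [Real.norm_eq_abs, abs_of_nonneg (h.nonneg x)]
      rcases le_total x (|r| + 1) with hx | hx
      · exact h.mono_F hx
      · exact (hconst x hx).le
    rw [h.norm_F, ENNReal.ofReal_le_ofReal_iff (h.nonneg _)] at h1
    exact h1
  exact fun x hx => (hconst x hx).trans (le_antisymm (h.le hF _) hge)

theorem exists_initData (h : InD Finf u F) (hF : 0 ≤ Finf)
    (hs : IsCompact (distMeasure F).support) : ∃ M₀ R, InitData Finf M₀ R u F := by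
  obtain ⟨M, hM⟩ := h.exists_abs_le
  obtain ⟨R, h1, h2⟩ := h.exists_far hF hs
  exact ⟨M, R, h.energyIneq, h.nonneg, h.le hF, hM, h1, h2⟩

end InD

/-! ### Membership in the space of admissible pairs -/

/-- A function with finite energy is absolutely continuous. -/
theorem EnergyIneq.absolutelyContinuousOnInterval {u F : ℝ → ℝ} (h : EnergyIneq u F)
    (hu : Continuous u) {a b : ℝ} (hab : a ≤ b) : AbsolutelyContinuousOnInterval u a b := by
  -- The right continuous version of F defines a measure, which bounds the sum of increments over
  -- disjoint intervals. Since u is continuous, the energy inequality passes to this version.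
  set G := h.mono.stieltjesFunction with hG
  have hE : ∀ c x y, x ≤ y → c ^ 2 * x + 2 * c * u x + G x ≤ c ^ 2 * y + 2 * c * u y + G y := by
    intro c x y hxy
    have hlim : ∀ z, Tendsto (fun s => c ^ 2 * (z + s) + 2 * c * u (z + s) + F (z + s)) (𝓝[>] 0)
        (𝓝 (c ^ 2 * z + 2 * c * u z + G z)) := by
      intro z
      have h1 : Tendsto (fun s => z + s) (𝓝[>] (0 : ℝ)) (𝓝[>] z) := by
        refine tendsto_nhdsWithin_iff.2 ⟨?_, ?_⟩
        · have : Continuous fun s => z + s := by fun_prop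
          simpa using (this.tendsto 0).mono_left (nhdsWithin_le_nhds (s := Ioi 0))
        · filter_upwards [self_mem_nhdsWithin] with s hs
          simpa using hs
      have h2 := h1.mono_right nhdsWithin_le_nhds
      refine ((h2.const_mul _).add (((hu.tendsto z).comp h2).const_mul _)).add ?_
      rw [hG, h.mono.stieltjesFunction_eq]
      exact (h.mono.tendsto_rightLim z).comp h1
    exact le_of_tendsto_of_tendsto' (hlim x) (hlim y) fun s => h c _ _ (by linarith)
  have hmono : Monotone G := G.mono
  rw [absolutelyContinuousOnInterval_iff]
  intro ε hε
  set K := G b - G a + 1 with hK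
  have hK0 : 0 < K := by linarith [hmono hab]
  refine ⟨ε ^ 2 / K, by positivity, fun E hE₁ hE₂ => ?_⟩
  obtain ⟨n, I⟩ := E
  have hsum : ∑ i ∈ Finset.range n, |G (I i).2 - G (I i).1| ≤ G b - G a := by
    have hle := measure_mono (μ := G.measure)
      (AbsolutelyContinuousOnInterval.biUnion_uIoc_subset_of_mem_disjWithin hE₁)
    rw [measure_biUnion_finset hE₁.2 fun i _ => measurableSet_uIoc, uIoc_of_le hab,
      G.measure_Ioc] at hle
    have e : ∀ i ∈ Finset.range n, G.measure (uIoc (I i).1 (I i).2) =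
        ENNReal.ofReal |G (I i).2 - G (I i).1| := by
      intro i _
      rw [uIoc, G.measure_Ioc]
      rcases le_total (I i).1 (I i).2 with hi | hi
      · rw [max_eq_right hi, min_eq_left hi, abs_of_nonneg (sub_nonneg.2 (hmono hi))]
      · rw [max_eq_left hi, min_eq_right hi, abs_sub_comm, abs_of_nonneg (sub_nonneg.2 (hmono hi))]
    rw [Finset.sum_congr rfl e, ← ENNReal.ofReal_sum_of_nonneg fun _ _ => abs_nonneg _,
      ENNReal.ofReal_le_ofReal_iff (sub_nonneg.2 (hmono hab))] at hle
    exact hle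
  -- The weight that balances the two sums: each of them contributes ε/2.
  set c := K / ε with hc
  have hc0 : 0 < c := by positivity
  have hterm : ∀ i ∈ Finset.range n, dist (u (I i).1) (u (I i).2) ≤
      c / 2 * dist (I i).1 (I i).2 + 1 / (2 * c) * |G (I i).2 - G (I i).1| := by
    have key : ∀ x y, x ≤ y → |u y - u x| ≤ c / 2 * |y - x| + 1 / (2 * c) * |G y - G x| := by
      intro x y hxy
      rw [abs_of_nonneg (sub_nonneg.2 hxy), abs_of_nonneg (sub_nonneg.2 (hmono hxy))]
      have h1 := hE c x y hxy
      have h2 := hE (-c) x y hxy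
      have h3 : 2 * c * (c / 2 * (y - x) + 1 / (2 * c) * (G y - G x)) =
          c ^ 2 * (y - x) + (G y - G x) := by field_simp
      have h4 : 2 * c * |u y - u x| ≤ c ^ 2 * (y - x) + (G y - G x) := by
        rcases abs_cases (u y - u x) with ⟨e, _⟩ | ⟨e, _⟩ <;> rw [e] <;> linarith
      rw [← h3] at h4
      exact le_of_mul_le_mul_left h4 (by positivity)
    intro i _
    rw [Real.dist_eq, Real.dist_eq]
    rcases le_total (I i).1 (I i).2 with hi | hi
    · rw [abs_sub_comm, abs_sub_comm (I i).1]; exact key _ _ hi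
    · rw [abs_sub_comm (G _)]; exact key _ _ hi
  refine (Finset.sum_le_sum hterm).trans_lt ?_
  rw [Finset.sum_add_distrib, ← Finset.mul_sum, ← Finset.mul_sum]
  have h1 : c / 2 * ∑ i ∈ Finset.range n, dist (I i).1 (I i).2 < c / 2 * (ε ^ 2 / K) :=
    mul_lt_mul_of_pos_left hE₂ (by positivity)
  have h2 : 1 / (2 * c) * ∑ i ∈ Finset.range n, |G (I i).2 - G (I i).1| ≤ 1 / (2 * c) * K :=
    mul_le_mul_of_nonneg_left (by linarith) (by positivity)
  have h3 : c / 2 * (ε ^ 2 / K) + 1 / (2 * c) * K = ε := by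
    rw [hc]; field_simp; ring
  linarith

/-- Differentiability of u almost everywhere comes from monotonicity alone: u is a linear
combination of the identity and the nondecreasing functions F and x + 2u + F. Then (Δu)² ≤ Δx ΔF is
divided by (Δx)². -/
theorem EnergyIneq.ae_deriv_sq_le {u F : ℝ → ℝ} (h : EnergyIneq u F) :
    ∀ᵐ x, deriv u x ^ 2 ≤ deriv F x := by
  have hm : Monotone fun x => x + 2 * u x + F x := fun x y hxy => by
    have := h 1 x y hxy
    simpa using this
  filter_upwards [h.mono.ae_differentiableAt, hm.ae_differentiableAt] with x h1 h2
  have h3 : DifferentiableAt ℝ u x := by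
    have e : u = fun x => 1 / 2 * ((x + 2 * u x + F x) - x - F x) := by funext x; ring
    rw [e]
    exact ((h2.sub differentiableAt_id).sub h1).const_mul _
  have l1 := (h1.hasDerivAt.tendsto_slope).mono_left (nhdsGT_le_nhdsNE x)
  have l2 := ((h3.hasDerivAt.tendsto_slope).mono_left (nhdsGT_le_nhdsNE x)).pow 2
  refine le_of_tendsto_of_tendsto l2 l1 ?_
  filter_upwards [self_mem_nhdsWithin] with y hy
  have hy' : 0 < y - x := sub_pos.2 hy
  rw [slope_def_field, slope_def_field, div_pow, div_le_div_iff₀ (by positivity) hy']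
  have := mul_le_mul_of_nonneg_right (h.sq_le (le_of_lt hy)) hy'.le
  linarith

/-- For nondecreasing F the integral of the derivative is at most the increment; a singular part of
the energy only adds to the right-hand side. -/
theorem EnergyIneq.intervalIntegral_deriv_sq {u F : ℝ → ℝ} (h : EnergyIneq u F) {a b : ℝ}
    (hab : a ≤ b) : IntervalIntegrable (fun x => deriv u x ^ 2) volume a b ∧
      ∫ x in a..b, deriv u x ^ 2 ≤ F b - F a := by
  have hm : MonotoneOn F (uIcc a b) := h.mono.monotoneOn _
  have hi := hm.intervalIntegrable_deriv
  have hi2 : IntervalIntegrable (fun x => deriv u x ^ 2) volume a b := by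
    refine hi.mono_fun ((measurable_deriv u).pow_const 2).aestronglyMeasurable ?_
    refine ae_restrict_of_ae ?_
    filter_upwards [h.ae_deriv_sq_le] with x hx
    rw [Real.norm_eq_abs, abs_of_nonneg (sq_nonneg _)]
    exact hx.trans (le_abs_self _)
  refine ⟨hi2, ?_⟩
  have h1 := hm.intervalIntegral_deriv_mem_uIcc
  rw [uIcc_of_le (sub_nonneg.2 (h.mono hab))] at h1
  refine le_trans ?_ h1.2
  exact intervalIntegral.integral_mono_ae hab hi2 hi h.ae_deriv_sq_le

theorem isWeakDeriv_deriv {u : ℝ → ℝ}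
    (hu : ∀ a b, a ≤ b → AbsolutelyContinuousOnInterval u a b) : IsWeakDeriv u (deriv u) := by
  intro φ hφ hs
  obtain ⟨r, hr⟩ := hs.isBounded.subset_closedBall (0 : ℝ)
  set L := |r| + 1
  have hL : 0 < L := by positivity
  have hzero : ∀ x, L ≤ |x| → φ x = 0 := fun x hx => by
    refine image_eq_zero_of_notMem_tsupport fun hx' => ?_
    have := hr hx'
    rw [mem_closedBall_zero_iff, Real.norm_eq_abs] at this
    have : |x| ≤ |r| := this.trans (le_abs_self r)
    linarith
  have hzero' : ∀ x, L ≤ |x| → deriv φ x = 0 := fun x hx => by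
    refine image_eq_zero_of_notMem_tsupport fun hx' => ?_
    have := hr (tsupport_deriv_subset hx')
    rw [mem_closedBall_zero_iff, Real.norm_eq_abs] at this
    have : |x| ≤ |r| := this.trans (le_abs_self r)
    linarith
  have hφ' : AbsolutelyContinuousOnInterval φ (-L) L :=
    (hφ.of_le (by exact_mod_cast le_top)).contDiffOn.absolutelyContinuousOnInterval
  have h1 := (hu (-L) L (by linarith)).integral_mul_deriv_eq_deriv_mul hφ'
  rw [hzero L (le_abs_self L), hzero (-L) (by rw [abs_neg]; exact le_abs_self L)] at h1
  rw [integral_eq_intervalIntegral (L := L) (g := fun x => u x * deriv φ x)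
      (fun x hx => by rw [hzero' x hx, mul_zero]) le_rfl le_rfl,
    integral_eq_intervalIntegral (L := L) (g := fun x => deriv u x * φ x)
      (fun x hx => by rw [hzero x hx, mul_zero]) le_rfl le_rfl, h1]
  ring

theorem InD.of_energyIneq {Finf M : ℝ} {u F : ℝ → ℝ} (hE : EnergyIneq u F) (hF : DistFn Finf F)
    (hM : ∀ x, |u x| ≤ M) : InD Finf u F := by
  have hK : ∀ x y, F y - F x ≤ Finf := fun x y => by linarith [hF.le y, hF.nonneg x]
  have hc := hE.continuous hK
  have hFm : AEStronglyMeasurable F volume := hF.mono.measurable.aestronglyMeasurable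
  have hFb : ∀ᵐ x, ‖F x‖ ≤ Finf := Eventually.of_forall fun x => by
    rw [Real.norm_eq_abs, abs_of_nonneg (hF.nonneg x)]; exact hF.le x
  refine ⟨hc, memLp_top_of_bound hc.aestronglyMeasurable M (Eventually.of_forall hM),
    memLp_top_of_bound hFm Finf hFb, hF.mono, hF.leftCont, hF.tendsto_atBot, ?_,
    deriv u, ?_, ?_, ?_⟩
  · rw [eLpNorm_exponent_top]
    refine le_antisymm (eLpNormEssSup_le_of_ae_bound hFb) ?_
    obtain ⟨R, -, hR⟩ := hF.far
    obtain ⟨x, hx, hle⟩ := exists_mem_Ioo_of_ae (ae_le_eLpNormEssSup (f := F) (μ := volume))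
      (lt_add_one R)
    rwa [Real.enorm_eq_ofReal (hF.nonneg x), hR x hx.1.le] at hle
  · rw [memLp_two_iff_integrable_sq (measurable_deriv u).aestronglyMeasurable]
    refine integrable_of_intervalIntegral_norm_bounded (ι := ℕ) (l := atTop) Finf
      (a := fun n => -(n : ℝ)) (b := fun n => (n : ℝ)) (fun n => ?_)
      (tendsto_neg_atTop_atBot.comp tendsto_natCast_atTop_atTop) tendsto_natCast_atTop_atTop
      (Eventually.of_forall fun n => ?_)
    · have h1 := (hE.intervalIntegral_deriv_sq (a := -(n : ℝ)) (b := n)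
        (by linarith [n.cast_nonneg (α := ℝ)])).1
      exact (intervalIntegrable_iff_integrableOn_Ioc_of_le
        (by linarith [n.cast_nonneg (α := ℝ)])).1 h1
    · have h1 := (hE.intervalIntegral_deriv_sq (a := -(n : ℝ)) (b := n)
        (by linarith [n.cast_nonneg (α := ℝ)])).2
      simp only [norm_pow, Real.norm_eq_abs, sq_abs]
      exact h1.trans (hK _ _)
  · exact isWeakDeriv_deriv fun a b hab => hE.absolutelyContinuousOnInterval hc hab
  · intro a b hab
    have hl : Function.leftLim F b = F b :=
      leftLim_eq_of_tendsto
        ((hF.leftCont b).mono_left (nhdsWithin_mono _ Iio_subset_Iic_self))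
    rw [hl]
    have hi := (hE.intervalIntegral_deriv_sq hab.le).1
    -- The bound on [z, b] is passed to the limit z ↓ a, which replaces F at a by its right limit
    -- and excludes an atom of energy at a.
    have l1 : Tendsto (fun z => ∫ x in z..b, deriv u x ^ 2) (𝓝[>] a)
        (𝓝 (∫ x in a..b, deriv u x ^ 2)) := by
      have := intervalIntegral.continuousOn_primitive_interval_left (μ := volume)
        (f := fun x => deriv u x ^ 2) (a := a) (b := b)
        (by rw [uIcc_of_le hab.le]; exact (intervalIntegrable_iff_integrableOn_Icc_of_le hab.le).1 hi)
      have h2 := this a left_mem_uIcc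
      refine h2.mono_left ?_
      rw [uIcc_of_le hab.le]
      exact nhdsWithin_le_of_mem (Icc_mem_nhdsGT hab)
    refine le_of_tendsto_of_tendsto l1 ((hE.mono.tendsto_rightLim a).const_sub (F b)) ?_
    filter_upwards [Icc_mem_nhdsGT hab] with z hz
    exact (hE.intervalIntegral_deriv_sq hz.2).2

/-! ### Limits of the numerical solutions -/

theorem frequently_nhdsLT_of_ae {p : ℝ → Prop} (hp : ∀ᵐ x, p x) (x : ℝ) :
    ∃ᶠ y in 𝓝[<] x, p y := by
  rw [(nhdsLT_basis x).frequently_iff]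
  intro a ha
  exact exists_mem_Ioo_of_ae hp ha

theorem tendsto_nhdsLT {f : ℝ → ℝ} {x : ℝ} (hf : ContinuousWithinAt f (Iic x) x) :
    Tendsto f (𝓝[<] x) (𝓝 (f x)) :=
  hf.mono_left (nhdsWithin_mono _ Iio_subset_Iic_self)

theorem eq_of_ae_eq_of_leftCont {f g : ℝ → ℝ} (hf : ∀ x, ContinuousWithinAt f (Iic x) x)
    (hg : ∀ x, ContinuousWithinAt g (Iic x) x) (h : ∀ᵐ x, f x = g x) : f = g := by
  funext x
  have h1 := (isClosed_singleton (x := (0 : ℝ))).mem_of_frequently_of_tendsto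
    ((frequently_nhdsLT_of_ae h x).mono fun y hy => by simp [hy] : ∃ᶠ y in 𝓝[<] x, f y - g y ∈ _)
    ((tendsto_nhdsLT (hf x)).sub (tendsto_nhdsLT (hg x)))
  exact sub_eq_zero.1 h1

/-- Points satisfying p accumulate at every point from the left, so left continuity removes the
restriction to such points, first at the left end and then at the right end. -/
theorem monotone_of_ae_of_leftCont {f : ℝ → ℝ} (hf : ∀ x, ContinuousWithinAt f (Iic x) x)
    {p : ℝ → Prop} (hp : ∀ᵐ x, p x) (h : ∀ x y, p x → p y → x ≤ y → f x ≤ f y) : Monotone f := by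
  have h1 : ∀ x y, p y → x ≤ y → f x ≤ f y := fun x y hy hxy => by
    refine isClosed_Iic.mem_of_frequently_of_tendsto ?_ (tendsto_nhdsLT (hf x))
    refine ((frequently_nhdsLT_of_ae hp x).and_eventually self_mem_nhdsWithin).mono ?_
    rintro z ⟨hz, hzx⟩
    exact h z y hz hy ((le_of_lt hzx).trans hxy)
  intro x y hxy
  rcases hxy.eq_or_lt with rfl | hlt
  · exact le_rfl
  refine isClosed_Ici.mem_of_frequently_of_tendsto ?_ (tendsto_nhdsLT (hf y))
  refine ((frequently_nhdsLT_of_ae hp y).and_eventually (Ioo_mem_nhdsLT hlt)).mono ?_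
  rintro z ⟨hz, hzx⟩
  exact h1 x z hz hzx.1.le

/-- For each c the monotone functions c²x + 2cU + G converge almost everywhere, and their limit is
left continuous because u inherits the Hölder bound. -/
theorem EnergyIneq.of_tendsto {U G : ℕ → ℝ → ℝ} {u F : ℝ → ℝ} {K : ℝ}
    (hE : ∀ k, EnergyIneq (U k) (G k)) (hK : ∀ k x y, G k y - G k x ≤ K)
    (hu : ∀ x, Tendsto (fun k => U k x) atTop (𝓝 (u x)))
    (hF : ∀ᵐ x, Tendsto (fun k => G k x) atTop (𝓝 (F x)))
    (hc : ∀ x, ContinuousWithinAt F (Iic x) x) : EnergyIneq u F := by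
  have hb : ∀ x y, |u y - u x| ≤ √(K * |y - x|) := fun x y =>
    le_of_tendsto' ((hu y).sub (hu x)).abs fun k => (hE k).abs_sub_le_sqrt (hK k) x y
  have huc : Continuous u := by
    rw [continuous_iff_continuousAt]
    intro x
    rw [ContinuousAt, tendsto_iff_dist_tendsto_zero]
    have h0 : Tendsto (fun y => √(K * |y - x|)) (𝓝 x) (𝓝 0) := by
      have : Continuous fun y => √(K * |y - x|) := by fun_prop
      simpa using this.tendsto x
    exact squeeze_zero (fun _ => dist_nonneg) (fun y => hb x y) h0
  intro c
  have hm : Monotone fun x => c ^ 2 * x + 2 * c * u x + F x := by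
    refine monotone_of_ae_of_leftCont (fun x => ?_) hF fun x y hx hy hxy => ?_
    · have h1 : Continuous fun x => c ^ 2 * x + 2 * c * u x := by fun_prop
      exact h1.continuousWithinAt.add (hc x)
    · exact le_of_tendsto_of_tendsto' (((hu x).const_mul _).const_add _ |>.add hx)
        (((hu y).const_mul _).const_add _ |>.add hy) fun k => hE k c x y hxy
  exact fun x y hxy => hm hxy

theorem tendsto_timeStep (Finf α : ℝ) {δ : ℕ → ℝ} (hδ : Tendsto δ atTop (𝓝 0)) :
    Tendsto (fun k => timeStep Finf α (δ k)) atTop (𝓝 0) := by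
  have : Continuous fun d => timeStep Finf α d := by unfold timeStep; fun_prop
  simpa [timeStep, Function.comp_def] using (this.tendsto 0).comp hδ

/-- Pointwise convergence of the numerical solutions along a sequence of grid sizes. -/
structure IsPointwiseLimit (Finf α : ℝ) (u₀ F₀ : ℝ → ℝ) (δ : ℕ → ℝ) (u F : ℝ → ℝ → ℝ) : Prop where
  pos : ∀ k, 0 < δ k
  tendsto_zero : Tendsto δ atTop (𝓝 0)
  tendsto_u : ∀ t, 0 ≤ t → ∀ x, Tendsto (fun k => numU Finf α u₀ F₀ (δ k) t x) atTop (𝓝 (u t x))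
  tendsto_F : ∀ t, 0 ≤ t →
    ∀ᵐ x, Tendsto (fun k => numF Finf α u₀ F₀ (δ k) t x) atTop (𝓝 (F t x))
  leftCont : ∀ t, 0 ≤ t → ∀ x, ContinuousWithinAt (F t) (Iic x) x

theorem IsSchemeLimit.isPointwiseLimit {Finf α : ℝ} {u₀ F₀ : ℝ → ℝ} {δ : ℕ → ℝ} {u F : ℝ → ℝ → ℝ}
    (h : IsSchemeLimit Finf α u₀ F₀ δ u F) (hδ : ∀ k, 0 < δ k) (hδ₀ : Tendsto δ atTop (𝓝 0)) :
    IsPointwiseLimit Finf α u₀ F₀ δ u F where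
  pos := hδ
  tendsto_zero := hδ₀
  tendsto_u t ht x := (h.tendsto_u t ht).tendsto_at (x := (t, x)) ⟨⟨ht, le_rfl⟩, mem_univ x⟩
  tendsto_F := h.tendsto_F_ae
  leftCont := h.leftCont_F

section Limit

variable {Finf α M₀ R : ℝ} {u₀ F₀ : ℝ → ℝ} {δ : ℕ → ℝ} {u F : ℝ → ℝ → ℝ}

namespace IsPointwiseLimit

theorem eventually_le_one (h : IsPointwiseLimit Finf α u₀ F₀ δ u F) : ∀ᶠ k in atTop, δ k ≤ 1 :=
  h.tendsto_zero.eventually (ge_mem_nhds zero_lt_one)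

theorem energyIneq (h : IsPointwiseLimit Finf α u₀ F₀ δ u F) (hI : InitData Finf M₀ R u₀ F₀)
    (hF : 0 < Finf) (hα : α ∈ Ioc (0 : ℝ) 1) {t : ℝ} (ht : 0 ≤ t) : EnergyIneq (u t) (F t) :=
  EnergyIneq.of_tendsto (fun k => (hI.numSol_state hF hα (h.pos k) ht).energy)
    (fun k => (hI.numSol_state hF hα (h.pos k) ht).sub_le) (h.tendsto_u t ht) (h.tendsto_F t ht)
    (h.leftCont t ht)

/-- The value of F at x is recovered from points y < x. On the right these must still lie beyond the
radius, hence the strict inequality there. -/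
theorem far (h : IsPointwiseLimit Finf α u₀ F₀ δ u F) (hI : InitData Finf M₀ R u₀ F₀)
    (hF : 0 < Finf) (hα : α ∈ Ioc (0 : ℝ) 1) {t T : ℝ} (ht : t ∈ Icc 0 T) :
    (∀ x, x ≤ -radius Finf α M₀ R T → F t x = 0) ∧
    ∀ x, radius Finf α M₀ R T < x → F t x = Finf := by
  have key : ∀ (x c : ℝ), (∀ᶠ y in 𝓝[<] x, ∀ᶠ k in atTop, numF Finf α u₀ F₀ (δ k) t y = c) →
      F t x = c := fun x c hc => by
    refine (isClosed_singleton (x := c)).mem_of_frequently_of_tendsto ?_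
      (tendsto_nhdsLT (h.leftCont t ht.1 x))
    refine ((frequently_nhdsLT_of_ae (h.tendsto_F t ht.1) x).and_eventually hc).mono ?_
    rintro y ⟨h1, h2⟩
    exact tendsto_nhds_unique (h1.congr' h2) tendsto_const_nhds
  constructor <;> intro x hx <;> refine key x _ ?_
  · filter_upwards [self_mem_nhdsWithin] with y hy
    filter_upwards [h.eventually_le_one] with k hk
    exact (hI.numF_far hF hα (h.pos k) hk ht).1 ((le_of_lt hy).trans hx)
  · filter_upwards [Ioo_mem_nhdsLT hx] with y hy
    filter_upwards [h.eventually_le_one] with k hk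
    exact (hI.numF_far hF hα (h.pos k) hk ht).2 hy.1.le

theorem distFn (h : IsPointwiseLimit Finf α u₀ F₀ δ u F) (hI : InitData Finf M₀ R u₀ F₀)
    (hF : 0 < Finf) (hα : α ∈ Ioc (0 : ℝ) 1) {t : ℝ} (ht : 0 ≤ t) : DistFn Finf (F t) := by
  obtain ⟨h1, h2⟩ := h.far hI hF hα (T := t) ⟨ht, le_rfl⟩
  exact ⟨(h.energyIneq hI hF hα ht).mono, h.leftCont t ht, radius Finf α M₀ R t + 1,
    fun x hx => h1 x (by linarith), fun x hx => h2 x (by linarith)⟩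

theorem abs_u_le (h : IsPointwiseLimit Finf α u₀ F₀ δ u F) (hI : InitData Finf M₀ R u₀ F₀)
    (hF : 0 < Finf) (hα : α ∈ Ioc (0 : ℝ) 1) {t : ℝ} (ht : 0 ≤ t) (x : ℝ) :
    |u t x| ≤ M₀ + 1 / 4 * Finf * t :=
  le_of_tendsto' (h.tendsto_u t ht x).abs fun k => hI.abs_numU_le hF hα (h.pos k) ht x

theorem abs_u_sub_le (h : IsPointwiseLimit Finf α u₀ F₀ δ u F) (hI : InitData Finf M₀ R u₀ F₀)
    (hF : 0 < Finf) (hα : α ∈ Ioc (0 : ℝ) 1) {s t T : ℝ} (hs : s ∈ Icc 0 T) (ht : t ∈ Icc 0 T)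
    (x : ℝ) : |u t x - u s x| ≤
      1 / 2 * Finf * |t - s| + 2 * √(Finf * (speed Finf α M₀ T * |t - s|)) := by
  have hr : Tendsto (fun k => |t - s| + 4 * timeStep Finf α (δ k)) atTop (𝓝 |t - s|) := by
    simpa using ((tendsto_timeStep Finf α h.tendsto_zero).const_mul 4).const_add |t - s|
  have hc : Continuous fun r => 1 / 2 * Finf * r + 2 * √(Finf * (speed Finf α M₀ T * r)) := by
    fun_prop
  refine le_of_tendsto_of_tendsto ((h.tendsto_u t ht.1 x).sub (h.tendsto_u s hs.1 x)).abs
    ((hc.tendsto _).comp hr) ?_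
  filter_upwards [h.eventually_le_one] with k hk
  exact (hI.num_time hF hα (h.pos k) hk hs ht rfl x).2

theorem holder (h : IsPointwiseLimit Finf α u₀ F₀ δ u F) (hI : InitData Finf M₀ R u₀ F₀)
    (hF : 0 < Finf) (hα : α ∈ Ioc (0 : ℝ) 1) {T : ℝ} (hT : 0 ≤ T) : ∃ C : NNReal,
      HolderOnWith C (1 / 2) (fun p : ℝ × ℝ => u p.1 p.2) (Icc 0 T ×ˢ univ) := by
  set A := speed Finf α M₀ T
  have hA : 0 ≤ A := hI.speed_nonneg hα hT
  set C := 1 / 2 * Finf * √T + 2 * √(Finf * A) + √Finf with hC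
  have hC0 : 0 ≤ C := by positivity
  refine ⟨C.toNNReal, ?_⟩
  rintro ⟨t, x⟩ ⟨ht, -⟩ ⟨s, y⟩ ⟨hs, -⟩
  have hd1 : |t - s| ≤ dist (t, x) (s, y) := le_max_left _ _
  have hd2 : |x - y| ≤ dist (t, x) (s, y) := le_max_right _ _
  have hd0 : 0 ≤ dist (t, x) (s, y) := dist_nonneg
  set d := dist (t, x) (s, y)
  have key : |u t x - u s y| ≤ C * √d := by
    have h1 := h.abs_u_sub_le hI hF hα hs ht x
    have h2 := (h.energyIneq hI hF hα hs.1).abs_sub_le_sqrt (K := Finf) (fun a b => by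
      linarith [(h.distFn hI hF hα hs.1).le b, (h.distFn hI hF hα hs.1).nonneg a]) y x
    -- On a bounded time interval the Lipschitz part of the modulus is also Hölder of order 1/2.
    have h3 : |t - s| ≤ √T * √d := by
      have hle : |t - s| ≤ T := by rw [abs_le]; constructor <;> linarith [ht.1, ht.2, hs.1, hs.2]
      rw [← Real.mul_self_sqrt (abs_nonneg (t - s))]
      exact mul_le_mul (Real.sqrt_le_sqrt hle) (Real.sqrt_le_sqrt hd1) (Real.sqrt_nonneg _)
        (Real.sqrt_nonneg _)
    have h4 : √(Finf * (A * |t - s|)) ≤ √(Finf * A) * √d := by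
      rw [← Real.sqrt_mul (by positivity), ← mul_assoc]
      exact Real.sqrt_le_sqrt (mul_le_mul_of_nonneg_left hd1 (by positivity))
    have h5 : √(Finf * |x - y|) ≤ √Finf * √d := by
      rw [← Real.sqrt_mul hF.le]
      exact Real.sqrt_le_sqrt (mul_le_mul_of_nonneg_left hd2 hF.le)
    have h6 := abs_sub_le (u t x) (u s x) (u s y)
    have h7 := mul_le_mul_of_nonneg_left h3 (by positivity : 0 ≤ 1 / 2 * Finf)
    rw [hC]
    linarith
  have e : ENNReal.ofReal (C * √d) =
      (C.toNNReal : ℝ≥0∞) * edist (t, x) (s, y) ^ (((1 / 2 : NNReal) : ℝ)) := by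
    rw [ENNReal.ofReal_mul hC0, edist_dist, ENNReal.ofReal_rpow_of_nonneg hd0 (by positivity),
      Real.sqrt_eq_rpow]
    congr 3
  rw [← e, edist_dist, Real.dist_eq]
  exact ENNReal.ofReal_le_ofReal key

theorem init_u (h : IsPointwiseLimit Finf α u₀ F₀ δ u F) (hI : InitData Finf M₀ R u₀ F₀)
    (hF : 0 < Finf) (hα : α ∈ Ioc (0 : ℝ) 1) : u 0 = u₀ := by
  funext x
  refine tendsto_nhds_unique (h.tendsto_u 0 le_rfl x) ?_
  rw [tendsto_iff_dist_tendsto_zero]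
  have h0 : Tendsto (fun k => √(Finf * δ k)) atTop (𝓝 0) := by
    have : Continuous fun d => √(Finf * d) := by fun_prop
    simpa [Function.comp_def] using (this.tendsto 0).comp h.tendsto_zero
  refine squeeze_zero (fun _ => dist_nonneg) (fun k => ?_) h0
  have hd := (dep_gridInterp (h.pos k) u₀ hI.energy.mono).abs_u_sub_le_sqrt hI.energy
    (K := Finf) (fun x y => by linarith [hI.le y, hI.nonneg x]) x
  rw [zero_add] at hd
  simp only [numU, hI.numSol_zero hF hα (h.pos k)]
  exact hd

/-- At continuity points of F₀ the interpolant is squeezed between shifts of F₀ by ±δ; left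
continuity then determines the remaining values. -/
theorem init_F (h : IsPointwiseLimit Finf α u₀ F₀ δ u F) (hI : InitData Finf M₀ R u₀ F₀)
    (hF : 0 < Finf) (hα : α ∈ Ioc (0 : ℝ) 1) (hc : ∀ x, ContinuousWithinAt F₀ (Iic x) x) :
    F 0 = F₀ := by
  refine eq_of_ae_eq_of_leftCont (h.leftCont 0 le_rfl) hc ?_
  have hcont : ∀ᵐ x, ContinuousAt F₀ x := by
    have := measure_eq_zero_iff_ae_notMem.1
      (hI.energy.mono.countable_not_continuousAt.measure_zero volume)
    filter_upwards [this] with x hx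
    by_contra hn
    exact hx hn
  filter_upwards [hcont, h.tendsto_F 0 le_rfl] with x h1 h2
  refine tendsto_nhds_unique h2 ?_
  have l1 : Tendsto (fun k => F₀ (x - δ k)) atTop (𝓝 (F₀ x)) := by
    refine h1.tendsto.comp ?_
    simpa using h.tendsto_zero.const_sub x
  have l2 : Tendsto (fun k => F₀ (x + δ k)) atTop (𝓝 (F₀ x)) := by
    refine h1.tendsto.comp ?_
    simpa using h.tendsto_zero.const_add x
  refine tendsto_of_tendsto_of_tendsto_of_le_of_le l1 l2 (fun k => ?_) fun k => ?_ <;>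
    simp only [numF, hI.numSol_zero hF hα (h.pos k)]
  · exact (dep_gridInterp (h.pos k) u₀ hI.energy.mono).le_F x
  · exact (dep_gridInterp (h.pos k) u₀ hI.energy.mono).F_le x

theorem tendsto_inner (h : IsPointwiseLimit Finf α u₀ F₀ δ u F) (hI : InitData Finf M₀ R u₀ F₀)
    (hF : 0 < Finf) (hα : α ∈ Ioc (0 : ℝ) 1) {B L : ℝ} {φ : ℝ → ℝ → ℝ} (hφ : TestBound B L φ)
    {t : ℝ} (ht : 0 ≤ t) :
    Tendsto (fun k => innerU Finf (numU Finf α u₀ F₀ (δ k)) (numF Finf α u₀ F₀ (δ k)) φ t) atTop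
      (𝓝 (innerU Finf u F φ t)) ∧
    Tendsto (fun k => innerF (numU Finf α u₀ F₀ (δ k)) (numF Finf α u₀ F₀ (δ k)) φ t) atTop
      (𝓝 (innerF u F φ t)) := by
  have hM := hI.M_nonneg
  have hs := fun k => hI.numSol_state hF hα (h.pos k) ht
  have hd := fun k => hI.num_distFn hF hα (h.pos k) ht
  have hb := fun k => hI.abs_numU_le hF hα (h.pos k) ht
  constructor
  · exact hφ.tendsto_innerU tendsto_const_nhds (Eventually.of_forall hd) (h.tendsto_F t ht)
      (Eventually.of_forall fun k => (hs k).continuous_u) (Eventually.of_forall hb)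
      (h.tendsto_u t ht)
  · refine hφ.tendsto_innerF tendsto_const_nhds (h.distFn hI hF hα ht) (Eventually.of_forall hd)
      (h.tendsto_F t ht) ((h.energyIneq hI hF hα ht).continuous (K := Finf) fun a b => ?_)
      (Eventually.of_forall fun k => (hs k).continuous_u) (Eventually.of_forall hb) (by positivity)
      fun y z hz => ?_
    · linarith [(h.distFn hI hF hα ht).le b, (h.distFn hI hF hα ht).nonneg a]
    · exact EnergyIneq.tendsto_comp (K := Finf)
        (Eventually.of_forall fun k => ⟨(hs k).energy, (hs k).sub_le⟩) (h.tendsto_u t ht y) hz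

end IsPointwiseLimit

theorem integrable_indicator_Icc_const (a b c : ℝ) :
    Integrable ((Icc a b).indicator fun _ => c) :=
  (integrable_indicator_iff measurableSet_Icc).2 (by simp)

theorem TestBound.abs_inner_le {B L M : ℝ} {φ : ℝ → ℝ → ℝ} (hφ : TestBound B L φ) {t : ℝ}
    (hF : 0 ≤ Finf) (hM : 0 ≤ M) (hd : DistFn Finf (F t)) (hu : Continuous (u t))
    (hb : ∀ x, |u t x| ≤ M) :
    |innerU Finf u F φ t| ≤ 2 * L * (B * M + B * (1 / 2 * M ^ 2) + B * Finf) ∧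
    |innerF u F φ t| ≤ (B + M * B) * Finf := by
  have hL := hφ.L_pos
  constructor
  · have h1 := norm_integral_le_of_norm_le (μ := volume)
      (f := fun x => timeDeriv φ t x * u t x + spaceDeriv φ t x * (1 / 2 * u t x ^ 2) +
        φ t x * (1 / 2 * F t x - 1 / 4 * Finf))
      (integrable_indicator_Icc_const (-L) L (B * M + B * (1 / 2 * M ^ 2) + B * Finf))
      (Eventually.of_forall fun x => hφ.abs_momentum_le hd hb t x)
    rw [integral_indicator measurableSet_Icc, setIntegral_const, smul_eq_mul,
      Real.volume_real_Icc_of_le (by linarith)] at h1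
    refine h1.trans_eq ?_
    ring
  · have hc : Continuous fun x => timeDeriv φ t x + u t x * spaceDeriv φ t x :=
      (hφ.time.continuous_right _).add (hu.mul (hφ.space.continuous_right _))
    have e : innerF u F φ t = ∫ x, (timeDeriv φ t x + u t x * spaceDeriv φ t x)
        ∂(distMeasure (F t)) := rfl
    rw [e, hd.integral_distMeasure hc]
    refine abs_setIntegral_Ioo_le hF fun η _ => ?_
    refine (abs_add_le _ _).trans (add_le_add (hφ.time.bound _ _) ?_)
    rw [abs_mul]
    exact mul_le_mul (hb _) (hφ.space.bound _ _) (abs_nonneg _) hM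

theorem tendsto_integral_Ioi_of_bound {I : ℕ → ℝ → ℝ} {J : ℝ → ℝ} {C L : ℝ}
    (hI : ∀ k, IntegrableOn (I k) (Ioi 0)) (hL : ∀ k t, L ≤ t → I k t = 0)
    (hC : ∀ k t, t ∈ Icc 0 L → |I k t| ≤ C)
    (hl : ∀ t, 0 ≤ t → Tendsto (fun k => I k t) atTop (𝓝 (J t))) :
    IntegrableOn J (Ioi 0) ∧
      Tendsto (fun k => ∫ t in Ioi 0, I k t) atTop (𝓝 (∫ t in Ioi 0, J t)) := by
  have hl' : ∀ᵐ t ∂(volume.restrict (Ioi (0 : ℝ))), Tendsto (fun k => I k t) atTop (𝓝 (J t)) := by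
    filter_upwards [ae_restrict_mem measurableSet_Ioi] with t ht using hl t (le_of_lt ht)
  have hb : ∀ k, ∀ᵐ t ∂(volume.restrict (Ioi (0 : ℝ))),
      ‖I k t‖ ≤ (Icc 0 L).indicator (fun _ => C) t := fun k => by
    filter_upwards [ae_restrict_mem measurableSet_Ioi] with t ht
    by_cases hm : t ∈ Icc 0 L
    · rw [indicator_of_mem hm]; exact hC k t hm
    · rw [indicator_of_notMem hm, hL k t, norm_zero]
      by_contra hlt
      exact hm ⟨le_of_lt ht, (not_le.1 hlt).le⟩
  have hg : Integrable ((Icc 0 L).indicator fun _ => C) (volume.restrict (Ioi (0 : ℝ))) :=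
    (integrable_indicator_Icc_const _ _ _).integrableOn
  refine ⟨?_, tendsto_integral_of_dominated_convergence _ (fun k => (hI k).aestronglyMeasurable) hg hb hl'⟩
  refine hg.mono' (aestronglyMeasurable_of_tendsto_ae atTop
    (fun k => (hI k).aestronglyMeasurable) hl') ?_
  filter_upwards [hl', ae_all_iff.2 hb] with t h1 h2
  exact le_of_tendsto' h1.norm h2

/-- Dominated convergence carries the left-hand sides for the scheme to those for the limit, and
they are O(√δ), so the limit is zero. -/
theorem IsPointwiseLimit.weak (h : IsPointwiseLimit Finf α u₀ F₀ δ u F)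
    (hI : InitData Finf M₀ R u₀ F₀) (hF : 0 < Finf) (hα : α ∈ Ioc (0 : ℝ) 1)
    (hc : ∀ x, ContinuousWithinAt F₀ (Iic x) x) {φ : ℝ → ℝ → ℝ} (hφ : IsTestFunction φ) :
    (IntegrableOn (innerU Finf u F φ) (Ioi 0) ∧ weakU Finf u₀ u F φ = 0) ∧
    (IntegrableOn (innerF u F φ) (Ioi 0) ∧ weakF F₀ u F φ = 0) := by
  obtain ⟨B, L, hφ⟩ := hφ.exists_testBound
  have hM₀ := hI.M_nonneg
  have hL := hφ.L_pos
  set M := M₀ + 1 / 4 * Finf * L with hM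
  have hM0 : 0 ≤ M := by positivity
  have hb : ∀ k t, t ∈ Icc 0 L → ∀ x, |numU Finf α u₀ F₀ (δ k) t x| ≤ M := fun k t ht x =>
    (hI.abs_numU_le hF hα (h.pos k) ht.1 x).trans (by rw [hM]; nlinarith [ht.2])
  have hbd := fun k t (ht : t ∈ Icc 0 L) => hφ.abs_inner_le (u := numU Finf α u₀ F₀ (δ k))
    (F := numF Finf α u₀ F₀ (δ k)) hF.le hM0 (hI.num_distFn hF hα (h.pos k) ht.1)
    (hI.numSol_state hF hα (h.pos k) ht.1).continuous_u (hb k t ht)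
  have hδ : Tendsto δ atTop (𝓝[>] 0) :=
    tendsto_nhdsWithin_iff.2 ⟨h.tendsto_zero, Eventually.of_forall h.pos⟩
  have hs : Tendsto (fun d => √d) (𝓝[>] (0 : ℝ)) (𝓝 0) := by
    simpa using (Real.continuous_sqrt.tendsto 0).mono_left (nhdsWithin_le_nhds (s := Ioi 0))
  constructor
  · obtain ⟨h1, h2⟩ := tendsto_integral_Ioi_of_bound
      (fun k => (hI.integrableOn_inner hF hα (h.pos k) hφ).1)
      (fun k t ht => hφ.innerU_eq_zero _ _ ht) (fun k t ht => (hbd k t ht).1)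
      (fun t ht => (h.tendsto_inner hI hF hα hφ ht).1)
    refine ⟨h1, ?_⟩
    have h3 : Tendsto (fun k => ∫ x, φ 0 x * numU Finf α u₀ F₀ (δ k) 0 x) atTop
        (𝓝 (∫ x, φ 0 x * u₀ x)) := by
      refine tendsto_integral_of_dominated_convergence ((Icc (-L) L).indicator fun _ => B * M)
        (fun k => ?_) (integrable_indicator_Icc_const _ _ _) (fun k => ?_) ?_
      · exact ((hφ.val.continuous_right 0).mul
          (hI.numSol_state hF hα (h.pos k) le_rfl).continuous_u).aestronglyMeasurable
      · refine Eventually.of_forall fun x => ?_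
        by_cases hx : x ∈ Icc (-L) L
        · rw [indicator_of_mem hx, norm_mul]
          exact mul_le_mul (hφ.val.bound _ _) (hb k 0 ⟨le_rfl, hL⟩ x) (norm_nonneg _) hφ.pos
        · rw [indicator_of_notMem hx, hφ.val.supp _ _ (Or.inr (not_lt.1 fun hlt =>
            hx ⟨(abs_lt.1 hlt).1.le, (abs_lt.1 hlt).2.le⟩)), zero_mul, norm_zero]
      · refine Eventually.of_forall fun x => ?_
        have := (h.tendsto_u 0 le_rfl x).const_mul (φ 0 x)
        rwa [h.init_u hI hF hα] at this
    exact tendsto_nhds_unique (h2.add h3) (((hI.weakU_isBigO hF hα hφ).trans_tendsto hs).comp hδ)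
  · obtain ⟨h1, h2⟩ := tendsto_integral_Ioi_of_bound
      (fun k => (hI.integrableOn_inner hF hα (h.pos k) hφ).2)
      (fun k t ht => hφ.innerF_eq_zero _ _ ht) (fun k t ht => (hbd k t ht).2)
      (fun t ht => (h.tendsto_inner hI hF hα hφ ht).2)
    refine ⟨h1, ?_⟩
    have h3 : Tendsto (fun k => ∫ x, φ 0 x ∂(distMeasure (numF Finf α u₀ F₀ (δ k) 0))) atTop
        (𝓝 (∫ x, φ 0 x ∂(distMeasure F₀))) := by
      have := (h.distFn hI hF hα le_rfl).tendsto_integral (C := B) (g := fun _ => φ 0)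
        (Eventually.of_forall fun k => hI.num_distFn hF hα (h.pos k) le_rfl)
        (h.tendsto_F 0 le_rfl) (hφ.val.continuous_right 0)
        (Eventually.of_forall fun _ => hφ.val.continuous_right 0)
        (Eventually.of_forall fun _ x => hφ.val.bound 0 x)
        fun y z hz => ((hφ.val.continuous_right 0).tendsto y).comp hz
      rwa [h.init_F hI hF hα hc] at this
    exact tendsto_nhds_unique (h2.add h3) (((hI.weakF_isBigO hF hα hφ).trans_tendsto hs).comp hδ)

theorem IsPointwiseLimit.isConservativeSolution (h : IsPointwiseLimit Finf α u₀ F₀ δ u F)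
    (hI : InitData Finf M₀ R u₀ F₀) (hF : 0 < Finf) (hα : α ∈ Ioc (0 : ℝ) 1)
    (hc : ∀ x, ContinuousWithinAt F₀ (Iic x) x) : IsConservativeSolution Finf u₀ F₀ u F where
  init_u := h.init_u hI hF hα
  init_F := h.init_F hI hF hα hc
  bounded T _ := ⟨M₀ + 1 / 4 * Finf * T, fun t ht x =>
    (h.abs_u_le hI hF hα ht.1 x).trans (by nlinarith [ht.2])⟩
  holder _ hT := h.holder hI hF hα hT
  mem_D _ ht := InD.of_energyIneq (h.energyIneq hI hF hα ht) (h.distFn hI hF hα ht)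
    (h.abs_u_le hI hF hα ht)
  weak_u _ hφ := (h.weak hI hF hα hc hφ).1
  weak_F _ hφ := (h.weak hI hF hα hc hφ).2

end Limit

/-! ### Compactness -/

theorem exists_tendsto_of_approx {a : ℕ → ℝ}
    (h : ∀ ε > 0, ∃ (b : ℕ → ℝ) (c : ℝ), Tendsto b atTop (𝓝 c) ∧ ∀ᶠ k in atTop, |a k - b k| ≤ ε) :
    ∃ c, Tendsto a atTop (𝓝 c) := by
  refine cauchySeq_tendsto_of_complete (Metric.cauchySeq_iff'.2 fun ε hε => ?_)
  obtain ⟨b, c, hb, hab⟩ := h (ε / 5) (by positivity)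
  obtain ⟨N, hN⟩ := eventually_atTop.1 (hab.and (hb.eventually
    (Metric.ball_mem_nhds c (by positivity : 0 < ε / 5))))
  refine ⟨N, fun n hn => ?_⟩
  obtain ⟨h1, h2⟩ := hN n hn
  obtain ⟨h3, h4⟩ := hN N le_rfl
  rw [Real.dist_eq] at h2 h4
  rw [Real.dist_eq]
  rw [abs_le] at h1 h3
  rw [abs_lt] at h2 h4 ⊢
  constructor <;> linarith [h1.1, h1.2, h2.1, h2.2, h3.1, h3.2, h4.1, h4.2]

/-- Pointwise convergence to zero of an asymptotically equicontinuous sequence is uniform on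
compact sets. -/
theorem eventually_forall_le_of_isCompact {X : Type*} [TopologicalSpace X] {K : Set X}
    (hK : IsCompact K) {D : ℕ → X → ℝ≥0∞} (hD : ∀ p ∈ K, Tendsto (fun k => D k p) atTop (𝓝 0))
    (hE : ∀ p ∈ K, ∀ ε : ℝ, 0 < ε → ∃ U ∈ 𝓝[K] p, ∀ᶠ k in atTop, ∀ q ∈ U,
      D k q ≤ D k p + ENNReal.ofReal ε) {ε : ℝ} (hε : 0 < ε) :
    ∀ᶠ k in atTop, ∀ q ∈ K, D k q ≤ ENNReal.ofReal ε := by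
  refine hK.induction_on (p := fun S => ∀ᶠ k in atTop, ∀ q ∈ S, D k q ≤ ENNReal.ofReal ε)
    (by simp) (fun S S' hS h => h.mono fun k hk q hq => hk q (hS hq)) (fun S S' h h' => ?_) ?_
  · filter_upwards [h, h'] with k h1 h2 q hq
    exact hq.elim (h1 q) (h2 q)
  · intro p hp
    obtain ⟨U, hU, hev⟩ := hE p hp (ε / 2) (by positivity)
    refine ⟨U, hU, ?_⟩
    have h0 : (0 : ℝ≥0∞) < ENNReal.ofReal (ε / 2) := by simpa using hε
    filter_upwards [hev, (hD p hp).eventually (ge_mem_nhds h0)] with k h1 h2 q hq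
    refine (h1 q hq).trans ((add_le_add_left h2 _).trans_eq ?_)
    rw [← ENNReal.ofReal_add (by positivity) (by positivity)]
    congr 1
    ring

/-- The left continuous lower limit of a sequence of monotone functions. -/
def lowerLimit (a : ℕ → ℝ → ℝ) (x : ℝ) : ℝ := sSup {c | ∃ y < x, ∀ᶠ k in atTop, c ≤ a k y}

section LowerLimit

variable {a : ℕ → ℝ → ℝ} {K : ℝ}

theorem lowerLimit_bddAbove (hK : ∀ k x, a k x ≤ K) (x : ℝ) :
    BddAbove {c | ∃ y < x, ∀ᶠ k in atTop, c ≤ a k y} := by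
  refine ⟨K, ?_⟩
  rintro c ⟨y, -, hc⟩
  obtain ⟨k, hk⟩ := hc.exists
  exact hk.trans (hK k y)

theorem lowerLimit_nonempty (h₀ : ∀ k x, 0 ≤ a k x) (x : ℝ) :
    {c | ∃ y < x, ∀ᶠ k in atTop, c ≤ a k y}.Nonempty :=
  ⟨0, x - 1, by simp, Eventually.of_forall fun k => h₀ k _⟩

theorem lowerLimit_monotone (h₀ : ∀ k x, 0 ≤ a k x) (hK : ∀ k x, a k x ≤ K) :
    Monotone (lowerLimit a) := fun x x' hx =>
  csSup_le_csSup (lowerLimit_bddAbove hK x') (lowerLimit_nonempty h₀ x)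
    fun _ ⟨y, hy, hc⟩ => ⟨y, hy.trans_le hx, hc⟩

theorem lowerLimit_leftCont (h₀ : ∀ k x, 0 ≤ a k x) (hK : ∀ k x, a k x ≤ K) (x : ℝ) :
    ContinuousWithinAt (lowerLimit a) (Iic x) x := by
  refine tendsto_order.2 ⟨fun b hb => ?_, fun b hb => ?_⟩
  · obtain ⟨c, ⟨y, hy, hc⟩, hbc⟩ := exists_lt_of_lt_csSup (lowerLimit_nonempty h₀ x) hb
    filter_upwards [nhdsWithin_le_nhds (lt_mem_nhds hy)] with z hz
    exact hbc.trans_le (le_csSup (lowerLimit_bddAbove hK z) ⟨y, hz, hc⟩)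
  · filter_upwards [self_mem_nhdsWithin] with z hz
    exact (lowerLimit_monotone h₀ hK hz).trans_lt hb

/-- Helly's selection principle, for sequences that are interlaced with convergent sequences. -/
theorem ae_tendsto_lowerLimit (h₀ : ∀ k x, 0 ≤ a k x) (hK : ∀ k x, a k x ≤ K)
    (ha : ∀ k, Monotone (a k))
    (h : ∀ x y, x < y → ∃ (b : ℕ → ℝ) (c : ℝ), Tendsto b atTop (𝓝 c) ∧
      ∀ᶠ k in atTop, a k x ≤ b k ∧ b k ≤ a k y) :
    ∀ᵐ x, Tendsto (fun k => a k x) atTop (𝓝 (lowerLimit a x)) := by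
  have hcont : ∀ᵐ x, ContinuousAt (lowerLimit a) x := by
    filter_upwards [measure_eq_zero_iff_ae_notMem.1
      ((lowerLimit_monotone h₀ hK).countable_not_continuousAt.measure_zero volume)] with x hx
    by_contra hn
    exact hx hn
  filter_upwards [hcont] with x hx
  refine tendsto_order.2 ⟨fun b hb => ?_, fun b hb => ?_⟩
  · obtain ⟨c, ⟨y, hy, hc⟩, hbc⟩ := exists_lt_of_lt_csSup (lowerLimit_nonempty h₀ x) hb
    filter_upwards [hc] with k hk
    exact hbc.trans_le (hk.trans (ha k hy.le))
  · obtain ⟨z, hz, hxz⟩ := (((hx.tendsto.mono_left nhdsWithin_le_nhds).eventually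
      (gt_mem_nhds hb)).and (self_mem_nhdsWithin : Ioi x ∈ 𝓝[>] x)).exists
    obtain ⟨y, hxy, hyz⟩ := exists_between (show x < z from hxz)
    -- The interlaced sequence at levels x < y < z bounds `a k x` eventually by any number above c,
    -- and c is at most the lower limit at z, which is below b.
    obtain ⟨s, c, hs, hev⟩ := h x y hxy
    have hc : c ≤ lowerLimit a z := by
      refine le_of_forall_lt fun c' hc' => ?_
      obtain ⟨c'', h1, h2⟩ := exists_between hc'
      refine h1.trans_le (le_csSup (lowerLimit_bddAbove hK z) ⟨y, hyz, ?_⟩)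
      filter_upwards [hev, hs.eventually (lt_mem_nhds h2)] with k h3 h4
      exact h4.le.trans h3.2
    filter_upwards [hev, hs.eventually (gt_mem_nhds (hc.trans_lt hz))] with k h3 h4
    exact h3.1.trans_lt h4

end LowerLimit

/-- Displacing mass `Finf` horizontally by at most h costs at most 2h·Finf in L¹: both G and H lie
between the shifts of G by ±h. -/
theorem eLpNorm_sub_le_of_shift {Finf h : ℝ} {G H : ℝ → ℝ} (hG : DistFn Finf G) (hh : 0 ≤ h)
    (h₁ : ∀ x, G (x - h) ≤ H x) (h₂ : ∀ x, H x ≤ G (x + h)) :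
    eLpNorm (H - G) 1 volume ≤ ENNReal.ofReal (2 * h * Finf) := by
  obtain ⟨r, hr₁, hr₂⟩ := hG.far
  set S := |r| + h with hS
  have hS0 : 0 ≤ S := by positivity
  have m1 : Monotone fun x => G (x + h) := fun x y hxy => hG.mono (by linarith)
  have m2 : Monotone fun x => G (x - h) := fun x y hxy => hG.mono (by linarith)
  have hzero : ∀ x, x ∉ Ioc (-S) S → G (x + h) - G (x - h) = 0 := fun x hx => by
    rcases le_or_gt x (-S) with hle | hgt
    · rw [hr₁ _ (by linarith [le_abs_self r]), hr₁ _ (by linarith [le_abs_self r]), sub_zero]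
    · have : S < x := not_le.1 fun hle => hx ⟨hgt, hle⟩
      rw [hr₂ _ (by linarith [le_abs_self r]), hr₂ _ (by linarith [le_abs_self r]), sub_self]
  have hi : IntervalIntegrable (fun x => G (x + h) - G (x - h)) volume (-S) S :=
    m1.intervalIntegrable.sub m2.intervalIntegrable
  have hnn : ∀ x, 0 ≤ G (x + h) - G (x - h) := fun x => sub_nonneg.2 (hG.mono (by linarith))
  rw [eLpNorm_one_eq_lintegral_enorm]
  calc ∫⁻ x, ‖(H - G) x‖ₑ ≤ ∫⁻ x, ENNReal.ofReal (G (x + h) - G (x - h)) := by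
        refine lintegral_mono fun x => ?_
        rw [Real.enorm_eq_ofReal_abs, Pi.sub_apply]
        refine ENNReal.ofReal_le_ofReal ?_
        have h3 : G x ≤ G (x + h) := hG.mono (by linarith)
        have h4 : G (x - h) ≤ G x := hG.mono (by linarith)
        rw [abs_le]
        constructor <;> linarith [h₁ x, h₂ x]
    _ = ∫⁻ x in Ioc (-S) S, ENNReal.ofReal (G (x + h) - G (x - h)) := by
        rw [setLIntegral_eq_of_support_subset]
        intro x hx
        by_contra hn
        exact hx (by simp [hzero x hn])
    _ = ENNReal.ofReal (∫ x in (-S)..S, (G (x + h) - G (x - h))) := by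
        rw [intervalIntegral.integral_of_le (by linarith), ofReal_integral_eq_lintegral_ofReal
          ((intervalIntegrable_iff_integrableOn_Ioc_of_le (by linarith)).1 hi)
          (Eventually.of_forall hnn)]
    _ ≤ _ := ENNReal.ofReal_le_ofReal
        (intervalIntegral_shift_sub_le hG.mono hG.nonneg hG.le hh _ _)

section Compactness

variable {Finf α M₀ R : ℝ} {u₀ F₀ : ℝ → ℝ} {δ : ℕ → ℝ}

/-- Compactness of a countable product of boxes replaces a diagonal argument. The absolute value of
the rational time keeps every coordinate of the product within the range of the bounds. -/
theorem InitData.exists_subseq (hI : InitData Finf M₀ R u₀ F₀) (hF : 0 < Finf)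
    (hα : α ∈ Ioc (0 : ℝ) 1) (hδ : ∀ k, 0 < δ k) : ∃ κ : ℕ → ℕ, StrictMono κ ∧
      ∀ q r : ℚ, 0 ≤ q →
        (∃ c, Tendsto (fun k => numU Finf α u₀ F₀ (δ (κ k)) q r) atTop (𝓝 c)) ∧
        ∃ c, Tendsto (fun k => numF Finf α u₀ F₀ (δ (κ k)) q r) atTop (𝓝 c) := by
  set v : ℕ → ℚ × ℚ → ℝ × ℝ := fun k p =>
    (numU Finf α u₀ F₀ (δ k) |(p.1 : ℝ)| p.2, numF Finf α u₀ F₀ (δ k) |(p.1 : ℝ)| p.2) with hv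
  have hK : IsCompact (univ.pi fun p : ℚ × ℚ =>
      Icc (-(M₀ + 1 / 4 * Finf * |(p.1 : ℝ)|)) (M₀ + 1 / 4 * Finf * |(p.1 : ℝ)|) ×ˢ Icc 0 Finf) :=
    isCompact_univ_pi fun p => isCompact_Icc.prod isCompact_Icc
  obtain ⟨c, -, κ, hκ, hc⟩ := hK.tendsto_subseq (x := v) fun k p _ => by
    have hs := hI.numSol_state hF hα (hδ k) (abs_nonneg (p.1 : ℝ))
    exact ⟨_root_.abs_le.1 (hI.abs_numU_le hF hα (hδ k) (abs_nonneg _) _), hs.nonneg _, hs.le _⟩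
  refine ⟨κ, hκ, fun q r hq => ?_⟩
  have h1 := tendsto_pi_nhds.1 hc (q, r)
  have e : |(q : ℝ)| = q := abs_of_nonneg (by exact_mod_cast hq)
  simp only [hv, Function.comp_apply, e] at h1
  exact ⟨⟨_, (continuous_fst.tendsto _).comp h1⟩, ⟨_, (continuous_snd.tendsto _).comp h1⟩⟩

theorem InitData.num_equicontinuous (hI : InitData Finf M₀ R u₀ F₀) (hF : 0 < Finf)
    (hα : α ∈ Ioc (0 : ℝ) 1) (hδ : ∀ k, 0 < δ k) (hδ₀ : Tendsto δ atTop (𝓝 0)) {T ε : ℝ}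
    (hT : 0 ≤ T) (hε : 0 < ε) : ∃ η > 0, ∀ᶠ k in atTop, ∀ s ∈ Icc 0 T, ∀ t ∈ Icc 0 T, ∀ x y,
      |t - s| < η → |y - x| < η →
        |numU Finf α u₀ F₀ (δ k) t y - numU Finf α u₀ F₀ (δ k) s x| ≤ ε := by
  set A := speed Finf α M₀ T
  have hA : 0 ≤ A := hI.speed_nonneg hα hT
  have hc : Continuous fun d => √(Finf * d) + (1 / 2 * Finf * d + 2 * √(Finf * (A * d))) := by
    fun_prop
  -- The modulus is made small at d; one half of d is for the distance in time, the other for the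
  -- slack 4Δt of the scheme.
  have h0 : ∀ᶠ d in 𝓝[>] (0 : ℝ),
      √(Finf * d) + (1 / 2 * Finf * d + 2 * √(Finf * (A * d))) < ε := by
    have := (hc.tendsto 0).mono_left (nhdsWithin_le_nhds (s := Ioi 0))
    exact this.eventually (gt_mem_nhds (by simpa using hε))
  obtain ⟨d, hd, hd0⟩ := (h0.and self_mem_nhdsWithin).exists
  have hd0 : 0 < d := hd0
  refine ⟨d / 2, by positivity, ?_⟩
  have hΔ := ((tendsto_timeStep Finf α hδ₀).const_mul 4).eventually
    (gt_mem_nhds (by simpa using hd0 : 4 * 0 < d / 2))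
  filter_upwards [hΔ, hδ₀.eventually (ge_mem_nhds zero_lt_one)] with k hk hk1 s hs t ht x y hts hyx
  have h1 := (hI.num_time hF hα (hδ k) hk1 hs ht rfl x).2
  have hG := hI.numSol_state hF hα (hδ k) ht.1
  have h2 := hG.energy.abs_sub_le_sqrt hG.sub_le x y
  have h3 := abs_sub_le (numU Finf α u₀ F₀ (δ k) t y) (numU Finf α u₀ F₀ (δ k) t x)
    (numU Finf α u₀ F₀ (δ k) s x)
  have hr : |t - s| + 4 * timeStep Finf α (δ k) ≤ d := by linarith
  have h4 : √(Finf * |y - x|) ≤ √(Finf * d) :=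
    Real.sqrt_le_sqrt (mul_le_mul_of_nonneg_left (by linarith) hF.le)
  have h5 : √(Finf * (A * (|t - s| + 4 * timeStep Finf α (δ k)))) ≤ √(Finf * (A * d)) :=
    Real.sqrt_le_sqrt (mul_le_mul_of_nonneg_left (mul_le_mul_of_nonneg_left hr hA) hF.le)
  have h6 : 1 / 2 * Finf * (|t - s| + 4 * timeStep Finf α (δ k)) ≤ 1 / 2 * Finf * d :=
    mul_le_mul_of_nonneg_left hr (by positivity)
  exact h3.trans ((add_le_add h2 h1).trans (by linarith))

theorem InitData.exists_isPointwiseLimit (hI : InitData Finf M₀ R u₀ F₀) (hF : 0 < Finf)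
    (hα : α ∈ Ioc (0 : ℝ) 1) (hδ : ∀ k, 0 < δ k) (hδ₀ : Tendsto δ atTop (𝓝 0)) :
    ∃ κ : ℕ → ℕ, StrictMono κ ∧ ∃ u F, IsPointwiseLimit Finf α u₀ F₀ (δ ∘ κ) u F := by
  obtain ⟨κ, hκ, hlim⟩ := hI.exists_subseq hF hα hδ
  have hδ' : ∀ k, 0 < (δ ∘ κ) k := fun k => hδ _
  have hδ₀' : Tendsto (δ ∘ κ) atTop (𝓝 0) := hδ₀.comp hκ.tendsto_atTop
  have hu : ∀ t x, 0 ≤ t → ∃ c, Tendsto (fun k => numU Finf α u₀ F₀ ((δ ∘ κ) k) t x) atTop (𝓝 c) := by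
    intro t x ht
    refine exists_tendsto_of_approx fun ε hε => ?_
    obtain ⟨η, hη, hev⟩ := hI.num_equicontinuous hF hα hδ' hδ₀' (T := t + 1) (by linarith) hε
    obtain ⟨q, hq₁, hq₂⟩ := exists_rat_btwn (show t < t + min η 1 by simp [hη])
    obtain ⟨r, hr₁, hr₂⟩ := exists_rat_btwn (show x < x + η by simp [hη])
    have hq : (0 : ℝ) ≤ q := ht.trans hq₁.le
    obtain ⟨c, hc⟩ := (hlim q r (by exact_mod_cast hq)).1
    refine ⟨_, c, hc, ?_⟩
    filter_upwards [hev] with k hk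
    refine hk q ⟨hq, ?_⟩ t ⟨ht, by linarith⟩ r x ?_ ?_
    · linarith [min_le_right η 1]
    · rw [abs_lt]; constructor <;> linarith [min_le_left η 1]
    · rw [abs_lt]; constructor <;> linarith
  choose! u hu using hu
  refine ⟨κ, hκ, u, fun t => lowerLimit fun k => numF Finf α u₀ F₀ ((δ ∘ κ) k) t, hδ', hδ₀',
    fun t ht x => hu t x ht, fun t ht => ?_, fun t ht => ?_⟩
  · have hs := fun k => hI.numSol_state hF hα (hδ' k) ht
    refine ae_tendsto_lowerLimit (fun k => (hs k).nonneg) (fun k => (hs k).le)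
      (fun k => (hs k).energy.mono) fun x y hxy => ?_
    set A := speed Finf α M₀ (t + 1)
    have hA : 0 ≤ A := hI.speed_nonneg hα (by linarith)
    -- The scheme at (q, r) is placed between its values at (t, x) and (t, y). The spatial shift is
    -- at most 2d, one d for |t - q| and one for the slack 4Δt, and r keeps distance more than 2d
    -- from both x and y.
    set d := (y - x) / 8 with hd
    have hd0 : 0 < d := by rw [hd]; linarith
    obtain ⟨q, hq₁, hq₂⟩ := exists_rat_btwn
      (show t < t + min (d / (A + 1)) 1 by simp only [lt_add_iff_pos_right]; positivity)
    obtain ⟨r, hr₁, hr₂⟩ := exists_rat_btwn (show x + 2 * d < y - 2 * d by rw [hd]; linarith)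
    have hq : (0 : ℝ) ≤ q := ht.trans hq₁.le
    obtain ⟨c, hc⟩ := (hlim q r (by exact_mod_cast hq)).2
    refine ⟨_, c, hc, ?_⟩
    have hΔ := ((tendsto_timeStep Finf α hδ₀').const_mul (A * 4)).eventually
      (gt_mem_nhds (by simpa using hd0 : A * 4 * 0 < d))
    have hq' : A * |t - q| ≤ d := by
      have h1 : |t - q| ≤ d / (A + 1) := by
        rw [_root_.abs_le]
        constructor <;> linarith [min_le_left (d / (A + 1)) 1, div_pos hd0 (by linarith : 0 < A + 1)]
      refine (mul_le_mul_of_nonneg_left h1 hA).trans ?_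
      rw [mul_div_assoc', div_le_iff₀ (by linarith)]
      nlinarith
    have hqm : (q : ℝ) ∈ Icc 0 (t + 1) := ⟨hq, by linarith [min_le_right (d / (A + 1)) 1]⟩
    have htm : t ∈ Icc 0 (t + 1) := ⟨ht, by linarith⟩
    filter_upwards [hΔ, hδ₀'.eventually (ge_mem_nhds zero_lt_one)] with k hk hk1
    have h1 := (hI.num_time hF hα (hδ' k) hk1 hqm htm rfl x).1
    have h2 := (hI.num_time hF hα (hδ' k) hk1 htm hqm rfl r).1
    rw [abs_sub_comm] at h2
    have hshift : A * (|t - q| + 4 * timeStep Finf α ((δ ∘ κ) k)) ≤ 2 * d := by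
      rw [mul_add, ← mul_assoc]; linarith
    exact ⟨h1.trans ((hI.numSol_state hF hα (hδ' k) hq).energy.mono (by linarith)),
      h2.trans ((hs k).energy.mono (by linarith))⟩
  · exact lowerLimit_leftCont (fun k => (hI.numSol_state hF hα (hδ' k) ht).nonneg)
      (fun k => (hI.numSol_state hF hα (hδ' k) ht).le)

end Compactness

/-! ### Uniform convergence -/

section Uniform

variable {Finf α M₀ R : ℝ} {u₀ F₀ : ℝ → ℝ} {δ : ℕ → ℝ} {u F : ℝ → ℝ → ℝ}

/-- The nearest point to `x` in the interval `[-r, r]`. -/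
def clamp (r x : ℝ) : ℝ := max (-r) (min r x)

theorem clamp_mem {r : ℝ} (hr : 0 ≤ r) (x : ℝ) : clamp r x ∈ Icc (-r) r :=
  ⟨le_max_left _ _, max_le (by linarith) (min_le_left _ _)⟩

/-- Where G is constant the energy inequality forces U to be constant. Uniform convergence on ℝ is
thereby reduced to a compact interval. -/
theorem EnergyIneq.eq_clamp {U G : ℝ → ℝ} {r c₁ c₂ : ℝ} (h : EnergyIneq U G) (hr : 0 ≤ r)
    (h₁ : ∀ x, x ≤ -r → G x = c₁) (h₂ : ∀ x, r ≤ x → G x = c₂) (x : ℝ) : U x = U (clamp r x) := by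
  have key : ∀ x y, x ≤ y → G x = G y → U x = U y := fun x y hxy he => by
    have := h.sq_le hxy
    rw [he, sub_self, mul_zero] at this
    have h0 := pow_eq_zero_iff two_ne_zero |>.1 (le_antisymm this (sq_nonneg _))
    linarith
  unfold clamp
  rcases le_total x (-r) with hx | hx
  · rw [min_eq_right (by linarith), max_eq_left hx]
    exact key _ _ hx ((h₁ x hx).trans (h₁ _ le_rfl).symm)
  · rcases le_total x r with hx' | hx'
    · rw [min_eq_right hx', max_eq_right hx]
    · rw [min_eq_left hx', max_eq_right (by linarith)]
      exact (key _ _ hx' ((h₂ _ le_rfl).trans (h₂ x hx').symm)).symm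

theorem InitData.numU_eq_clamp (hI : InitData Finf M₀ R u₀ F₀) (hF : 0 < Finf)
    (hα : α ∈ Ioc (0 : ℝ) 1) {δ : ℝ} (hδ : 0 < δ) (hδ₁ : δ ≤ 1) {T t : ℝ} (ht : t ∈ Icc 0 T)
    (x : ℝ) : numU Finf α u₀ F₀ δ t x =
      numU Finf α u₀ F₀ δ t (clamp |radius Finf α M₀ R T| x) :=
  (hI.numSol_state hF hα hδ ht.1).energy.eq_clamp (abs_nonneg _)
    (fun _ hy => (hI.numF_far hF hα hδ hδ₁ ht).1
      (hy.trans (neg_le_neg (le_abs_self _))))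
    (fun _ hy => (hI.numF_far hF hα hδ hδ₁ ht).2 ((le_abs_self _).trans hy)) x

theorem InitData.eLpNorm_numF_sub_le (hI : InitData Finf M₀ R u₀ F₀) (hF : 0 < Finf)
    (hα : α ∈ Ioc (0 : ℝ) 1) {δ : ℝ} (hδ : 0 < δ) (hδ₁ : δ ≤ 1) {T s t : ℝ} (hs : s ∈ Icc 0 T)
    (ht : t ∈ Icc 0 T) :
    eLpNorm (numF Finf α u₀ F₀ δ t - numF Finf α u₀ F₀ δ s) 1 volume ≤
      ENNReal.ofReal (2 * (speed Finf α M₀ T * (|t - s| + 4 * timeStep Finf α δ)) * Finf) := by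
  have hA := hI.speed_nonneg hα (hs.1.trans hs.2)
  have hp := timeStep_pos hF hα hδ
  refine eLpNorm_sub_le_of_shift (hI.num_distFn hF hα hδ hs.1) (by positivity) (fun x => ?_)
    fun x => (hI.num_time hF hα hδ hδ₁ hs ht rfl x).1
  have := (hI.num_time hF hα hδ hδ₁ ht hs rfl
    (x - speed Finf α M₀ T * (|t - s| + 4 * timeStep Finf α δ))).1
  rwa [abs_sub_comm s t, sub_add_cancel] at this

namespace IsPointwiseLimit

theorem u_eq_clamp (h : IsPointwiseLimit Finf α u₀ F₀ δ u F) (hI : InitData Finf M₀ R u₀ F₀)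
    (hF : 0 < Finf) (hα : α ∈ Ioc (0 : ℝ) 1) {T t : ℝ} (ht : t ∈ Icc 0 T) (x : ℝ) :
    u t x = u t (clamp |radius Finf α M₀ R T| x) := by
  refine tendsto_nhds_unique (h.tendsto_u t ht.1 x) ((h.tendsto_u t ht.1 _).congr' ?_)
  filter_upwards [h.eventually_le_one] with k hk
  exact (hI.numU_eq_clamp hF hα (h.pos k) hk ht x).symm

/-- Pointwise convergence and equicontinuity up to the time step give uniform convergence on a
compact set of times and positions. Beyond it, scheme and limit both repeat their boundary values.
-/
theorem tendstoUniformlyOn (h : IsPointwiseLimit Finf α u₀ F₀ δ u F)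
    (hI : InitData Finf M₀ R u₀ F₀) (hF : 0 < Finf) (hα : α ∈ Ioc (0 : ℝ) 1) {T : ℝ} (hT : 0 ≤ T) :
    TendstoUniformlyOn (fun k (p : ℝ × ℝ) => numU Finf α u₀ F₀ (δ k) p.1 p.2)
      (fun p => u p.1 p.2) atTop (Icc 0 T ×ˢ univ) := by
  set r := |radius Finf α M₀ R T| with hr
  have hr0 : 0 ≤ r := abs_nonneg _
  have hcomp : ∀ ε > 0, ∀ᶠ k in atTop, ∀ p ∈ Icc 0 T ×ˢ Icc (-r) r,
      edist (u p.1 p.2) (numU Finf α u₀ F₀ (δ k) p.1 p.2) ≤ ENNReal.ofReal ε := by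
    intro ε hε
    refine eventually_forall_le_of_isCompact (isCompact_Icc.prod isCompact_Icc)
      (D := fun k (p : ℝ × ℝ) => edist (u p.1 p.2) (numU Finf α u₀ F₀ (δ k) p.1 p.2)) ?_ ?_ hε
    · rintro ⟨t, x⟩ ⟨ht, -⟩
      have := tendsto_iff_edist_tendsto_0.1 (h.tendsto_u t ht.1 x)
      simpa only [edist_comm] using this
    · rintro ⟨s, x⟩ ⟨hs, -⟩ ε hε
      obtain ⟨η, hη, hev⟩ := hI.num_equicontinuous hF hα h.pos h.tendsto_zero hT (half_pos hε)
      refine ⟨Metric.ball (s, x) η ∩ (Icc 0 T ×ˢ Icc (-r) r), inter_mem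
        (nhdsWithin_le_nhds (Metric.ball_mem_nhds _ hη)) self_mem_nhdsWithin, ?_⟩
      filter_upwards [hev] with k hk
      rintro ⟨t, y⟩ ⟨hd, ht, -⟩
      have hd1 : |t - s| < η := (le_max_left (dist t s) (dist y x)).trans_lt hd
      have hd2 : |y - x| < η := (le_max_right (dist t s) (dist y x)).trans_lt hd
      have h1 : edist (u t y) (u s x) ≤ ENNReal.ofReal (ε / 2) := by
        rw [edist_dist, Real.dist_eq]
        refine ENNReal.ofReal_le_ofReal (le_of_tendsto
          ((h.tendsto_u t ht.1 y).sub (h.tendsto_u s hs.1 x)).abs ?_)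
        filter_upwards [hev] with k hk using hk s hs t ht x y hd1 hd2
      have h2 : edist (numU Finf α u₀ F₀ (δ k) s x) (numU Finf α u₀ F₀ (δ k) t y) ≤
          ENNReal.ofReal (ε / 2) := by
        rw [edist_comm, edist_dist, Real.dist_eq]
        exact ENNReal.ofReal_le_ofReal (hk s hs t ht x y hd1 hd2)
      have e : ENNReal.ofReal ε = ENNReal.ofReal (ε / 2) + ENNReal.ofReal (ε / 2) := by
        rw [← ENNReal.ofReal_add (by positivity) (by positivity), add_halves]
      calc edist (u t y) (numU Finf α u₀ F₀ (δ k) t y)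
          ≤ edist (u t y) (u s x) + edist (u s x) (numU Finf α u₀ F₀ (δ k) s x) +
            edist (numU Finf α u₀ F₀ (δ k) s x) (numU Finf α u₀ F₀ (δ k) t y) :=
            edist_triangle4 _ _ _ _
        _ ≤ ENNReal.ofReal (ε / 2) + edist (u s x) (numU Finf α u₀ F₀ (δ k) s x) +
            ENNReal.ofReal (ε / 2) := by gcongr
        _ = _ := by rw [e]; ring
  rw [Metric.tendstoUniformlyOn_iff]
  intro ε hε
  filter_upwards [hcomp (ε / 2) (half_pos hε), h.eventually_le_one] with k hk hk1
  rintro ⟨t, x⟩ ⟨ht, -⟩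
  have h1 := hk (t, clamp r x) ⟨ht, clamp_mem hr0 x⟩
  simp only at h1 ⊢
  rw [h.u_eq_clamp hI hF hα ht x, hI.numU_eq_clamp hF hα (h.pos k) hk1 ht x]
  rw [edist_dist, ENNReal.ofReal_le_ofReal_iff (half_pos hε).le] at h1
  linarith

theorem aestronglyMeasurable_sub (h : IsPointwiseLimit Finf α u₀ F₀ δ u F)
    (hI : InitData Finf M₀ R u₀ F₀) (hF : 0 < Finf) (hα : α ∈ Ioc (0 : ℝ) 1) {t : ℝ} (ht : 0 ≤ t)
    (k : ℕ) : AEStronglyMeasurable (numF Finf α u₀ F₀ (δ k) t - F t) volume :=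
  ((hI.num_distFn hF hα (h.pos k) ht).mono.measurable.sub
    (h.distFn hI hF hα ht).mono.measurable).aestronglyMeasurable

/-- Outside [-r, r] the scheme and the limit take the same constant values, so dominated convergence
applies on a set of finite measure. -/
theorem tendsto_eLpNorm (h : IsPointwiseLimit Finf α u₀ F₀ δ u F)
    (hI : InitData Finf M₀ R u₀ F₀) (hF : 0 < Finf) (hα : α ∈ Ioc (0 : ℝ) 1) {t : ℝ} (ht : 0 ≤ t) :
    Tendsto (fun k => eLpNorm (numF Finf α u₀ F₀ (δ k) t - F t) 1 volume) atTop (𝓝 0) := by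
  have hd := h.distFn hI hF hα ht
  set r := radius Finf α M₀ R t
  have htm : t ∈ Icc 0 t := ⟨ht, le_rfl⟩
  obtain ⟨hf₁, hf₂⟩ := h.far hI hF hα htm
  simp only [eLpNorm_one_eq_lintegral_enorm]
  have := tendsto_lintegral_filter_of_dominated_convergence (μ := volume) (l := atTop)
    (F := fun k x => ‖(numF Finf α u₀ F₀ (δ k) t - F t) x‖ₑ) (f := fun _ => 0)
    ((Icc (-r) r).indicator fun _ => ENNReal.ofReal Finf) ?_ ?_ ?_ ?_
  · simpa using this
  · exact Eventually.of_forall fun k =>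
      ((hI.num_distFn hF hα (h.pos k) ht).mono.measurable.sub hd.mono.measurable).enorm
  · filter_upwards [h.eventually_le_one] with k hk
    refine Eventually.of_forall fun x => ?_
    have hn := hI.num_distFn hF hα (h.pos k) ht
    by_cases hx : x ∈ Icc (-r) r
    · rw [indicator_of_mem hx, Real.enorm_eq_ofReal_abs, Pi.sub_apply]
      refine ENNReal.ofReal_le_ofReal (abs_le.2 ⟨?_, ?_⟩) <;>
        linarith [hn.nonneg x, hn.le x, hd.nonneg x, hd.le x]
    · rw [indicator_of_notMem hx, Pi.sub_apply]
      rcases le_or_gt x (-r) with hle | hgt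
      · rw [hf₁ x hle, (hI.numF_far hF hα (h.pos k) hk htm).1 hle]; simp
      · have hgt' : r < x := not_le.1 fun hle => hx ⟨hgt.le, hle⟩
        rw [hf₂ x hgt', (hI.numF_far hF hα (h.pos k) hk htm).2 hgt'.le]; simp
  · rw [lintegral_indicator measurableSet_Icc, setLIntegral_const]
    exact ENNReal.mul_ne_top ENNReal.ofReal_ne_top (by simp)
  · filter_upwards [h.tendsto_F t ht] with x hx
    have := (hx.sub_const (F t x)).enorm
    simpa using this

theorem eLpNorm_F_sub_le (h : IsPointwiseLimit Finf α u₀ F₀ δ u F)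
    (hI : InitData Finf M₀ R u₀ F₀) (hF : 0 < Finf) (hα : α ∈ Ioc (0 : ℝ) 1) {T s t : ℝ}
    (hs : s ∈ Icc 0 T) (ht : t ∈ Icc 0 T) :
    eLpNorm (F t - F s) 1 volume ≤ ENNReal.ofReal (2 * (speed Finf α M₀ T * |t - s|) * Finf) := by
  set A := speed Finf α M₀ T
  have l1 : Tendsto (fun k => ENNReal.ofReal
      (2 * (A * (|t - s| + 4 * timeStep Finf α (δ k))) * Finf)) atTop
      (𝓝 (ENNReal.ofReal (2 * (A * |t - s|) * Finf))) := by
    refine ENNReal.tendsto_ofReal ?_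
    have hc : Continuous fun d => 2 * (A * (|t - s| + 4 * d)) * Finf := by fun_prop
    simpa [Function.comp_def] using
      (hc.tendsto 0).comp (tendsto_timeStep Finf α h.tendsto_zero)
  have l2 := ((h.tendsto_eLpNorm hI hF hα ht.1).add l1).add (h.tendsto_eLpNorm hI hF hα hs.1)
  rw [zero_add, add_zero] at l2
  refine ge_of_tendsto l2 ?_
  filter_upwards [h.eventually_le_one] with k hk
  have m1 := h.aestronglyMeasurable_sub hI hF hα ht.1 k
  have m2 := h.aestronglyMeasurable_sub hI hF hα hs.1 k
  have m3 : AEStronglyMeasurable (numF Finf α u₀ F₀ (δ k) t - numF Finf α u₀ F₀ (δ k) s) volume :=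
    ((hI.num_distFn hF hα (h.pos k) ht.1).mono.measurable.sub
      (hI.num_distFn hF hα (h.pos k) hs.1).mono.measurable).aestronglyMeasurable
  have e : F t - F s = (-(numF Finf α u₀ F₀ (δ k) t - F t) +
      (numF Finf α u₀ F₀ (δ k) t - numF Finf α u₀ F₀ (δ k) s)) +
      (numF Finf α u₀ F₀ (δ k) s - F s) := by ring
  rw [e]
  refine (eLpNorm_add_le (m1.neg.add m3) m2 le_rfl).trans (add_le_add_left ?_ _)
  refine (eLpNorm_add_le m1.neg m3 le_rfl).trans ?_
  rw [eLpNorm_neg]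
  exact add_le_add_right (hI.eLpNorm_numF_sub_le hF hα (h.pos k) hk hs ht) _

/-- The L¹ distance at fixed time tends to zero, and it is equicontinuous in time up to the slack
4Δt by the shift bounds for scheme and limit; compactness of [0, T] makes this uniform. -/
theorem tendsto_iSup_eLpNorm (h : IsPointwiseLimit Finf α u₀ F₀ δ u F)
    (hI : InitData Finf M₀ R u₀ F₀) (hF : 0 < Finf) (hα : α ∈ Ioc (0 : ℝ) 1) {T : ℝ} (hT : 0 ≤ T) :
    Tendsto (fun k => ⨆ t ∈ Icc 0 T, eLpNorm (numF Finf α u₀ F₀ (δ k) t - F t) 1 volume)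
      atTop (𝓝 0) := by
  set A := speed Finf α M₀ T
  have hA : 0 ≤ A := hI.speed_nonneg hα hT
  have key : ∀ ε > 0, ∀ᶠ k in atTop, ∀ t ∈ Icc 0 T,
      eLpNorm (numF Finf α u₀ F₀ (δ k) t - F t) 1 volume ≤ ENNReal.ofReal ε := by
    intro ε hε
    refine eventually_forall_le_of_isCompact isCompact_Icc
      (D := fun k t => eLpNorm (numF Finf α u₀ F₀ (δ k) t - F t) 1 volume)
      (fun t ht => h.tendsto_eLpNorm hI hF hα ht.1) (fun s hs ε hε => ?_) hε
    have hc : Continuous fun d => 2 * (A * d) * Finf := by fun_prop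
    have h0 : ∀ᶠ d in 𝓝[>] (0 : ℝ), 2 * (A * d) * Finf < ε / 2 := by
      have := (hc.tendsto 0).mono_left (nhdsWithin_le_nhds (s := Ioi 0))
      exact this.eventually (gt_mem_nhds (by simpa using hε))
    obtain ⟨d, hd, hd0⟩ := (h0.and self_mem_nhdsWithin).exists
    have hd0 : 0 < d := hd0
    refine ⟨Metric.ball s (d / 2) ∩ Icc 0 T, inter_mem
      (nhdsWithin_le_nhds (Metric.ball_mem_nhds _ (half_pos hd0))) self_mem_nhdsWithin, ?_⟩
    have hΔ := ((tendsto_timeStep Finf α h.tendsto_zero).const_mul 4).eventually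
      (gt_mem_nhds (by simpa using hd0 : 4 * 0 < d / 2))
    filter_upwards [hΔ, h.eventually_le_one] with k hk hk1
    rintro t ⟨hts, ht⟩
    rw [Metric.mem_ball, Real.dist_eq] at hts
    have hp := timeStep_pos hF hα (h.pos k)
    have b1 : eLpNorm (numF Finf α u₀ F₀ (δ k) t - numF Finf α u₀ F₀ (δ k) s) 1 volume ≤
        ENNReal.ofReal (ε / 2) := by
      refine (hI.eLpNorm_numF_sub_le hF hα (h.pos k) hk1 hs ht).trans
        (ENNReal.ofReal_le_ofReal (le_trans ?_ hd.le))
      gcongr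
      linarith
    have b2 : eLpNorm (F s - F t) 1 volume ≤ ENNReal.ofReal (ε / 2) := by
      refine (h.eLpNorm_F_sub_le hI hF hα ht hs).trans
        (ENNReal.ofReal_le_ofReal (le_trans ?_ hd.le))
      rw [abs_sub_comm]
      gcongr
      linarith
    have m1 : AEStronglyMeasurable (numF Finf α u₀ F₀ (δ k) t - numF Finf α u₀ F₀ (δ k) s)
        volume := ((hI.num_distFn hF hα (h.pos k) ht.1).mono.measurable.sub
      (hI.num_distFn hF hα (h.pos k) hs.1).mono.measurable).aestronglyMeasurable
    have m2 := h.aestronglyMeasurable_sub hI hF hα hs.1 k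
    have m3 : AEStronglyMeasurable (F s - F t) volume :=
      ((h.distFn hI hF hα hs.1).mono.measurable.sub
        (h.distFn hI hF hα ht.1).mono.measurable).aestronglyMeasurable
    have e : numF Finf α u₀ F₀ (δ k) t - F t = ((numF Finf α u₀ F₀ (δ k) t -
        numF Finf α u₀ F₀ (δ k) s) + (numF Finf α u₀ F₀ (δ k) s - F s)) + (F s - F t) := by ring
    have e' : ENNReal.ofReal ε = ENNReal.ofReal (ε / 2) + ENNReal.ofReal (ε / 2) := by
      rw [← ENNReal.ofReal_add (by positivity) (by positivity), add_halves]
    calc eLpNorm (numF Finf α u₀ F₀ (δ k) t - F t) 1 volume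
        ≤ eLpNorm (numF Finf α u₀ F₀ (δ k) t - numF Finf α u₀ F₀ (δ k) s) 1 volume +
          eLpNorm (numF Finf α u₀ F₀ (δ k) s - F s) 1 volume + eLpNorm (F s - F t) 1 volume := by
          rw [e]
          exact (eLpNorm_add_le (m1.add m2) m3 le_rfl).trans
            (add_le_add_left (eLpNorm_add_le m1 m2 le_rfl) _)
      _ ≤ ENNReal.ofReal (ε / 2) + eLpNorm (numF Finf α u₀ F₀ (δ k) s - F s) 1 volume +
          ENNReal.ofReal (ε / 2) := by gcongr
      _ = _ := by rw [e']; ring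
  rw [ENNReal.tendsto_nhds_zero]
  intro ε hε
  obtain ⟨ε', h1, h2⟩ := ENNReal.lt_iff_exists_nnreal_btwn.1 hε
  filter_upwards [key ε' (by exact_mod_cast h1)] with k hk
  refine iSup₂_le fun t ht => (hk t ht).trans ?_
  rw [ENNReal.ofReal_coe_nnreal]
  exact h2.le

theorem isSchemeLimit (h : IsPointwiseLimit Finf α u₀ F₀ δ u F)
    (hI : InitData Finf M₀ R u₀ F₀) (hF : 0 < Finf) (hα : α ∈ Ioc (0 : ℝ) 1) :
    IsSchemeLimit Finf α u₀ F₀ δ u F where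
  tendsto_u _ hT := h.tendstoUniformlyOn hI hF hα hT
  tendsto_F _ hT := h.tendsto_iSup_eLpNorm hI hF hα hT
  cont_F s hs := by
    set A := speed Finf α M₀ (s + 1)
    have l1 : Tendsto (fun t => ENNReal.ofReal (2 * (A * |t - s|) * Finf)) (𝓝[Ici 0] s) (𝓝 0) := by
      have hc : Continuous fun t => ENNReal.ofReal (2 * (A * |t - s|) * Finf) :=
        ENNReal.continuous_ofReal.comp (by fun_prop)
      simpa using (hc.tendsto s).mono_left (nhdsWithin_le_nhds (s := Ici 0))
    refine tendsto_of_tendsto_of_tendsto_of_le_of_le' tendsto_const_nhds l1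
      (Eventually.of_forall fun _ => zero_le) ?_
    filter_upwards [self_mem_nhdsWithin, nhdsWithin_le_nhds (gt_mem_nhds (lt_add_one s))] with t h1 h2
    exact h.eLpNorm_F_sub_le hI hF hα ⟨hs, by linarith⟩ ⟨h1, h2.le⟩
  tendsto_F_ae := h.tendsto_F
  leftCont_F := h.leftCont

end IsPointwiseLimit

end Uniform

end HunterSaxton

end

/-! ### The theorem -/

open HunterSaxton in
theorem mainTheorem2 (Finf α : ℝ) (hFinf : 0 < Finf) (hα : α ∈ Set.Ioc (0 : ℝ) 1)
    (u₀ F₀ : ℝ → ℝ) (h₀ : InD Finf u₀ F₀) (hsupp : IsCompact (distMeasure F₀).support) :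
    -- every sequence of grid sizes tending to zero has a subsequence along which the scheme
    -- converges
    (∀ δ : ℕ → ℝ, (∀ k, 0 < δ k) → Tendsto δ atTop (𝓝 0) →
      ∃ κ : ℕ → ℕ, StrictMono κ ∧ ∃ u F : ℝ → ℝ → ℝ,
        IsSchemeLimit Finf α u₀ F₀ (δ ∘ κ) u F) ∧
    -- every such limit is a conservative solution
    (∀ δ : ℕ → ℝ, (∀ k, 0 < δ k) → Tendsto δ atTop (𝓝 0) →
      ∀ u F : ℝ → ℝ → ℝ, IsSchemeLimit Finf α u₀ F₀ δ u F →
        IsConservativeSolution Finf u₀ F₀ u F) ∧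
    -- the residuals of the numerical solutions in both weak equations are of order `√Δx`
    (∀ φ : ℝ → ℝ → ℝ, IsTestFunction φ →
      (∀ Δx : ℝ, 0 < Δx →
        IntegrableOn (innerU Finf (numU Finf α u₀ F₀ Δx) (numF Finf α u₀ F₀ Δx) φ) (Ioi 0) ∧
        IntegrableOn (innerF (numU Finf α u₀ F₀ Δx) (numF Finf α u₀ F₀ Δx) φ) (Ioi 0)) ∧
      (fun Δx => weakU Finf (numU Finf α u₀ F₀ Δx 0)
          (numU Finf α u₀ F₀ Δx) (numF Finf α u₀ F₀ Δx) φ) =O[𝓝[>] 0] (fun Δx => √Δx) ∧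
      (fun Δx => weakF (numF Finf α u₀ F₀ Δx 0)
          (numU Finf α u₀ F₀ Δx) (numF Finf α u₀ F₀ Δx) φ) =O[𝓝[>] 0] (fun Δx => √Δx)) := by
  obtain ⟨M₀, R, hI⟩ := h₀.exists_initData hFinf.le hsupp
  refine ⟨fun δ hδ hδ₀ => ?_, fun δ hδ hδ₀ u F h => ?_, fun φ hφ => ?_⟩
  · obtain ⟨κ, hκ, u, F, h⟩ := hI.exists_isPointwiseLimit hFinf hα hδ hδ₀
    exact ⟨κ, hκ, u, F, h.isSchemeLimit hI hFinf hα⟩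
  · exact (h.isPointwiseLimit hδ hδ₀).isConservativeSolution hI hFinf hα h₀.leftCont_F
  · obtain ⟨B, L, hB⟩ := hφ.exists_testBound
    exact ⟨fun Δx hΔx => hI.integrableOn_inner hFinf hα hΔx hB, hI.weakU_isBigO hFinf hα hB,
      hI.weakF_isBigO hFinf hα hB⟩
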